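/- Let $(X,d_X)$ be a metric space with at least two points, and $\mu$ a $\sigma$-finite Borel measure on $X$ such that all balls have positive finite measure. Write $L^p=L^p(X,\mu;\mathbb C)$, and let $B(x,r)$ be the open ball. The notation $u\lesssim v$ means $u\le Cv$ with a constant $C$ independent of the points, functions, sets and of the scales $r,t$. A restriction marked by $(*)$ is imposed only if $X$ is bounded. Assume: (doubling) for some $d>0$, $\mu(B(x,tr))\lesssim t^d\mu(B(x,r))$ for all $x\in X$, $r>0$, $t\ge1$; (lower volume bound) for some $\nu>0$, $r^\nu\lesssim\mu(B(x,r))$ for all $x\in X$ and $0<r\lesssim\min(1,\operatorname{diam}X)$. Let $H$ be a densely defined, nonnegative, self-adjoint operator on $L^2$ with (Davies–Gaffney) $\|e^{-tH}\|_{L^2(E)\to L^2(F)}\lesssim e^{-d_X(E,F)^2/(4t)}$ for all measurable $E,F\subset X$ and $t>0$ [$t\lesssim\operatorname{diam}X$ $(*)$]; (DUE) for every $t>0$, $e^{-tH}$ has an integral kernel $p_t$, and $0\le p_t(x,x)\lesssim 1/\mu(B(x,\sqrt t))$ for all $t>0$ and a.e. $x$, where $p_t(x,x)=\int|p_{t/2}(x,y)|^2\,d\mu(y)$.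 Let $M$ be an integer with $M\ge\min(\frac34+\frac{3d}8,3)$ and put $B_Q=(1-e^{-r^2H})^M$ for a ball $Q$ of radius $r$. An *atom* is a function $a=B_Qf_Q$, where $Q$ is a ball, $f_Q\in L^2$ vanishes outside $Q$, and $\|f_Q\|_{L^2}\le\mu(Q)^{-1/2}$. The Hardy space $H^1$ is the space of measurable functions $h=\sum_{i\in\mathbb N}\lambda_ia_i$ (a.e.) with atoms $a_i$ and real $\lambda_i$, $\sum|\lambda_i|<\infty$, and $\|h\|_{H^1}$ is the infimum of $\sum|\lambda_i|$ over all such decompositions. For $f\in L^\infty+L^2$ let $\|f\|_{BMO}=\sup_Q\big(\frac1{\mu(Q)}\int_Q|B_Qf|^2d\mu\big)^{1/2}$, where $Q$ runs over all balls and $B_Q$ is extended from $L^2$ to $L^\infty+L^2$ by duality ($\int (B_Qf)\overline\varphi\,d\mu=\int f\,\overline{B_Q\varphi}\,d\mu$ for $\varphi\in L^2$ with bounded support). $BMO$ is the closure (completion) of $\{f\in L^\infty+L^2:\|f\|_{BMO}<\infty\}$ for this norm (functions at distance $0$ being identified). Let $\psi_m(x)=x^me^{-x}$, let $\kappa>0$,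 and let $m$ be an integer with $\frac d2\le m\le\frac{4M}3$. Then there is a constant $C$, depending only on $X,\mu,d,H,M,m,\kappa$, such that the following holds for every $A>0$ and every bounded operator $T$ on $L^2$ that commutes with $H$ (that is, $T$ maps the domain of $H$ into itself and $THf=HTf$ there) and satisfies $(H_m(A))$ $\ \|T\psi_m(r^2H)\|_{L^2(B)\to L^2(\widetilde B)}\le A\,\mu(B)^{1/2}\mu(\widetilde B)^{1/2}$ for any two balls $B,\widetilde B$ of the same radius $r>0$ [$r\le\kappa\operatorname{diam}X$ $(*)$]. The operators $T$ and $Te^{-sH}$, for all $s>0$, map $H^1\cap L^2$ into $BMO$, extend from $H^1\cap L^2$ to continuous operators $H^1\to BMO$, and $$\|T\|_{H^1\to BMO}+\sup_{s>0}\|Te^{-sH}\|_{H^1\to BMO}\le C\,A.$$ In particular they extend to continuous operators from $H^1$ to its dual $(H^1)^*$ (a function $u$ acting by $k\mapsto\int\overline u\,k\,d\mu$ for $k\in H^1\cap L^2$), and $\|T\|_{H^1\to(H^1)^*}+\sup_{s>0}\|Te^{-sH}\|_{H^1\to(H^1)^*}\le C\,A$. -/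

import Mathlib

open MeasureTheory Filter Topology Set
open scoped ENNReal NNReal InnerProductSpace

noncomputable section

namespace HardyBMO

/-! ## Functional calculus of a nonnegative self-adjoint operator -/

section FunctionalCalculus

variable {E : Type*} [NormedAddCommGroup E] [InnerProductSpace ℂ E] [CompleteSpace E]

/-- `H` is a densely defined, nonnegative, self-adjoint (in general unbounded) operator. -/
structure IsNonnegSelfAdjoint (H : E →ₗ.[ℂ] E) : Prop where
  dense_domain : Dense (H.domain : Set E)
  selfAdjoint : IsSelfAdjoint H
  nonneg : ∀ f : H.domain, 0 ≤ (⟪H f, (f : E)⟫_ℂ).re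

/-- The bounded operator `T` commutes with the unbounded operator `H`: `T` maps the domain of `H`
into itself and `H T f = T H f` for every `f` in the domain. -/
def CommutesWith (H : E →ₗ.[ℂ] E) (T : E →L[ℂ] E) : Prop :=
  ∀ f : H.domain, ∃ h : T f ∈ H.domain, H ⟨T f, h⟩ = T (H f)

open Classical in
/-- The bounded operator `(1 + H)⁻¹`, i.e. the bounded operator `R` with values in the domain of
`H` such that `(1 + H) R f = f` for all `f`. It exists and is unique if `H` is nonnegative and
self-adjoint. -/
def resolventOp (H : E →ₗ.[ℂ] E) : E →L[ℂ] E :=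
  if h : ∃ R : E →L[ℂ] E, ∀ f, ∃ hf : R f ∈ H.domain, R f + H ⟨R f, hf⟩ = f then h.choose else 0

/-- The operator `g(H)`, for `g` continuous on `[0, ∞)` and vanishing at infinity: as
`H = R⁻¹ - 1` with `R = (1 + H)⁻¹`, whose spectrum lies in `[0, 1]`, it is the continuous function
`s ↦ g (s⁻¹ - 1)` (extended by the value `g(∞) = 0` at `s = 0`) of the bounded self-adjoint
operator `R`. -/
def functionOf (H : E →ₗ.[ℂ] E) (g : ℝ → ℝ) : E →L[ℂ] E :=
  cfc (fun s : ℝ => if 0 < s then g (s⁻¹ - 1) else 0) (resolventOp H)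

/-- The heat operator `e^{-tH}`, for `t > 0`. -/
def heat (H : E →ₗ.[ℂ] E) (t : ℝ) : E →L[ℂ] E :=
  functionOf H fun x => Real.exp (-(t * x))

/-- The function `ψ_m(x) = x^m e^{-x}`. -/
def psi (m : ℕ) (x : ℝ) : ℝ := x ^ m * Real.exp (-x)

/-- The operator `ψ_m(tH)`, for `t > 0`. -/
def psiOp (H : E →ₗ.[ℂ] E) (m : ℕ) (t : ℝ) : E →L[ℂ] E :=
  functionOf H fun x => psi m (t * x)

/-- The operator `B_Q = (1 - e^{-r²H})^M` for a ball `Q` of radius `r`. -/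
def ballOp (H : E →ₗ.[ℂ] E) (M : ℕ) (r : ℝ) : E →L[ℂ] E :=
  (1 - heat H (r ^ 2)) ^ M

end FunctionalCalculus

/-! ## The metric measure space -/

section Space

variable {X : Type*} [MetricSpace X] [MeasurableSpace X]

/-- All balls have positive finite measure, and `μ(B(x,tr)) ≲ t^d μ(B(x,r))` for `t ≥ 1`. -/
def Doubling (μ : Measure X) (d : ℝ) : Prop :=
  (∀ (x : X) (r : ℝ), 0 < r → 0 < μ (Metric.ball x r) ∧ μ (Metric.ball x r) < ∞) ∧
  ∃ C : ℝ, 0 < C ∧ ∀ (x : X) (r t : ℝ), 0 < r → 1 ≤ t →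
    μ.real (Metric.ball x (t * r)) ≤ C * t ^ d * μ.real (Metric.ball x r)

variable (X) in
/-- The restriction `r ≤ κ diam X`, imposed only if `X` is bounded. -/
def BelowDiam (κ r : ℝ) : Prop :=
  Bornology.IsBounded (univ : Set X) → r ≤ κ * Metric.diam (univ : Set X)

/-- The lower volume bound: `r^ν ≲ μ(B(x,r))` for `r ≲ min(1, diam X)` and some `ν > 0`. -/
def LowerVolumeBound (μ : Measure X) : Prop :=
  ∃ ν c κ : ℝ, 0 < ν ∧ 0 < c ∧ 0 < κ ∧ ∀ (x : X) (r : ℝ), 0 < r → r ≤ κ → BelowDiam X κ r →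
    c * r ^ ν ≤ μ.real (Metric.ball x r)

/-- The distance `inf {d(x,y) : x ∈ E, y ∈ F}` between two sets. -/
def setDist (E F : Set X) : ℝ := ⨅ p : E × F, dist (p.1 : X) (p.2 : X)

end Space

/-! ## Operators on `L²(X, μ)` with complex scalars -/

section Operators

variable {X : Type*} [MetricSpace X] [MeasurableSpace X] {μ : Measure X}

/-- `f` vanishes almost everywhere outside of `E`. -/
def SupportedIn (f : Lp ℂ 2 μ) (E : Set X) : Prop := ∀ᵐ x ∂μ, x ∉ E → f x = 0

/-- `‖T‖_{L²(E) → L²(F)} ≤ K`. -/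
def LocalNormLE (T : Lp ℂ 2 μ →L[ℂ] Lp ℂ 2 μ) (E F : Set X) (K : ℝ) : Prop :=
  ∀ f : Lp ℂ 2 μ, SupportedIn f E →
    eLpNorm (T f) 2 (μ.restrict F) ≤ ENNReal.ofReal (K * ‖f‖)

/-- Davies–Gaffney estimates `‖e^{-tH}‖_{L²(E) → L²(F)} ≲ e^{-d(E,F)²/(4t)}` for all `t > 0`
(only for `t ≲ diam X` if `X` is bounded). -/
def DaviesGaffney (H : Lp ℂ 2 μ →ₗ.[ℂ] Lp ℂ 2 μ) : Prop :=
  ∃ C κ : ℝ, 0 < C ∧ 0 < κ ∧ ∀ t : ℝ, 0 < t → BelowDiam X κ t →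
    ∀ E F : Set X, MeasurableSet E → MeasurableSet F →
      LocalNormLE (heat H t) E F (C * Real.exp (-(setDist E F ^ 2 / (4 * t))))

/-- `p t` is an integral kernel of `e^{-tH}` for every `t > 0`. -/
def IsHeatKernel (H : Lp ℂ 2 μ →ₗ.[ℂ] Lp ℂ 2 μ) (p : ℝ → X → X → ℂ) : Prop :=
  ∀ t : ℝ, 0 < t →
    AEStronglyMeasurable (Function.uncurry (p t)) (μ.prod μ) ∧
    ∀ f : Lp ℂ 2 μ, ∀ᵐ x ∂μ, heat H t f x = ∫ y, p t x y * f y ∂μ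

/-- The value `p_t(x,x)` of the heat kernel on the diagonal. A kernel of `e^{-tH}` is determined
only almost everywhere on `X × X`, so its diagonal values are the ones given by the semigroup law
and the Hermitian symmetry `p_t(y,x) = conj (p_t(x,y))`:
`p_t(x,x) = ∫ p_{t/2}(x,y) p_{t/2}(y,x) dμ(y) = ∫ |p_{t/2}(x,y)|² dμ(y) ∈ [0,∞]`. -/
def diagKernel (μ : Measure X) (p : ℝ → X → X → ℂ) (t : ℝ) (x : X) : ℝ≥0∞ :=
  ∫⁻ y, ‖p (t / 2) x y‖ₑ ^ 2 ∂μ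

/-- On-diagonal upper estimates: for every `t > 0` the operator `e^{-tH}` has a kernel `p_t`, and
`0 ≤ p_t(x,x) ≲ 1 / μ(B(x,√t))` for all `t > 0` and almost every `x`. -/
def DUE (H : Lp ℂ 2 μ →ₗ.[ℂ] Lp ℂ 2 μ) : Prop :=
  ∃ p : ℝ → X → X → ℂ, IsHeatKernel H p ∧ ∃ C : ℝ, 0 < C ∧ ∀ t : ℝ, 0 < t → ∀ᵐ x ∂μ,
    diagKernel μ p t x ≤ ENNReal.ofReal C / μ (Metric.ball x (Real.sqrt t))

/-- Property `H_m(A)` of `T`: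
`‖T ψ_m(r²H)‖_{L²(B) → L²(B')} ≤ A μ(B)^{1/2} μ(B')^{1/2}` for any two balls `B`, `B'` of the same
radius `r > 0` (only for `r ≤ κ diam X` if `X` is bounded). -/
def PropertyH (H : Lp ℂ 2 μ →ₗ.[ℂ] Lp ℂ 2 μ) (κ : ℝ) (m : ℕ) (A : ℝ)
    (T : Lp ℂ 2 μ →L[ℂ] Lp ℂ 2 μ) : Prop :=
  ∀ r : ℝ, 0 < r → BelowDiam X κ r → ∀ x y : X,
    LocalNormLE (T ∘L psiOp H m (r ^ 2)) (Metric.ball x r) (Metric.ball y r)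
      (A * μ.real (Metric.ball x r) ^ (1 / 2 : ℝ) * μ.real (Metric.ball y r) ^ (1 / 2 : ℝ))

/-! ## The atomic Hardy space -/

/-- Atoms: `a = B_Q f_Q` with `f_Q` supported in the ball `Q` and
`‖f_Q‖_{L²} ≤ μ(Q)^{-1/2}`. -/
def IsAtom (H : Lp ℂ 2 μ →ₗ.[ℂ] Lp ℂ 2 μ) (M : ℕ) (a : Lp ℂ 2 μ) : Prop :=
  ∃ (x : X) (r : ℝ) (f : Lp ℂ 2 μ), 0 < r ∧ SupportedIn f (Metric.ball x r) ∧
    ‖f‖ ≤ μ.real (Metric.ball x r) ^ (-(1 / 2) : ℝ) ∧ a = ballOp H M r f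

/-- `h = ∑ i, l i • a i` almost everywhere, where the `a i` are atoms and `∑ i, |l i| < ∞`. -/
structure IsAtomicDecomposition (H : Lp ℂ 2 μ →ₗ.[ℂ] Lp ℂ 2 μ) (M : ℕ) (h : X →ₘ[μ] ℂ)
    (l : ℕ → ℝ) (a : ℕ → Lp ℂ 2 μ) : Prop where
  atom : ∀ i, IsAtom H M (a i)
  summable : Summable fun i => |l i|
  ae_tendsto : ∀ᵐ x ∂μ,
    Tendsto (fun n => ∑ i ∈ Finset.range n, (l i : ℂ) * a i x) atTop (𝓝 (h x))

/-- The values `∑ i, |l i|` over all atomic decompositions of `h`. -/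
def atomicCosts (H : Lp ℂ 2 μ →ₗ.[ℂ] Lp ℂ 2 μ) (M : ℕ) (h : X →ₘ[μ] ℂ) : Set ℝ :=
  {c | ∃ l a, IsAtomicDecomposition H M h l a ∧ c = ∑' i, |l i|}

/-- The Hardy norm: the infimum of `∑ i, |l i|` over all atomic decompositions. -/
def hardyNorm (H : Lp ℂ 2 μ →ₗ.[ℂ] Lp ℂ 2 μ) (M : ℕ) (h : X →ₘ[μ] ℂ) : ℝ :=
  sInf (atomicCosts H M h)

variable {H : Lp ℂ 2 μ →ₗ.[ℂ] Lp ℂ 2 μ} {M : ℕ}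

theorem atomicCosts_bddBelow (h : X →ₘ[μ] ℂ) : BddBelow (atomicCosts H M h) := by
  refine ⟨0, ?_⟩
  rintro c ⟨l, a, -, rfl⟩
  exact tsum_nonneg fun i => abs_nonneg _

theorem IsAtom.smul {a : Lp ℂ 2 μ} (ha : IsAtom H M a) {u : ℂ} (hu : ‖u‖ ≤ 1) :
    IsAtom H M (u • a) := by
  obtain ⟨x, r, f, hr, hs, hf, rfl⟩ := ha
  refine ⟨x, r, u • f, hr, ?_, ?_, by simp⟩
  · filter_upwards [hs, Lp.coeFn_smul u f] with y hy hy' hyx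
    simp [hy', hy hyx]
  · rw [norm_smul]
    exact (mul_le_of_le_one_left (norm_nonneg f) hu).trans hf

theorem IsAtomicDecomposition.smul {h : X →ₘ[μ] ℂ} {l : ℕ → ℝ} {a : ℕ → Lp ℂ 2 μ}
    (hd : IsAtomicDecomposition H M h l a) (c : ℂ) :
    IsAtomicDecomposition H M (c • h) (fun i => ‖c‖ * l i) (fun i => (c / ‖c‖ : ℂ) • a i) := by
  refine ⟨fun i => (hd.atom i).smul ?_, ?_, ?_⟩
  · rw [norm_div]
    simpa using div_self_le_one ‖c‖
  · simpa [abs_mul] using hd.summable.mul_left ‖c‖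
  · have h2 : ∀ᵐ x ∂μ, ∀ i, ((c / ‖c‖ : ℂ) • a i : Lp ℂ 2 μ) x = (c / ‖c‖ : ℂ) • a i x :=
      ae_all_iff.2 fun i => Lp.coeFn_smul _ _
    filter_upwards [hd.ae_tendsto, h2, AEEqFun.coeFn_smul c h] with x hx hx2 hx3
    rw [hx3]
    refine (hx.const_smul c).congr fun n => ?_
    rw [Finset.smul_sum]
    refine Finset.sum_congr rfl fun i _ => ?_
    rw [hx2 i]
    by_cases hc : c = 0
    · simp [hc]
    · have : (‖c‖ : ℂ) ≠ 0 := by simpa using hc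
      simp only [smul_eq_mul, Complex.ofReal_mul]
      field_simp

/-- The sequence that takes alternately the values of two sequences. -/
def interleave {α : Type*} (u v : ℕ → α) (n : ℕ) : α := if Even n then u (n / 2) else v (n / 2)

theorem interleave_even {α : Type*} (u v : ℕ → α) (n : ℕ) : interleave u v (2 * n) = u n := by
  simp [interleave]

theorem interleave_odd {α : Type*} (u v : ℕ → α) (n : ℕ) :
    interleave u v (2 * n + 1) = v n := by
  have : (2 * n + 1) / 2 = n := by omega
  simp [interleave, this]

theorem tendsto_sum_interleave {u v : ℕ → ℂ} {a b : ℂ}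
    (hu : Tendsto (fun n => ∑ i ∈ Finset.range n, u i) atTop (𝓝 a))
    (hv : Tendsto (fun n => ∑ i ∈ Finset.range n, v i) atTop (𝓝 b)) :
    Tendsto (fun n => ∑ i ∈ Finset.range n, interleave u v i) atTop (𝓝 (a + b)) := by
  have key : ∀ n, ∑ i ∈ Finset.range n, interleave u v i =
      ∑ i ∈ Finset.range ((n + 1) / 2), u i + ∑ i ∈ Finset.range (n / 2), v i := by
    intro n
    induction n with
    | zero => simp
    | succ n ih =>
      rw [Finset.sum_range_succ, ih]
      rcases Nat.even_or_odd' n with ⟨k, rfl | rfl⟩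
      · have h1 : (2 * k + 1) / 2 = k := by omega
        have h2 : (2 * k + 1 + 1) / 2 = k + 1 := by omega
        have h3 : 2 * k / 2 = k := by omega
        rw [h1, h2, h3, interleave_even, Finset.sum_range_succ]
        ring
      · have h1 : (2 * k + 1) / 2 = k := by omega
        have h2 : (2 * k + 1 + 1) / 2 = k + 1 := by omega
        have h3 : (2 * k + 1 + 1 + 1) / 2 = k + 1 := by omega
        rw [h1, h2, h3, interleave_odd, Finset.sum_range_succ v]
        ring
  simp_rw [key]
  have t1 : Tendsto (fun n : ℕ => n / 2) atTop atTop := Nat.tendsto_div_const_atTop (by norm_num)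
  exact (hu.comp (t1.comp (tendsto_add_atTop_nat 1))).add (hv.comp t1)

theorem hasSum_interleave {u v : ℕ → ℝ} (hu : Summable u) (hv : Summable v) :
    HasSum (interleave u v) (∑' i, u i + ∑' i, v i) := by
  refine HasSum.even_add_odd ?_ ?_
  · simpa [interleave_even] using hu.hasSum
  · simpa [interleave_odd] using hv.hasSum

theorem IsAtomicDecomposition.add {h₁ h₂ : X →ₘ[μ] ℂ} {l₁ l₂ : ℕ → ℝ} {a₁ a₂ : ℕ → Lp ℂ 2 μ}
    (hd₁ : IsAtomicDecomposition H M h₁ l₁ a₁) (hd₂ : IsAtomicDecomposition H M h₂ l₂ a₂) :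
    IsAtomicDecomposition H M (h₁ + h₂) (interleave l₁ l₂) (interleave a₁ a₂) ∧
      ∑' i, |interleave l₁ l₂ i| = ∑' i, |l₁ i| + ∑' i, |l₂ i| := by
  have habs : (fun i => |interleave l₁ l₂ i|) =
      interleave (fun i => |l₁ i|) (fun i => |l₂ i|) := by
    funext i
    simp only [interleave]
    split_ifs <;> rfl
  have hs := hasSum_interleave hd₁.summable hd₂.summable
  rw [← habs] at hs
  refine ⟨⟨fun i => ?_, hs.summable, ?_⟩, hs.tsum_eq⟩
  · simp only [interleave]
    split_ifs
    exacts [hd₁.atom _, hd₂.atom _]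
  · filter_upwards [hd₁.ae_tendsto, hd₂.ae_tendsto, AEEqFun.coeFn_add h₁ h₂] with x h1 h2 h3
    rw [h3]
    refine (tendsto_sum_interleave h1 h2).congr fun n => Finset.sum_congr rfl fun i _ => ?_
    simp only [interleave]
    split_ifs <;> rfl

theorem isAtomicDecomposition_zero [Nonempty X] :
    IsAtomicDecomposition H M (0 : X →ₘ[μ] ℂ) 0 0 := by
  refine ⟨fun i => ⟨Classical.arbitrary X, 1, 0, one_pos, ?_, ?_, by simp⟩, by simp, ?_⟩
  · filter_upwards [Lp.coeFn_zero ℂ 2 μ] with y hy _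
    exact hy
  · simpa using Real.rpow_nonneg measureReal_nonneg _
  · filter_upwards [AEEqFun.coeFn_zero (μ := μ) (β := ℂ)] with x hx
    simp [hx]

theorem hardyNorm_nonneg (h : X →ₘ[μ] ℂ) : 0 ≤ hardyNorm H M h := by
  refine Real.sInf_nonneg ?_
  rintro c ⟨l, a, -, rfl⟩
  exact tsum_nonneg fun i => abs_nonneg _

section HardySpace

variable [Nonempty X]

variable (H M) in
/-- The functions that have an atomic decomposition. -/
def hardySubmodule : Submodule ℂ (X →ₘ[μ] ℂ) where
  carrier := {h | ∃ l a, IsAtomicDecomposition H M h l a}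
  zero_mem' := ⟨0, 0, isAtomicDecomposition_zero⟩
  add_mem' := by
    rintro _ _ ⟨l₁, a₁, h₁⟩ ⟨l₂, a₂, h₂⟩
    exact ⟨_, _, (h₁.add h₂).1⟩
  smul_mem' := by
    rintro c _ ⟨l, a, h⟩
    exact ⟨_, _, h.smul c⟩

variable (H M) in
/-- The atomic Hardy space `H¹`. -/
def Hardy : Type _ := hardySubmodule H M

instance : AddCommGroup (Hardy H M) := inferInstanceAs (AddCommGroup (hardySubmodule H M))

instance : Module ℂ (Hardy H M) := inferInstanceAs (Module ℂ (hardySubmodule H M))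

/-- The measurable function (up to a.e. equality) underlying an element of `H¹`. -/
def Hardy.toFun (h : Hardy H M) : X →ₘ[μ] ℂ := Subtype.val (p := (· ∈ hardySubmodule H M)) h

theorem Hardy.costs_nonempty (h : Hardy H M) : (atomicCosts H M h.toFun).Nonempty := by
  obtain ⟨l, a, hd⟩ := Subtype.property (p := (· ∈ hardySubmodule H M)) h
  exact ⟨_, l, a, hd, rfl⟩

variable (H M) in
/-- The Hardy norm as a seminorm on `H¹`. -/
def hardySeminorm : Seminorm ℂ (Hardy H M) :=
  Seminorm.ofSMulLE (fun h => hardyNorm H M h.toFun)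
    (le_antisymm
      (csInf_le (atomicCosts_bddBelow _) ⟨0, 0, isAtomicDecomposition_zero, by simp⟩)
      (hardyNorm_nonneg _))
    (by
      intro f g
      refine le_of_forall_pos_le_add fun ε hε => ?_
      obtain ⟨_, ⟨l₁, a₁, h₁, rfl⟩, hc₁⟩ :=
        exists_lt_of_csInf_lt f.costs_nonempty (lt_add_of_pos_right _ (half_pos hε))
      obtain ⟨_, ⟨l₂, a₂, h₂, rfl⟩, hc₂⟩ :=
        exists_lt_of_csInf_lt g.costs_nonempty (lt_add_of_pos_right _ (half_pos hε))
      have hadd := h₁.add h₂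
      have : hardyNorm H M (f + g).toFun ≤ ∑' i, |l₁ i| + ∑' i, |l₂ i| :=
        csInf_le (atomicCosts_bddBelow _) ⟨_, _, hadd.1, hadd.2.symm⟩
      simp only [hardyNorm] at *
      linarith)
    (by
      intro c f
      have : ∀ y ∈ atomicCosts H M f.toFun, hardyNorm H M (c • f).toFun ≤ ‖c‖ * y := by
        rintro _ ⟨l, a, h, rfl⟩
        refine csInf_le (atomicCosts_bddBelow _) ⟨_, _, h.smul c, ?_⟩
        simp [abs_mul, tsum_mul_left]
      rcases (norm_nonneg c).eq_or_lt with hc | hc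
      · obtain ⟨y, hy⟩ := f.costs_nonempty
        have := this y hy
        simpa [← hc] using this
      · rw [← div_le_iff₀' hc]
        refine le_csInf f.costs_nonempty fun y hy => ?_
        rw [div_le_iff₀' hc]
        exact this y hy)

instance : SeminormedAddCommGroup (Hardy H M) :=
  (hardySeminorm H M).toAddGroupSeminorm.toSeminormedAddCommGroup

instance : NormedSpace ℂ (Hardy H M) where
  norm_smul_le c f := (map_smul_eq_mul (hardySeminorm H M) c f).le

end HardySpace

/-! ## The space `BMO` -/

variable (H M) in
/-- `g = B_Q f` for balls `Q` of radius `r`, where `f` need not belong to `L²`: as `B_Q` is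
self-adjoint, `∫ g conj(φ) = ∫ f conj(B_Q φ)` for all `φ ∈ L²` with bounded support. This determines
`g` up to a.e. equality; it gives back the operator `B_Q` on `L²`, and on `L^∞` it gives the
operator with the same integral kernel. -/
def IsBallOpOf (r : ℝ) (f g : X →ₘ[μ] ℂ) : Prop :=
  ∀ φ : Lp ℂ 2 μ, (∃ (x : X) (R : ℝ), SupportedIn φ (Metric.ball x R)) →
    Integrable (fun y => ⟪φ y, g y⟫_ℂ) μ ∧ Integrable (fun y => ⟪ballOp H M r φ y, f y⟫_ℂ) μ ∧
    ∫ y, ⟪φ y, g y⟫_ℂ ∂μ = ∫ y, ⟪ballOp H M r φ y, f y⟫_ℂ ∂μ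

/-- The quadratic mean `(μ(Q)⁻¹ ∫_Q |g|² dμ)^{1/2}` over the ball `Q = B(x,r)`. -/
def quadMean (x : X) (r : ℝ) (g : X →ₘ[μ] ℂ) : ℝ≥0∞ :=
  eLpNorm g 2 (μ.restrict (Metric.ball x r)) / μ (Metric.ball x r) ^ (1 / 2 : ℝ)

variable (H M) in
/-- `‖f‖_BMO = sup_Q (μ(Q)⁻¹ ∫_Q |B_Q f|² dμ)^{1/2}`, the supremum being over all balls `Q`. (The
infimum is over the single class `g = B_Q f`; it is `∞` if `B_Q f` is not defined.) -/
def bmoNorm (f : X →ₘ[μ] ℂ) : ℝ≥0∞ :=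
  ⨆ (x : X) (r : ℝ) (_ : 0 < r), ⨅ (g : X →ₘ[μ] ℂ) (_ : IsBallOpOf H M r f g), quadMean x r g

theorem IsBallOpOf.add {r : ℝ} {f₁ f₂ g₁ g₂ : X →ₘ[μ] ℂ} (h₁ : IsBallOpOf H M r f₁ g₁)
    (h₂ : IsBallOpOf H M r f₂ g₂) : IsBallOpOf H M r (f₁ + f₂) (g₁ + g₂) := by
  intro φ hφ
  obtain ⟨i₁, j₁, e₁⟩ := h₁ φ hφ
  obtain ⟨i₂, j₂, e₂⟩ := h₂ φ hφ
  have hg : (fun y => ⟪φ y, (g₁ + g₂) y⟫_ℂ) =ᵐ[μ]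
      fun y => ⟪φ y, g₁ y⟫_ℂ + ⟪φ y, g₂ y⟫_ℂ := by
    filter_upwards [AEEqFun.coeFn_add g₁ g₂] with y hy
    rw [hy, Pi.add_apply, inner_add_right]
  have hf : (fun y => ⟪ballOp H M r φ y, (f₁ + f₂) y⟫_ℂ) =ᵐ[μ]
      fun y => ⟪ballOp H M r φ y, f₁ y⟫_ℂ + ⟪ballOp H M r φ y, f₂ y⟫_ℂ := by
    filter_upwards [AEEqFun.coeFn_add f₁ f₂] with y hy
    rw [hy, Pi.add_apply, inner_add_right]
  refine ⟨(integrable_congr hg).2 (i₁.add i₂), (integrable_congr hf).2 (j₁.add j₂), ?_⟩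
  rw [integral_congr_ae hg, integral_congr_ae hf, integral_add i₁ i₂, integral_add j₁ j₂, e₁, e₂]

theorem IsBallOpOf.smul {r : ℝ} {f g : X →ₘ[μ] ℂ} (h : IsBallOpOf H M r f g) (c : ℂ) :
    IsBallOpOf H M r (c • f) (c • g) := by
  intro φ hφ
  obtain ⟨i, j, e⟩ := h φ hφ
  have hg : (fun y => ⟪φ y, (c • g) y⟫_ℂ) =ᵐ[μ] fun y => c * ⟪φ y, g y⟫_ℂ := by
    filter_upwards [AEEqFun.coeFn_smul c g] with y hy
    rw [hy, Pi.smul_apply, inner_smul_right]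
  have hf : (fun y => ⟪ballOp H M r φ y, (c • f) y⟫_ℂ) =ᵐ[μ]
      fun y => c * ⟪ballOp H M r φ y, f y⟫_ℂ := by
    filter_upwards [AEEqFun.coeFn_smul c f] with y hy
    rw [hy, Pi.smul_apply, inner_smul_right]
  refine ⟨(integrable_congr hg).2 (i.const_mul c), (integrable_congr hf).2 (j.const_mul c), ?_⟩
  rw [integral_congr_ae hg, integral_congr_ae hf, integral_const_mul, integral_const_mul, e]

theorem isBallOpOf_zero (r : ℝ) : IsBallOpOf H M r (0 : X →ₘ[μ] ℂ) 0 := by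
  intro φ _
  have h0 : ∀ ψ : X → ℂ, (fun y => ⟪ψ y, (0 : X →ₘ[μ] ℂ) y⟫_ℂ) =ᵐ[μ] fun _ => 0 := by
    intro ψ
    filter_upwards [AEEqFun.coeFn_zero (μ := μ) (β := ℂ)] with y hy
    rw [hy, Pi.zero_apply, inner_zero_right]
  refine ⟨(integrable_congr (h0 _)).2 (integrable_zero _ _ _),
    (integrable_congr (h0 _)).2 (integrable_zero _ _ _), ?_⟩
  rw [integral_congr_ae (h0 _), integral_congr_ae (h0 _)]

theorem quadMean_zero (x : X) (r : ℝ) : quadMean x r (0 : X →ₘ[μ] ℂ) = 0 := by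
  rw [quadMean, eLpNorm_congr_ae (ae_restrict_of_ae AEEqFun.coeFn_zero)]
  simp

theorem quadMean_add_le (x : X) (r : ℝ) (g₁ g₂ : X →ₘ[μ] ℂ) :
    quadMean x r (g₁ + g₂) ≤ quadMean x r g₁ + quadMean x r g₂ := by
  rw [quadMean, eLpNorm_congr_ae (ae_restrict_of_ae (AEEqFun.coeFn_add g₁ g₂)), quadMean, quadMean,
    ← ENNReal.add_div]
  gcongr
  exact eLpNorm_add_le g₁.aestronglyMeasurable.restrict g₂.aestronglyMeasurable.restrict
    (by norm_num)

theorem quadMean_smul (x : X) (r : ℝ) (c : ℂ) (g : X →ₘ[μ] ℂ) :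
    quadMean x r (c • g) = ‖c‖ₑ * quadMean x r g := by
  rw [quadMean, eLpNorm_congr_ae (ae_restrict_of_ae (AEEqFun.coeFn_smul c g)), quadMean,
    eLpNorm_const_smul, mul_div_assoc]

theorem bmoNorm_zero : bmoNorm H M (0 : X →ₘ[μ] ℂ) = 0 := by
  simp only [bmoNorm, ENNReal.iSup_eq_zero]
  intro x r _
  exact le_antisymm ((iInf₂_le 0 (isBallOpOf_zero r)).trans (quadMean_zero x r).le) (by positivity)

theorem bmoNorm_add_le (f₁ f₂ : X →ₘ[μ] ℂ) :
    bmoNorm H M (f₁ + f₂) ≤ bmoNorm H M f₁ + bmoNorm H M f₂ := by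
  refine iSup_le fun x => iSup_le fun r => iSup_le fun hr => ?_
  refine le_trans ?_ (add_le_add
    (le_iSup_of_le x (le_iSup_of_le r (le_iSup_of_le hr le_rfl)))
    (le_iSup_of_le x (le_iSup_of_le r (le_iSup_of_le hr le_rfl))))
  rw [ENNReal.iInf_add]
  refine le_iInf fun g₁ => ?_
  rw [ENNReal.iInf_add]
  refine le_iInf fun h₁ => ?_
  rw [ENNReal.add_iInf]
  refine le_iInf fun g₂ => ?_
  rw [ENNReal.add_iInf]
  refine le_iInf fun h₂ => ?_
  exact iInf₂_le_of_le (g₁ + g₂) (h₁.add h₂) (quadMean_add_le x r g₁ g₂)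

theorem bmoNorm_smul_le (c : ℂ) (f : X →ₘ[μ] ℂ) :
    bmoNorm H M (c • f) ≤ ‖c‖ₑ * bmoNorm H M f := by
  by_cases hc : c = 0
  · have h0 : (0 : ℂ) • f = 0 := zero_smul ℂ f
    rw [hc, h0, bmoNorm_zero]
    positivity
  refine iSup_le fun x => iSup_le fun r => iSup_le fun hr => ?_
  refine le_trans ?_ (mul_le_mul_right
    (le_iSup_of_le x (le_iSup_of_le r (le_iSup_of_le hr le_rfl))) _)
  have h0 : ‖c‖ₑ ≠ 0 := by simpa using hc
  simp only [ENNReal.mul_iInf_of_ne h0 enorm_ne_top, le_iInf_iff]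
  intro g h
  exact (iInf₂_le (c • g) (h.smul c)).trans (quadMean_smul x r c g).le

variable (H M) in
/-- The space `{f ∈ L^∞ + L² : ‖f‖_BMO < ∞}`. -/
def bmoSubmodule : Submodule ℂ (X →ₘ[μ] ℂ) where
  carrier := {f | (∃ g ∈ Lp ℂ ∞ μ, ∃ h ∈ Lp ℂ 2 μ, f = g + h) ∧ bmoNorm H M f < ∞}
  zero_mem' := ⟨⟨0, zero_mem _, 0, zero_mem _, by simp⟩, by simp [bmoNorm_zero]⟩
  add_mem' := by
    rintro _ _ ⟨⟨g₁, hg₁, h₁, hh₁, rfl⟩, b₁⟩ ⟨⟨g₂, hg₂, h₂, hh₂, rfl⟩, b₂⟩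
    exact ⟨⟨g₁ + g₂, add_mem hg₁ hg₂, h₁ + h₂, add_mem hh₁ hh₂, add_add_add_comm _ _ _ _⟩,
      (bmoNorm_add_le _ _).trans_lt (ENNReal.add_lt_top.2 ⟨b₁, b₂⟩)⟩
  smul_mem' := by
    rintro c _ ⟨⟨g, hg, h, hh, rfl⟩, b⟩
    exact ⟨⟨c • g, Lp.const_smul_mem_Lp c ⟨g, hg⟩, c • h, Lp.const_smul_mem_Lp c ⟨h, hh⟩,
      smul_add _ _ _⟩, (bmoNorm_smul_le _ _).trans_lt (ENNReal.mul_lt_top enorm_lt_top b)⟩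

variable (H M) in
/-- The space `{f ∈ L^∞ + L² : ‖f‖_BMO < ∞}` with the seminorm `‖·‖_BMO`. -/
def PreBMO : Type _ := bmoSubmodule H M

instance : AddCommGroup (PreBMO H M) := inferInstanceAs (AddCommGroup (bmoSubmodule H M))

instance : Module ℂ (PreBMO H M) := inferInstanceAs (Module ℂ (bmoSubmodule H M))

/-- The measurable function (up to a.e. equality) underlying an element of `PreBMO`. -/
def PreBMO.toFun (f : PreBMO H M) : X →ₘ[μ] ℂ := Subtype.val (p := (· ∈ bmoSubmodule H M)) f

theorem PreBMO.bmoNorm_lt_top (f : PreBMO H M) : bmoNorm H M f.toFun < ∞ :=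
  (Subtype.property (p := (· ∈ bmoSubmodule H M)) f).2

variable (H M) in
/-- The `BMO` norm as a seminorm. -/
def bmoSeminorm : Seminorm ℂ (PreBMO H M) :=
  Seminorm.ofSMulLE (fun f => (bmoNorm H M f.toFun).toReal)
    (by
      change (bmoNorm H M (0 : X →ₘ[μ] ℂ)).toReal = 0
      simp [bmoNorm_zero])
    (fun f g => (ENNReal.toReal_mono (ENNReal.add_lt_top.2
      ⟨f.bmoNorm_lt_top, g.bmoNorm_lt_top⟩).ne (bmoNorm_add_le f.toFun g.toFun)).trans
        ENNReal.toReal_add_le)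
    (fun c f => (ENNReal.toReal_mono (ENNReal.mul_lt_top enorm_lt_top f.bmoNorm_lt_top).ne
      (bmoNorm_smul_le c f.toFun)).trans (by simp [ENNReal.toReal_mul]))

instance : SeminormedAddCommGroup (PreBMO H M) :=
  (bmoSeminorm H M).toAddGroupSeminorm.toSeminormedAddCommGroup

instance : NormedSpace ℂ (PreBMO H M) where
  norm_smul_le c f := (map_smul_eq_mul (bmoSeminorm H M) c f).le

variable (H M) in
/-- The Banach space `BMO`: the closure (completion) of `{f ∈ L^∞ + L² : ‖f‖_BMO < ∞}` for the
`BMO` norm; functions at zero distance are identified. -/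
abbrev BMO : Type _ := UniformSpace.Completion (PreBMO H M)

/-! ## Extensions of an `L²`-bounded operator -/

section Extension

variable [Nonempty X]

/-- `S` extends the `L²`-bounded operator `T` to a continuous operator from `H¹` to `BMO`: for
`f ∈ H¹ ∩ L²` the function `T f ∈ L²` has finite `BMO` norm, and `S f` is its class in `BMO`. -/
def ExtendsToBMO (T : Lp ℂ 2 μ →L[ℂ] Lp ℂ 2 μ) (S : Hardy H M →L[ℂ] BMO H M) : Prop :=
  ∀ (h : Hardy H M) (f : Lp ℂ 2 μ), h.toFun = (f : X →ₘ[μ] ℂ) →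
    ∃ g : PreBMO H M, g.toFun = (T f : X →ₘ[μ] ℂ) ∧ S h = (g : BMO H M)

/-- `S` extends the `L²`-bounded operator `T` to a continuous operator from `H¹` to its dual
`(H¹)^*`, where a function `u` acts as `k ↦ ∫ conj(u) k` (an antilinear embedding): for
`f, k ∈ H¹ ∩ L²` the functional `S f` takes at `k` the value `∫ conj(T f) k`. -/
def ExtendsToDual (T : Lp ℂ 2 μ →L[ℂ] Lp ℂ 2 μ)
    (S : Hardy H M →L⋆[ℂ] StrongDual ℂ (Hardy H M)) : Prop :=
  ∀ (h k : Hardy H M) (f g : Lp ℂ 2 μ), h.toFun = (f : X →ₘ[μ] ℂ) → k.toFun = (g : X →ₘ[μ] ℂ) →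
    S h k = ⟪T f, g⟫_ℂ

end Extension

end Operators

end HardyBMO

end

set_option linter.unusedSectionVars false

noncomputable section

namespace HardyBMO

/-! ### Functional calculus of `H` through its resolvent -/

section Calculus

variable {E : Type*} [NormedAddCommGroup E] [InnerProductSpace ℂ E] [CompleteSpace E]
  {H : E →ₗ.[ℂ] E}

/-! ### The resolvent -/

/-! Everything rests on one bilinear estimate (`exists_bilinear_bound`): for `f` supported in a ball
`Q` and `g` in a ball `Q'`, `|⟪B_{Q'} g, T B_Q f⟫| ≤ C A μ(Q)^{1/2} μ(Q')^{1/2} ‖f‖ ‖g‖`. Put `D_u =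
e^{-uH} - e^{-2uH}`. By the spectral theorem a positive multiple of the identity equals `∫_0^∞ D_u
ψ_m(uH) D_u du/u` off the kernel of `H`, and `B_Q` annihilates that kernel. Since `T` commutes with
`H`, the pairing becomes the `du/u`-integral of `⟪D_u B_{Q'} g, T ψ_m(uH) D_u B_Q f⟫`.

For fixed `u`, Davies–Gaffney and the on-diagonal bound show that `D_u B_Q f` lives at scale `ρ =
max(r, √u)` around the centre of `Q`: on dyadic shells it decays faster than the square root of the
volume grows. Its amplitude times `μ(B(x,ρ))^{1/2}` is at most `C μ(Q)^{1/2} (‖D_u f‖ + min(u/r²,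
r²/u)^{1/2} ‖f‖)` (`exists_shellDecay`). Property `H_m` at radius `√u ≤ ρ` passes to all larger
balls by covering, because its right-hand side is the square root of a product of volumes, and
volumes add up. Summing over shells bounds the integrand by `A` times the two amplitudes
(`Doubling.exists_inner_le`). Cauchy–Schwarz in `u` and the quadratic estimate for `ψ_1(uH)` finish
the argument (`exists_matrixCoeff_le_of_ballBound`).

The integral is truncated to `[b, 2^n b]`. The lower end is removed by strong continuity of the
functional calculus at `0`. If `X` is unbounded, the upper end disappears because `B_Q` vanishes at
zero energy. If `X` is bounded, `H_m` is known only up to `√u = κ diam X`; there the heat operators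
are Hilbert–Schmidt, so `H` has a spectral gap above `0`, and the remaining low-frequency part
factors through `ψ_m(uH)` at the last admissible `u`.

An `L²` function with an atomic decomposition is the `L¹` limit of the partial sums, not necessarily
the `L²` limit, so `T` cannot be applied term by term. After `e^{-sH}`, which maps `L¹` to `L²` by
the lower volume bound, it can. Estimates for `T e^{-sH}` uniform in `s` are therefore needed for
`T` itself. They follow from `ψ_m(uH) e^{-sH} = (u/(u+s))^m ψ_m((u+s)H)`, where `m ≥ d/2` makes the
prefactor absorb the growth of volume from radius `√u` to `√(u+s)`
(`exists_hasBallBounds_mul_heat`). The bounds on `H¹ ∩ L²` follow as `s → 0`, and density of `H¹ ∩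
L²` gives the extensions. -/

theorem IsNonnegSelfAdjoint.norm_le (hH : IsNonnegSelfAdjoint H) (f : H.domain) :
    ‖(f : E)‖ ≤ ‖(f : E) + H f‖ := by
  have h1 : ‖(f : E)‖ ^ 2 ≤ (⟪(f : E) + H f, (f : E)⟫_ℂ).re := by
    rw [inner_add_left, Complex.add_re]
    have := hH.nonneg f
    have h2 : (⟪(f : E), (f : E)⟫_ℂ).re = ‖(f : E)‖ ^ 2 := by
      rw [inner_self_eq_norm_sq_to_K]; norm_cast
    linarith
  have h3 : (⟪(f : E) + H f, (f : E)⟫_ℂ).re ≤ ‖(f : E) + H f‖ * ‖(f : E)‖ :=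
    (Complex.re_le_norm _).trans (norm_inner_le_norm _ _)
  rcases (norm_nonneg (f : E)).eq_or_lt with h0 | h0
  · rw [← h0]; positivity
  · nlinarith

theorem IsNonnegSelfAdjoint.symm (hH : IsNonnegSelfAdjoint H) (f g : H.domain) :
    ⟪H f, (g : E)⟫_ℂ = ⟪(f : E), H g⟫_ℂ := by
  have h := LinearPMap.adjoint_isFormalAdjoint (T := H) hH.dense_domain
  have hs : H.adjoint = H := hH.selfAdjoint
  rw [hs] at h
  exact h f g

/-- This is the inclusion of the domain of the adjoint in that of `H`; with `w = -y` it turns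
orthogonality to the range of `1 + H` into an eigenvalue equation. -/
theorem IsNonnegSelfAdjoint.mem_domain (hH : IsNonnegSelfAdjoint H) (y w : E)
    (h : ∀ x : H.domain, ⟪w, (x : E)⟫_ℂ = ⟪y, H x⟫_ℂ) : ∃ hy : y ∈ H.domain, H ⟨y, hy⟩ = w := by
  have hs : H.adjoint = H := hH.selfAdjoint
  have h1 := LinearPMap.mem_adjoint_domain_of_exists (T := H) y ⟨w, h⟩
  have h2 := LinearPMap.adjoint_apply_eq (T := H) hH.dense_domain ⟨y, h1⟩ h
  have key : ∀ K : E →ₗ.[ℂ] E, K = H → ∀ hk : y ∈ K.domain, K ⟨y, hk⟩ = w →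
      ∃ hy : y ∈ H.domain, H ⟨y, hy⟩ = w := by
    rintro K rfl hk hw
    exact ⟨hk, hw⟩
  exact key _ hs h1 h2

/-- The range of `1 + H` is closed, since `H` has closed graph and `1 + H` is bounded below. A
vector `g` orthogonal to it lies in the domain with `H g = -g`, and the lower bound forces `g = 0`.
-/
theorem IsNonnegSelfAdjoint.surjective (hH : IsNonnegSelfAdjoint H) (w : E) :
    ∃ f : H.domain, (f : E) + H f = w := by
  let L : H.domain →ₗ[ℂ] E := H.domain.subtype + H.toFun
  have hL : ∀ f, L f = (f : E) + H f := fun f => rfl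
  have hclosed : IsClosed (LinearMap.range L : Set E) := by
    refine isClosed_of_closure_subset fun w hw => ?_
    obtain ⟨u, hu, hlim⟩ := mem_closure_iff_seq_limit.1 hw
    choose f hf using hu
    have hc : CauchySeq fun n => (f n : E) := by
      have h1 := hlim.cauchySeq
      rw [Metric.cauchySeq_iff] at h1 ⊢
      intro ε hε
      obtain ⟨N, hN⟩ := h1 ε hε
      refine ⟨N, fun m hm n hn => lt_of_le_of_lt ?_ (hN m hm n hn)⟩
      rw [dist_eq_norm, dist_eq_norm, ← hf m, ← hf n, ← map_sub]
      exact hH.norm_le (f m - f n)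
    obtain ⟨v, hv⟩ := cauchySeq_tendsto_of_complete hc
    have hHv : Tendsto (fun n => H (f n)) atTop (𝓝 (w - v)) := by
      have := hlim.sub hv
      refine this.congr fun n => ?_
      rw [← hf n, hL]; simp
    have hg := hH.selfAdjoint.isClosed
    have hmem : (v, w - v) ∈ (H.graph : Set (E × E)) := by
      refine hg.mem_of_tendsto (hv.prodMk_nhds hHv) (Eventually.of_forall fun n => ?_)
      exact LinearPMap.mem_graph H (f n)
    rw [SetLike.mem_coe, LinearPMap.mem_graph_iff] at hmem
    obtain ⟨y, hy1, hy2⟩ := hmem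
    refine ⟨y, ?_⟩
    rw [hL, hy1, hy2]; simp
  have htop : LinearMap.range L = ⊤ := by
    have : CompleteSpace (LinearMap.range L) := hclosed.completeSpace_coe
    rw [← Submodule.orthogonal_eq_bot_iff, Submodule.eq_bot_iff]
    intro g hg
    rw [Submodule.mem_orthogonal'] at hg
    obtain ⟨hd, hHg⟩ := hH.mem_domain g (-g) fun x => by
      have := hg (L x) ⟨x, rfl⟩
      rw [hL, inner_add_right] at this
      rw [inner_neg_left]
      linear_combination -this
    have h1 := hH.norm_le ⟨g, hd⟩
    rw [hHg] at h1
    simpa using h1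
  have : w ∈ LinearMap.range L := htop ▸ Submodule.mem_top
  exact this

theorem IsNonnegSelfAdjoint.resolventOp_spec (hH : IsNonnegSelfAdjoint H) (f : E) :
    ∃ hf : resolventOp H f ∈ H.domain, resolventOp H f + H ⟨resolventOp H f, hf⟩ = f := by
  have hex : ∃ R : E →L[ℂ] E, ∀ f, ∃ hf : R f ∈ H.domain, R f + H ⟨R f, hf⟩ = f := by
    choose r hr using hH.surjective
    have huniq : ∀ a b : H.domain, (a : E) + H a = b + H b → a = b := by
      intro a b hab
      have h1 := hH.norm_le (a - b)
      have h2 : ((a - b : H.domain) : E) + H (a - b) = 0 := by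
        rw [LinearPMap.map_sub, Submodule.coe_sub, sub_add_sub_comm, hab, sub_self]
      rw [h2, norm_zero] at h1
      have h3 := norm_le_zero_iff.1 h1
      rw [Submodule.coe_sub, sub_eq_zero] at h3
      exact Subtype.ext h3
    let R₀ : E →ₗ[ℂ] E :=
      { toFun := fun f => (r f : E)
        map_add' := fun f g => by
          rw [← Submodule.coe_add]
          congr 1
          apply huniq
          rw [hr, LinearPMap.map_add, Submodule.coe_add, add_add_add_comm, hr, hr]
        map_smul' := fun c f => by
          rw [RingHom.id_apply, ← Submodule.coe_smul]
          congr 1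
          apply huniq
          rw [hr, LinearPMap.map_smul, Submodule.coe_smul, ← smul_add, hr] }
    refine ⟨R₀.mkContinuous 1 fun f => ?_, fun f => ⟨(r f).2, hr f⟩⟩
    rw [one_mul]
    have := hH.norm_le (r f)
    rwa [hr] at this
  rw [resolventOp, dif_pos hex]
  exact hex.choose_spec f

theorem IsNonnegSelfAdjoint.resolventOp_apply_add (hH : IsNonnegSelfAdjoint H) (h : H.domain) :
    resolventOp H (h + H h) = h := by
  obtain ⟨hf, he⟩ := hH.resolventOp_spec ((h : E) + H h)
  have h1 := hH.norm_le (⟨_, hf⟩ - h)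
  have h2 : ((⟨_, hf⟩ - h : H.domain) : E) + H (⟨_, hf⟩ - h) = 0 := by
    rw [LinearPMap.map_sub, Submodule.coe_sub, sub_add_sub_comm, he, sub_self]
  rw [h2, norm_zero] at h1
  have h3 := norm_le_zero_iff.1 h1
  rw [Submodule.coe_sub, sub_eq_zero] at h3
  exact h3

theorem IsNonnegSelfAdjoint.norm_resolventOp_le (hH : IsNonnegSelfAdjoint H) :
    ‖resolventOp H‖ ≤ 1 := by
  refine ContinuousLinearMap.opNorm_le_bound _ zero_le_one fun f => ?_
  obtain ⟨hf, he⟩ := hH.resolventOp_spec f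
  have := hH.norm_le ⟨_, hf⟩
  rw [he] at this
  rwa [one_mul]

theorem IsNonnegSelfAdjoint.isPositive_resolventOp (hH : IsNonnegSelfAdjoint H) :
    (resolventOp H).IsPositive := by
  have hsym : ∀ f g : E, ⟪resolventOp H f, g⟫_ℂ = ⟪f, resolventOp H g⟫_ℂ := by
    intro f g
    obtain ⟨hf, hfe⟩ := hH.resolventOp_spec f
    obtain ⟨hg, hge⟩ := hH.resolventOp_spec g
    conv_lhs => rw [← hge]
    conv_rhs => rw [← hfe]
    rw [inner_add_left, inner_add_right, hH.symm ⟨_, hf⟩ ⟨_, hg⟩]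
  refine ⟨hsym, fun f => ?_⟩
  obtain ⟨hf, hfe⟩ := hH.resolventOp_spec f
  have h1 := hH.nonneg ⟨_, hf⟩
  rw [ContinuousLinearMap.reApplyInnerSelf]
  have h2 : ⟪resolventOp H f, f⟫_ℂ =
      ⟪resolventOp H f, resolventOp H f⟫_ℂ + ⟪resolventOp H f, H ⟨_, hf⟩⟫_ℂ := by
    rw [← inner_add_right, hfe]
  rw [h2, map_add, inner_self_eq_norm_sq, inner_re_symm]
  have h3 : RCLike.re ⟪H ⟨_, hf⟩, resolventOp H f⟫_ℂ = (⟪H ⟨_, hf⟩, resolventOp H f⟫_ℂ).re := rfl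
  rw [h3]
  positivity

theorem IsNonnegSelfAdjoint.isSelfAdjoint_resolventOp (hH : IsNonnegSelfAdjoint H) :
    IsSelfAdjoint (resolventOp H) :=
  hH.isPositive_resolventOp.isSelfAdjoint

theorem IsNonnegSelfAdjoint.spectrum_subset (hH : IsNonnegSelfAdjoint H) :
    spectrum ℝ (resolventOp H) ⊆ Icc 0 1 := by
  intro s hs
  refine ⟨spectrum_nonneg_of_nonneg
    ((ContinuousLinearMap.nonneg_iff_isPositive _).2 hH.isPositive_resolventOp) hs, ?_⟩
  have h1 := spectrum.norm_le_norm_mul_of_mem hs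
  have h2 : ‖resolventOp H‖ * ‖(1 : E →L[ℂ] E)‖ ≤ 1 * 1 :=
    mul_le_mul hH.norm_resolventOp_le ContinuousLinearMap.norm_id_le (norm_nonneg _) zero_le_one
  have h3 := Real.le_norm_self s
  linarith

theorem IsNonnegSelfAdjoint.dense_range_resolventOp (hH : IsNonnegSelfAdjoint H) :
    DenseRange (resolventOp H) := by
  refine hH.dense_domain.mono fun f hf => ⟨_, hH.resolventOp_apply_add ⟨f, hf⟩⟩

theorem CommutesWith.commute_resolventOp {T : E →L[ℂ] E} (hT : CommutesWith H T)
    (hH : IsNonnegSelfAdjoint H) : Commute (resolventOp H) T := by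
  ext f
  obtain ⟨hf, hfe⟩ := hH.resolventOp_spec f
  obtain ⟨h1, h2⟩ := hT ⟨_, hf⟩
  have := hH.resolventOp_apply_add ⟨_, h1⟩
  rw [h2] at this
  change resolventOp H (T f) = T (resolventOp H f)
  rw [← map_add, hfe] at this
  exact this

/-! ### Functions of `H` -/

/-- Continuous functions on `[0, ∞)` that vanish at infinity. -/
structure VanishesAtTop (g : ℝ → ℝ) : Prop where
  cont : ContinuousOn g (Ici 0)
  lim : Tendsto g atTop (𝓝 0)

theorem VanishesAtTop.add {g₁ g₂ : ℝ → ℝ} (h₁ : VanishesAtTop g₁) (h₂ : VanishesAtTop g₂) :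
    VanishesAtTop fun x => g₁ x + g₂ x :=
  ⟨h₁.cont.add h₂.cont, by simpa using h₁.lim.add h₂.lim⟩

theorem VanishesAtTop.sub {g₁ g₂ : ℝ → ℝ} (h₁ : VanishesAtTop g₁) (h₂ : VanishesAtTop g₂) :
    VanishesAtTop fun x => g₁ x - g₂ x :=
  ⟨h₁.cont.sub h₂.cont, by simpa using h₁.lim.sub h₂.lim⟩

theorem VanishesAtTop.mul {g₁ g₂ : ℝ → ℝ} (h₁ : VanishesAtTop g₁) (h₂ : VanishesAtTop g₂) :
    VanishesAtTop fun x => g₁ x * g₂ x :=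
  ⟨h₁.cont.mul h₂.cont, by simpa using h₁.lim.mul h₂.lim⟩

theorem VanishesAtTop.const_mul {g : ℝ → ℝ} (h : VanishesAtTop g) (c : ℝ) :
    VanishesAtTop fun x => c * g x :=
  ⟨continuousOn_const.mul h.cont, by simpa using h.lim.const_mul c⟩

theorem VanishesAtTop.sum {ι : Type*} {s : Finset ι} {g : ι → ℝ → ℝ}
    (h : ∀ i ∈ s, VanishesAtTop (g i)) : VanishesAtTop fun x => ∑ i ∈ s, g i x :=
  ⟨continuousOn_finsetSum s fun i hi => (h i hi).cont,
    by simpa using tendsto_finsetSum s fun i hi => (h i hi).lim⟩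

theorem VanishesAtTop.comp_mul {g : ℝ → ℝ} (h : VanishesAtTop g) {t : ℝ} (ht : 0 < t) :
    VanishesAtTop fun x => g (t * x) :=
  ⟨h.cont.comp (by fun_prop) fun x hx => mul_nonneg ht.le hx,
    h.lim.comp (tendsto_id.const_mul_atTop ht)⟩

theorem vanishesAtTop_pow_mul_exp (k : ℕ) {c : ℝ} (hc : 0 < c) :
    VanishesAtTop fun x => x ^ k * Real.exp (-(c * x)) := by
  refine ⟨by fun_prop, ?_⟩
  have h := (Real.tendsto_pow_mul_exp_neg_atTop_nhds_zero k).comp (tendsto_id.const_mul_atTop hc)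
  have h2 := h.const_mul ((c ^ k)⁻¹)
  rw [mul_zero] at h2
  refine h2.congr fun x => ?_
  have : c ^ k ≠ 0 := by positivity
  simp only [Function.comp, id, mul_pow]
  field_simp

theorem vanishesAtTop_exp {t : ℝ} (ht : 0 < t) : VanishesAtTop fun x => Real.exp (-(t * x)) := by
  simpa using vanishesAtTop_pow_mul_exp 0 ht

theorem vanishesAtTop_psi (m : ℕ) {t : ℝ} (ht : 0 < t) : VanishesAtTop fun x => psi m (t * x) := by
  have h : VanishesAtTop (psi m) := by
    have := vanishesAtTop_pow_mul_exp m one_pos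
    simp only [one_mul] at this
    exact this
  exact h.comp_mul ht

/-- The function of the resolvent that represents `g(H)`. -/
def onResolvent (g : ℝ → ℝ) (s : ℝ) : ℝ := if 0 < s then g (s⁻¹ - 1) else 0

theorem functionOf_eq (H : E →ₗ.[ℂ] E) (g : ℝ → ℝ) :
    functionOf H g = cfc (onResolvent g) (resolventOp H) := rfl

/-- The point `s = 0` of the resolvent spectrum corresponds to infinite energy, so continuity there
is exactly the vanishing of `g` at infinity. -/
theorem VanishesAtTop.continuousOn {g : ℝ → ℝ} (h : VanishesAtTop g) :
    ContinuousOn (onResolvent g) (Icc 0 1) := by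
  intro s hs
  rcases hs.1.eq_or_lt with rfl | h0
  · rw [ContinuousWithinAt, onResolvent, if_neg (lt_irrefl _)]
    have h1 : Tendsto (fun s : ℝ => g (s⁻¹ - 1)) (𝓝[>] 0) (𝓝 0) :=
      h.lim.comp (tendsto_atTop_add_const_right _ (-1) tendsto_inv_nhdsGT_zero)
    have h2 : Tendsto (onResolvent g) (𝓝[>] 0) (𝓝 0) := by
      refine h1.congr' ?_
      filter_upwards [self_mem_nhdsWithin] with s hs
      exact (if_pos hs).symm
    have h3 : Tendsto (onResolvent g) (𝓝[{0}] 0) (𝓝 0) := by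
      rw [nhdsWithin_singleton, tendsto_pure_left]
      intro s hs
      rw [onResolvent, if_neg (lt_irrefl _)]
      exact mem_of_mem_nhds hs
    refine (h2.sup h3).mono_left ?_
    rw [← nhdsWithin_union]
    refine nhdsWithin_mono _ fun x hx => ?_
    rcases hx.1.eq_or_lt with rfl | hx
    · exact Or.inr rfl
    · exact Or.inl hx
  · have hs1 : 0 ≤ s⁻¹ - 1 := by
      have := (one_le_inv₀ h0).2 hs.2
      linarith
    have h1 : ContinuousWithinAt (fun s : ℝ => g (s⁻¹ - 1)) (Icc 0 1 ∩ Ioi 0) s := by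
      refine ContinuousWithinAt.comp (t := Ici 0) (h.cont _ hs1) ?_ ?_
      · exact ((continuousAt_inv₀ h0.ne').sub continuousAt_const).continuousWithinAt
      · intro x hx
        have := (one_le_inv₀ hx.2).2 hx.1.2
        change 0 ≤ x⁻¹ - 1
        linarith
    have h2 : ContinuousWithinAt (onResolvent g) (Icc 0 1 ∩ Ioi 0) s := by
      refine h1.congr (fun x hx => ?_) ?_
      · exact if_pos hx.2
      · exact if_pos h0
    exact (continuousWithinAt_inter (Ioi_mem_nhds h0)).1 h2

theorem VanishesAtTop.continuousOn_spectrum {g : ℝ → ℝ} (h : VanishesAtTop g)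
    (hH : IsNonnegSelfAdjoint H) : ContinuousOn (onResolvent g) (spectrum ℝ (resolventOp H)) :=
  h.continuousOn.mono hH.spectrum_subset

theorem isSelfAdjoint_functionOf (H : E →ₗ.[ℂ] E) (g : ℝ → ℝ) : IsSelfAdjoint (functionOf H g) :=
  cfc_predicate _ _

theorem inner_functionOf (H : E →ₗ.[ℂ] E) (g : ℝ → ℝ) (u v : E) :
    ⟪functionOf H g u, v⟫_ℂ = ⟪u, functionOf H g v⟫_ℂ :=
  (isSelfAdjoint_functionOf H g).isSymmetric u v

theorem functionOf_congr (hH : IsNonnegSelfAdjoint H) {g₁ g₂ : ℝ → ℝ}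
    (h : ∀ x, 0 ≤ x → g₁ x = g₂ x) : functionOf H g₁ = functionOf H g₂ := by
  refine cfc_congr fun s hs => ?_
  have := hH.spectrum_subset hs
  by_cases h0 : 0 < s
  · have h1 : 0 ≤ s⁻¹ - 1 := by
      have := (one_le_inv₀ h0).2 this.2
      linarith
    simp only [h0, if_true, h _ h1]
  · simp [h0]

variable {g g₁ g₂ : ℝ → ℝ}

theorem functionOf_mul (hH : IsNonnegSelfAdjoint H) (h₁ : VanishesAtTop g₁)
    (h₂ : VanishesAtTop g₂) :
    functionOf H (fun x => g₁ x * g₂ x) = functionOf H g₁ * functionOf H g₂ := by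
  rw [functionOf_eq, functionOf_eq, functionOf_eq,
    ← cfc_mul _ _ _ (h₁.continuousOn_spectrum hH) (h₂.continuousOn_spectrum hH)]
  congr 1
  funext s
  simp only [onResolvent]
  split_ifs <;> simp

theorem functionOf_add (hH : IsNonnegSelfAdjoint H) (h₁ : VanishesAtTop g₁)
    (h₂ : VanishesAtTop g₂) :
    functionOf H (fun x => g₁ x + g₂ x) = functionOf H g₁ + functionOf H g₂ := by
  rw [functionOf_eq, functionOf_eq, functionOf_eq,
    ← cfc_add _ _ _ (h₁.continuousOn_spectrum hH) (h₂.continuousOn_spectrum hH)]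
  congr 1
  funext s
  simp only [onResolvent]
  split_ifs <;> simp

theorem functionOf_sub (hH : IsNonnegSelfAdjoint H) (h₁ : VanishesAtTop g₁)
    (h₂ : VanishesAtTop g₂) :
    functionOf H (fun x => g₁ x - g₂ x) = functionOf H g₁ - functionOf H g₂ := by
  rw [functionOf_eq, functionOf_eq, functionOf_eq,
    ← cfc_sub _ _ _ (h₁.continuousOn_spectrum hH) (h₂.continuousOn_spectrum hH)]
  congr 1
  funext s
  simp only [onResolvent]
  split_ifs <;> simp

theorem functionOf_const_mul (hH : IsNonnegSelfAdjoint H) (h : VanishesAtTop g) (c : ℝ) :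
    functionOf H (fun x => c * g x) = c • functionOf H g := by
  rw [functionOf_eq, functionOf_eq, ← cfc_const_mul _ _ _ (h.continuousOn_spectrum hH)]
  congr 1
  funext s
  simp only [onResolvent]
  split_ifs <;> simp

theorem functionOf_sum (hH : IsNonnegSelfAdjoint H) {ι : Type*} (s : Finset ι) {g : ι → ℝ → ℝ}
    (h : ∀ i, VanishesAtTop (g i)) :
    functionOf H (fun x => ∑ i ∈ s, g i x) = ∑ i ∈ s, functionOf H (g i) := by
  classical
  induction s using Finset.induction_on with
  | empty =>
    have := functionOf_const_mul hH (vanishesAtTop_exp one_pos) 0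
    simpa using this
  | insert i s hi ih =>
    simp only [Finset.sum_insert hi]
    rw [functionOf_add hH (h i) (VanishesAtTop.sum fun j _ => h j), ih]

theorem norm_functionOf_le (hH : IsNonnegSelfAdjoint H) {c : ℝ} (hc : 0 ≤ c)
    (h : ∀ x, 0 ≤ x → |g x| ≤ c) : ‖functionOf H g‖ ≤ c := by
  refine norm_cfc_le hc fun s hs => ?_
  have hs := hH.spectrum_subset hs
  by_cases h0 : 0 < s
  · have h1 : 0 ≤ s⁻¹ - 1 := by
      have := (one_le_inv₀ h0).2 hs.2
      linarith
    simpa [h0] using h _ h1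
  · simpa [h0] using hc

theorem norm_functionOf_apply_le (hH : IsNonnegSelfAdjoint H) {c : ℝ} (hc : 0 ≤ c)
    (h : ∀ x, 0 ≤ x → |g x| ≤ c) (f : E) : ‖functionOf H g f‖ ≤ c * ‖f‖ :=
  (ContinuousLinearMap.le_opNorm _ _).trans
    (mul_le_mul_of_nonneg_right (norm_functionOf_le hH hc h) (norm_nonneg _))

theorem commute_functionOf (H : E →ₗ.[ℂ] E) (g₁ g₂ : ℝ → ℝ) :
    Commute (functionOf H g₁) (functionOf H g₂) :=
  cfc_commute_cfc _ _ _

theorem CommutesWith.commute_functionOf {T : E →L[ℂ] E} (hT : CommutesWith H T)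
    (hH : IsNonnegSelfAdjoint H) (g : ℝ → ℝ) : Commute (functionOf H g) T :=
  (hT.commute_resolventOp hH).cfc_real _

theorem norm_sq_functionOf (hH : IsNonnegSelfAdjoint H) (h : VanishesAtTop g) (f : E) :
    (‖functionOf H g f‖ ^ 2 : ℝ) = (⟪functionOf H (fun x => g x ^ 2) f, f⟫_ℂ).re := by
  have h2 : functionOf H (fun x => g x ^ 2) = functionOf H g * functionOf H g := by
    rw [← functionOf_mul hH h h]
    simp_rw [sq]
  rw [h2, mul_apply_eq_comp, inner_functionOf, inner_self_eq_norm_sq_to_K]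
  norm_cast

/-- The left side is the quadratic form of the single operator `∑ g_i(H)²`, so a pointwise bound on
`∑ g_i²` suffices. This is the source of the square function estimates. -/
theorem sum_norm_sq_functionOf_le (hH : IsNonnegSelfAdjoint H) {ι : Type*} (s : Finset ι)
    {g : ι → ℝ → ℝ} (h : ∀ i, VanishesAtTop (g i)) {c : ℝ} (hc : 0 ≤ c)
    (hs : ∀ x, 0 ≤ x → ∑ i ∈ s, g i x ^ 2 ≤ c) (f : E) :
    ∑ i ∈ s, ‖functionOf H (g i) f‖ ^ 2 ≤ c * ‖f‖ ^ 2 := by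
  have h2 : ∀ i, VanishesAtTop fun x => g i x ^ 2 := fun i => by
    simpa only [sq] using (h i).mul (h i)
  have e : ∑ i ∈ s, ‖functionOf H (g i) f‖ ^ 2 =
      (⟪functionOf H (fun x => ∑ i ∈ s, g i x ^ 2) f, f⟫_ℂ).re := by
    rw [functionOf_sum hH s h2, sum_apply, sum_inner, Complex.re_sum]
    exact Finset.sum_congr rfl fun i _ => norm_sq_functionOf hH (h i) f
  rw [e]
  refine (Complex.re_le_norm _).trans ((norm_inner_le_norm _ _).trans ?_)
  rw [sq, ← mul_assoc]
  refine mul_le_mul_of_nonneg_right (norm_functionOf_apply_le hH hc (fun x hx => ?_) f)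
    (norm_nonneg _)
  rw [abs_of_nonneg (Finset.sum_nonneg fun i _ => sq_nonneg _)]
  exact hs x hx

/-- The difference of the squared norms is `‖√(g₂² - g₁²)(H) f‖² ≥ 0`. -/
theorem norm_functionOf_mono (hH : IsNonnegSelfAdjoint H) (h₁ : VanishesAtTop g₁)
    (h₂ : VanishesAtTop g₂) (h : ∀ x, 0 ≤ x → |g₁ x| ≤ |g₂ x|) (f : E) :
    ‖functionOf H g₁ f‖ ≤ ‖functionOf H g₂ f‖ := by
  have hd : VanishesAtTop fun x => g₂ x ^ 2 - g₁ x ^ 2 := by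
    simpa only [sq] using (h₂.mul h₂).sub (h₁.mul h₁)
  have hr : VanishesAtTop fun x => √(g₂ x ^ 2 - g₁ x ^ 2) :=
    ⟨hd.cont.sqrt, by simpa using hd.lim.sqrt⟩
  have h1 := norm_sq_functionOf hH hr f
  have h2 : functionOf H (fun x => √(g₂ x ^ 2 - g₁ x ^ 2) ^ 2) =
      functionOf H (fun x => g₂ x ^ 2) - functionOf H (fun x => g₁ x ^ 2) := by
    rw [← functionOf_sub hH (by simpa only [sq] using h₂.mul h₂)
      (by simpa only [sq] using h₁.mul h₁)]
    refine functionOf_congr hH fun x hx => Real.sq_sqrt ?_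
    have := sq_le_sq.2 (h x hx)
    linarith
  rw [h2, sub_apply, inner_sub_left, Complex.sub_re,
    ← norm_sq_functionOf hH h₁, ← norm_sq_functionOf hH h₂] at h1
  refine le_of_sq_le_sq ?_ (norm_nonneg _)
  nlinarith [sq_nonneg ‖functionOf H (fun x => √(g₂ x ^ 2 - g₁ x ^ 2)) f‖]

end Calculus

/-! ### Strong limits, operator integrals and the semigroup -/

section Calculus

variable {E : Type*} [NormedAddCommGroup E] [InnerProductSpace ℂ E] [CompleteSpace E]
  {H : E →ₗ.[ℂ] E} {g : ℝ → ℝ}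

theorem VanishesAtTop.exists_bound (h : VanishesAtTop g) :
    ∃ G : ℝ, 0 ≤ G ∧ ∀ x, 0 ≤ x → |g x| ≤ G := by
  have h1 : ∀ᶠ x in atTop, |g x| < 1 := by
    have := h.lim.abs
    rw [abs_zero] at this
    exact this.eventually_lt_const one_pos
  obtain ⟨N, hN⟩ := eventually_atTop.1 h1
  obtain ⟨K, hK⟩ := (isCompact_Icc (a := (0 : ℝ)) (b := N)).exists_bound_of_continuousOn
    (h.cont.mono Icc_subset_Ici_self)
  refine ⟨max K 1, by positivity, fun x hx => ?_⟩
  rcases le_total x N with hx' | hx'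
  · exact (hK x ⟨hx, hx'⟩).trans (le_max_left _ _)
  · exact (hN x hx').le.trans (le_max_right _ _)

theorem vanishesAtTop_inv_one_add : VanishesAtTop fun x => (1 + x)⁻¹ := by
  refine ⟨ContinuousOn.inv₀ (by fun_prop) fun x hx => ?_, ?_⟩
  · have : (0 : ℝ) ≤ x := hx
    positivity
  · exact (tendsto_atTop_add_const_left _ 1 tendsto_id).inv_tendsto_atTop

theorem functionOf_inv_one_add (hH : IsNonnegSelfAdjoint H) :
    functionOf H (fun x => (1 + x)⁻¹) = resolventOp H := by
  rw [functionOf_eq]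
  conv_rhs => rw [← cfc_id' ℝ (resolventOp H) hH.isSelfAdjoint_resolventOp]
  refine cfc_congr fun s hs => ?_
  have := hH.spectrum_subset hs
  rcases this.1.eq_or_lt with rfl | h0
  · simp [onResolvent]
  · simp [onResolvent, h0]

/-- The operators are uniformly bounded, so vectors `R k` in the dense range of the resolvent
suffice. There the multiplier is `(g(εx) - g(0)) / (1 + x)`: it is small for `εx < δ` by continuity
at `0`, and for `εx ≥ δ` because `(1 + x)⁻¹ ≤ ε/δ`. -/
theorem tendsto_functionOf_nhdsGT_zero (hH : IsNonnegSelfAdjoint H) (h : VanishesAtTop g) (f : E) :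
    Tendsto (fun ε => functionOf H (fun x => g (ε * x)) f) (𝓝[>] 0) (𝓝 ((g 0 : ℂ) • f)) := by
  obtain ⟨G, hG0, hG⟩ := h.exists_bound
  rw [Metric.tendsto_nhdsWithin_nhds]
  intro e he
  -- With these `η` and `η'` the two approximation errors are at most `e/8` each and the error on
  -- `resolventOp H k` at most `e/4`.
  set η : ℝ := e / (4 * (1 + 2 * G)) with hη
  have hη0 : 0 < η := by positivity
  obtain ⟨_, hk, ⟨k, rfl⟩⟩ := Metric.dense_iff.1 hH.dense_range_resolventOp f η hη0
  rw [Metric.mem_ball, dist_eq_norm] at hk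
  set η' : ℝ := e / (4 * (1 + ‖k‖)) with hη'
  have hη'0 : 0 < η' := by positivity
  have hc := h.cont 0 self_mem_Ici
  rw [Metric.continuousWithinAt_iff] at hc
  obtain ⟨δ, hδ, hgδ⟩ := hc η' hη'0
  refine ⟨δ * η' / (2 * G + 1), by positivity, fun {ε} hε hεd => ?_⟩
  have hε0 : (0 : ℝ) < ε := hε
  rw [Real.dist_eq, sub_zero, abs_of_pos hε0] at hεd
  have hcomp := h.comp_mul hε0
  have key : ‖functionOf H (fun x => g (ε * x)) (resolventOp H k) -
      (g 0 : ℂ) • resolventOp H k‖ ≤ η' * ‖k‖ := by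
    have e1 : functionOf H (fun x => g (ε * x)) (resolventOp H k) - (g 0 : ℂ) • resolventOp H k =
        functionOf H (fun x => g (ε * x) * (1 + x)⁻¹ - g 0 * (1 + x)⁻¹) k := by
      rw [functionOf_sub hH (hcomp.mul vanishesAtTop_inv_one_add)
        (vanishesAtTop_inv_one_add.const_mul _), functionOf_mul hH hcomp vanishesAtTop_inv_one_add,
        functionOf_const_mul hH vanishesAtTop_inv_one_add, functionOf_inv_one_add hH]
      simp
    rw [e1]
    refine norm_functionOf_apply_le hH hη'0.le (fun x hx => ?_) k
    rw [← sub_mul, abs_mul, abs_of_pos (by positivity : 0 < (1 + x)⁻¹)]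
    have hx1 : (1 + x)⁻¹ ≤ 1 := inv_le_one_of_one_le₀ (by linarith)
    rcases lt_or_ge (ε * x) δ with hlt | hge
    · have h1 := hgδ (mul_nonneg hε0.le hx : ε * x ∈ Ici 0)
        (by rwa [Real.dist_eq, sub_zero, abs_of_nonneg (by positivity)])
      rw [Real.dist_eq] at h1
      calc _ ≤ η' * 1 := mul_le_mul h1.le hx1 (by positivity) hη'0.le
        _ = η' := mul_one _
    · have h1 : |g (ε * x) - g 0| ≤ 2 * G + 1 := by
        have := hG _ (mul_nonneg hε0.le hx)
        have := hG 0 le_rfl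
        have := abs_sub (g (ε * x)) (g 0)
        linarith
      have h2 : (1 + x)⁻¹ ≤ ε / δ := by
        rw [inv_le_comm₀ (by positivity) (by positivity), inv_div, div_le_iff₀ hε0]
        nlinarith
      calc _ ≤ (2 * G + 1) * (ε / δ) := mul_le_mul h1 h2 (by positivity) (by positivity)
        _ ≤ η' := by
          rw [lt_div_iff₀ (by positivity)] at hεd
          rw [mul_div_assoc', div_le_iff₀ hδ]
          linarith
  have hn : ‖functionOf H (fun x => g (ε * x)) (f - resolventOp H k)‖ ≤ G * η := by
    refine (norm_functionOf_apply_le hH hG0 (fun x hx => hG _ (by positivity)) _).trans ?_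
    rw [norm_sub_rev] at hk
    exact mul_le_mul_of_nonneg_left hk.le hG0
  have hn2 : ‖(g 0 : ℂ) • (f - resolventOp H k)‖ ≤ G * η := by
    rw [norm_smul, Complex.norm_real]
    rw [norm_sub_rev] at hk
    exact mul_le_mul (hG 0 le_rfl) hk.le (norm_nonneg _) hG0
  rw [dist_eq_norm]
  have e2 : functionOf H (fun x => g (ε * x)) f - (g 0 : ℂ) • f =
      functionOf H (fun x => g (ε * x)) (f - resolventOp H k) +
      (functionOf H (fun x => g (ε * x)) (resolventOp H k) - (g 0 : ℂ) • resolventOp H k) -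
      (g 0 : ℂ) • (f - resolventOp H k) := by
    rw [map_sub, smul_sub]; abel
  rw [e2]
  have h3 : η' * ‖k‖ ≤ e / 4 := by
    rw [hη', div_mul_eq_mul_div, div_le_div_iff₀ (by positivity) (by norm_num)]
    nlinarith [norm_nonneg k]
  have h4 : G * η ≤ e / 8 := by
    rw [hη, mul_div_assoc', div_le_div_iff₀ (by positivity) (by norm_num)]
    nlinarith
  calc _ ≤ _ := norm_sub_le _ _
    _ ≤ _ := add_le_add_left (norm_add_le _ _) _
    _ < e := by linarith

/-! ### Integrals of functions of `H` -/

/-- Joint continuity is what integration under the continuous functional calculus requires. At `s =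
0` it holds because `g (u * x)` tends to `0` as `x → ∞`, uniformly for `u ≥ a`. -/
theorem VanishesAtTop.continuousOn_uncurry (h : VanishesAtTop g) {a b : ℝ} (ha : 0 < a) :
    ContinuousOn (Function.uncurry fun u s => onResolvent (fun x => g (u * x) / u) s)
      (Icc a b ×ˢ Icc 0 1) := by
  rintro ⟨u, s⟩ ⟨hu, hs⟩
  have hu0 : 0 < u := ha.trans_le hu.1
  rcases hs.1.eq_or_lt with h0 | h0
  · rw [Metric.continuousWithinAt_iff]
    intro ε hε
    have h1 : ∀ᶠ x in atTop, |g x| < ε * a := by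
      have := h.lim.abs
      rw [abs_zero] at this
      exact this.eventually_lt_const (by positivity)
    obtain ⟨N, hN⟩ := eventually_atTop.1 h1
    have hev : ∀ᶠ s : ℝ in 𝓝[>] 0, N ≤ a * (s⁻¹ - 1) :=
      ((tendsto_atTop_add_const_right _ (-1) tendsto_inv_nhdsGT_zero).const_mul_atTop
        ha).eventually_ge_atTop N
    rw [eventually_nhdsWithin_iff, Metric.eventually_nhds_iff] at hev
    obtain ⟨δ, hδ, hδ'⟩ := hev
    refine ⟨δ, hδ, ?_⟩
    rintro ⟨v, t⟩ ⟨hv, ht⟩ hd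
    have hv0 : 0 < v := ha.trans_le hv.1
    dsimp only at hs h0 hv ht
    subst h0
    simp only [Function.uncurry, onResolvent, lt_irrefl, if_false]
    rcases ht.1.eq_or_lt with h0 | h0
    · rw [← h0]
      simpa using hε
    · rw [if_pos h0, Real.dist_eq, sub_zero, abs_div, abs_of_pos hv0, div_lt_iff₀ hv0]
      have h2 : dist t 0 < δ := (le_max_right _ _).trans_lt hd
      have h3 := hδ' h2 h0
      have h4 : 0 ≤ t⁻¹ - 1 := by
        have := (one_le_inv₀ h0).2 ht.2
        linarith
      have h5 := hN (v * (t⁻¹ - 1)) (h3.trans (mul_le_mul_of_nonneg_right hv.1 h4))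
      exact h5.trans_le (mul_le_mul_of_nonneg_left hv.1 hε.le)
  · have h0' : 0 < s := h0
    have hopen : (univ ×ˢ Ioi (0 : ℝ)) ∈ 𝓝 (u, s) :=
      prod_mem_nhds univ_mem (Ioi_mem_nhds h0')
    rw [← continuousWithinAt_inter hopen]
    have hs1 : ∀ {t : ℝ}, 0 < t → t ≤ 1 → 0 ≤ t⁻¹ - 1 := fun h h' => by
      have := (one_le_inv₀ h).2 h'
      linarith
    have h1 : ContinuousWithinAt (fun p : ℝ × ℝ => g (p.1 * (p.2⁻¹ - 1)) / p.1)
        (Icc a b ×ˢ Icc 0 1 ∩ univ ×ˢ Ioi 0) (u, s) := by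
      refine ContinuousWithinAt.div ?_ continuousWithinAt_fst hu0.ne'
      refine ContinuousWithinAt.comp (t := Ici 0)
        (h.cont _ (mul_nonneg hu0.le (hs1 h0' hs.2))) ?_ ?_
      · refine continuousWithinAt_fst.mul ((ContinuousWithinAt.inv₀ continuousWithinAt_snd
          h0'.ne').sub continuousWithinAt_const)
      · rintro ⟨v, t⟩ ⟨⟨hv, ht⟩, -, ht0⟩
        exact mul_nonneg (ha.le.trans hv.1) (hs1 ht0 ht.2)
    refine h1.congr ?_ ?_
    · rintro ⟨v, t⟩ ⟨-, -, ht0⟩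
      exact if_pos ht0
    · exact if_pos h0'

/-- Since `d/du γ(ux) = -η(ux)/u`, one has `γ(aH) - γ(bH) = ∫_a^b η(uH) du/u` as a norm-convergent
integral of operators, and `l` passes inside. A general functional `l` is allowed because only
individual matrix coefficients of `T η(uH)` will be under control. -/
theorem norm_apply_functionOf_sub_le (hH : IsNonnegSelfAdjoint H) {γ η : ℝ → ℝ}
    (hγ : VanishesAtTop γ) (hη : VanishesAtTop η) (hη0 : η 0 = 0)
    (hd : ∀ t, 0 < t → HasDerivAt γ (-(η t / t)) t) {a b : ℝ} (ha : 0 < a) (hab : a ≤ b)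
    (l : (E →L[ℂ] E) →L[ℂ] ℂ) {K : ℝ}
    (hK : ∀ u ∈ Icc a b, ‖l (functionOf H fun x => η (u * x))‖ ≤ K) :
    ‖l (functionOf H (fun x => γ (a * x)) - functionOf H (fun x => γ (b * x)))‖
      ≤ K / a * (b - a) := by
  have hb : 0 < b := ha.trans_le hab
  have hint : ∀ x : ℝ, 0 ≤ x → γ (a * x) - γ (b * x) = ∫ u in Icc a b, η (u * x) / u := by
    intro x hx
    rw [integral_Icc_eq_integral_Ioc, ← intervalIntegral.integral_of_le hab]
    have hder : ∀ u ∈ uIcc a b, HasDerivAt (fun u => -γ (u * x)) (η (u * x) / u) u := by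
      intro u hu
      rw [uIcc_of_le hab] at hu
      have hu0 : 0 < u := ha.trans_le hu.1
      -- The derivative of `γ` is known only on `(0, ∞)`; at `x = 0` the path is constant and `η 0 =
      -- 0` makes the integrand vanish.
      rcases hx.eq_or_lt with rfl | hx0
      · simp only [mul_zero, hη0, zero_div]
        exact hasDerivAt_const _ _
      · have h1 := (hd (u * x) (by positivity)).comp u ((hasDerivAt_id u).mul_const x)
        have h2 := h1.neg
        refine h2.congr_deriv ?_
        simp only [one_mul]
        field_simp
    rw [intervalIntegral.integral_eq_sub_of_hasDerivAt hder]
    · ring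
    · refine ContinuousOn.intervalIntegrable ?_
      rw [uIcc_of_le hab]
      refine ContinuousOn.div ?_ continuousOn_id fun u hu => (ha.trans_le hu.1).ne'
      exact hη.cont.comp (by fun_prop) fun u hu => mul_nonneg (ha.le.trans hu.1) hx
  obtain ⟨G, hG0, hG⟩ := hη.exists_bound
  have hbound : ∀ u ∈ Icc a b, ∀ s ∈ spectrum ℝ (resolventOp H),
      ‖onResolvent (fun x => η (u * x) / u) s‖ ≤ G / a := by
    intro u hu s hs
    have hs := hH.spectrum_subset hs
    have hu0 : 0 < u := ha.trans_le hu.1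
    simp only [onResolvent]
    split_ifs with h0
    · have h1 : 0 ≤ s⁻¹ - 1 := by
        have := (one_le_inv₀ h0).2 hs.2
        linarith
      rw [Real.norm_eq_abs, abs_div, abs_of_pos hu0]
      exact div_le_div₀ hG0 (hG _ (by positivity)) ha hu.1
    · simp only [norm_zero]; positivity
  have hcont : ContinuousOn (Function.uncurry fun u s => onResolvent (fun x => η (u * x) / u) s)
      (Icc a b ×ˢ spectrum ℝ (resolventOp H)) :=
    (hη.continuousOn_uncurry ha).mono (prod_mono_right hH.spectrum_subset)
  have hfin : HasFiniteIntegral (fun _ : ℝ => G / a) (volume.restrict (Icc a b)) :=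
    (integrable_const _).hasFiniteIntegral
  have e1 : functionOf H (fun x => γ (a * x)) - functionOf H (fun x => γ (b * x)) =
      ∫ u in Icc a b, functionOf H (fun x => η (u * x) / u) := by
    rw [← functionOf_sub hH (hγ.comp_mul ha) (hγ.comp_mul hb)]
    simp only [functionOf_eq]
    rw [← cfc_setIntegral measurableSet_Icc _ (fun _ => G / a) (resolventOp H) hcont
      (ae_restrict_of_forall_mem measurableSet_Icc hbound) hfin hH.isSelfAdjoint_resolventOp]
    refine cfc_congr fun s hs => ?_
    have hs := hH.spectrum_subset hs
    by_cases h0 : 0 < s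
    · have h1 : 0 ≤ s⁻¹ - 1 := by
        have := (one_le_inv₀ h0).2 hs.2
        linarith
      simp only [onResolvent, h0, if_true]
      exact hint _ h1
    · simp [onResolvent, h0]
  have hi : IntegrableOn (fun u => functionOf H (fun x => η (u * x) / u)) (Icc a b) := by
    simp only [functionOf_eq]
    exact integrableOn_cfc measurableSet_Icc _ (fun _ => G / a) (resolventOp H) hcont
      (ae_restrict_of_forall_mem measurableSet_Icc hbound) hfin hH.isSelfAdjoint_resolventOp
  rw [e1, ← ContinuousLinearMap.integral_comp_comm l hi]
  have h2 : ∀ u ∈ Icc a b, ‖l (functionOf H (fun x => η (u * x) / u))‖ ≤ K / a := by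
    intro u hu
    have hu0 : 0 < u := ha.trans_le hu.1
    have e2 : functionOf H (fun x => η (u * x) / u) =
        ((u⁻¹ : ℝ) : ℂ) • functionOf H (fun x => η (u * x)) := by
      have := functionOf_const_mul hH (hη.comp_mul hu0) u⁻¹
      rw [Complex.coe_smul, ← this]
      simp only [div_eq_inv_mul]
    rw [e2, map_smul, norm_smul, Complex.norm_real, Real.norm_eq_abs, abs_of_pos (by positivity),
      div_eq_inv_mul]
    exact mul_le_mul (inv_anti₀ ha hu.1) (hK u hu) (norm_nonneg _) (by positivity)
  have h3 := norm_setIntegral_le_of_norm_le_const (μ := volume) (s := Icc a b)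
    (by simp) h2
  simpa [hab, Measure.real] using h3

/-! ### The heat semigroup -/

theorem inner_heat (H : E →ₗ.[ℂ] E) (t : ℝ) (u v : E) : ⟪heat H t u, v⟫_ℂ = ⟪u, heat H t v⟫_ℂ :=
  inner_functionOf H _ u v

theorem norm_heat_apply_le (hH : IsNonnegSelfAdjoint H) {t : ℝ} (ht : 0 < t) (f : E) :
    ‖heat H t f‖ ≤ ‖f‖ := by
  have := norm_functionOf_apply_le (g := fun x => Real.exp (-(t * x))) hH zero_le_one
    (fun x hx => ?_) f
  · rwa [one_mul] at this
  · rw [Real.abs_exp, Real.exp_le_one_iff]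
    nlinarith

theorem heat_add (hH : IsNonnegSelfAdjoint H) {s t : ℝ} (hs : 0 < s) (ht : 0 < t) :
    heat H (s + t) = heat H s * heat H t := by
  rw [heat, heat, heat, ← functionOf_mul hH (vanishesAtTop_exp hs) (vanishesAtTop_exp ht)]
  congr 1
  funext x
  rw [← Real.exp_add]
  ring_nf

theorem heat_pow (hH : IsNonnegSelfAdjoint H) {t : ℝ} (ht : 0 < t) {i : ℕ} (hi : 1 ≤ i) :
    heat H t ^ i = heat H (i * t) := by
  induction i, hi using Nat.le_induction with
  | base => simp
  | succ i hi ih =>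
    rw [pow_succ, ih, ← heat_add hH (by positivity) ht]
    congr 1
    push_cast
    ring

theorem heat_mul_heat_pow (hH : IsNonnegSelfAdjoint H) {s t : ℝ} (hs : 0 < s) (ht : 0 < t) (i : ℕ) :
    heat H s * heat H t ^ i = heat H (s + i * t) := by
  rcases Nat.eq_zero_or_pos i with rfl | hi
  · simp
  · rw [heat_pow hH ht hi, heat_add hH hs (by positivity)]

/-- The function `1 - e^{-tx}` does not vanish at infinity, so it lies outside `functionOf`.
Expanding the square and writing `e^{-tH} = (e^{-tH/2})²` gives `‖f - e^{-tH} f‖² ≤ ‖f‖² -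
‖e^{-tH/2} f‖²`. -/
theorem norm_sub_heat_apply_le (hH : IsNonnegSelfAdjoint H) {t : ℝ} (ht : 0 < t) (f : E) :
    ‖f - heat H t f‖ ≤ ‖f‖ := by
  have h1 := @norm_sub_sq ℂ E _ _ _ f (heat H t f)
  have h2 : heat H t f = heat H (t / 2) (heat H (t / 2) f) := by
    conv_lhs => rw [← add_halves t, heat_add hH (half_pos ht) (half_pos ht)]
    rfl
  have h3 : RCLike.re ⟪f, heat H t f⟫_ℂ = ‖heat H (t / 2) f‖ ^ 2 := by
    rw [h2, ← inner_heat, inner_self_eq_norm_sq]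
  have h4 : ‖heat H t f‖ ≤ ‖heat H (t / 2) f‖ := by
    rw [h2]; exact norm_heat_apply_le hH (half_pos ht) _
  refine le_of_sq_le_sq ?_ (norm_nonneg _)
  rw [h1, h3]
  nlinarith [norm_nonneg (heat H t f)]

theorem isSelfAdjoint_ballOp (H : E →ₗ.[ℂ] E) (M : ℕ) (r : ℝ) : IsSelfAdjoint (ballOp H M r) :=
  ((IsSelfAdjoint.one _).sub (isSelfAdjoint_functionOf H _)).pow M

theorem inner_ballOp (H : E →ₗ.[ℂ] E) (M : ℕ) (r : ℝ) (u v : E) :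
    ⟪ballOp H M r u, v⟫_ℂ = ⟪u, ballOp H M r v⟫_ℂ :=
  (isSelfAdjoint_ballOp H M r).isSymmetric u v

theorem norm_ballOp_apply_le (hH : IsNonnegSelfAdjoint H) (M : ℕ) {r : ℝ} (hr : 0 < r) (f : E) :
    ‖ballOp H M r f‖ ≤ ‖f‖ := by
  induction M with
  | zero => simp [ballOp]
  | succ M ih =>
    rw [ballOp, pow_succ']
    exact (norm_sub_heat_apply_le hH (by positivity) _).trans ih

theorem commute_functionOf_ballOp (H : E →ₗ.[ℂ] E) (g : ℝ → ℝ) (M : ℕ) (r : ℝ) :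
    Commute (functionOf H g) (ballOp H M r) :=
  ((Commute.one_right _).sub_right (commute_functionOf H _ _)).pow_right M

theorem ballOp_eq_sum (H : E →ₗ.[ℂ] E) (M : ℕ) (r : ℝ) :
    ballOp H M r = ∑ i ∈ Finset.range (M + 1),
      ((-1) ^ i * (M.choose i : ℂ)) • heat H (r ^ 2) ^ i := by
  rw [ballOp, sub_eq_neg_add, (Commute.one_right _).add_pow]
  refine Finset.sum_congr rfl fun i _ => ?_
  rw [neg_pow, one_pow, mul_one, mul_smul, Nat.cast_smul_eq_nsmul, nsmul_eq_mul]
  rw [← Nat.cast_comm, ← mul_smul_comm]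
  congr 1
  rw [← one_mul (heat H (r ^ 2) ^ i), ← mul_assoc, mul_one, ← smul_mul_assoc]
  congr 1
  rcases Nat.even_or_odd i with h | h <;> simp [h.neg_one_pow]

end Calculus

/-! ### Localisation in `L²`: restrictions, coverings, shells -/

section Restriction

variable {X : Type*} [MeasurableSpace X] {μ : Measure X}

/-! ### Restriction of square-integrable functions to sets -/

/-- Multiplication by the indicator function of `E`. -/
def cut {E : Set X} (hE : MeasurableSet E) : Lp ℂ 2 μ →L[ℂ] Lp ℂ 2 μ :=
  LinearMap.mkContinuous
    { toFun := fun f => ((Lp.memLp f).indicator hE).toLp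
      map_add' := fun f g => by
        rw [← MemLp.toLp_add]
        refine MemLp.toLp_congr _ _ ?_
        filter_upwards [Lp.coeFn_add f g] with x hx
        by_cases h : x ∈ E
        · simp only [indicator_of_mem h, hx, Pi.add_apply]
        · simp only [indicator_of_notMem h, Pi.add_apply, add_zero]
      map_smul' := fun c f => by
        rw [RingHom.id_apply, ← MemLp.toLp_const_smul]
        refine MemLp.toLp_congr _ _ ?_
        filter_upwards [Lp.coeFn_smul c f] with x hx
        by_cases h : x ∈ E
        · simp only [indicator_of_mem h, hx, Pi.smul_apply]
        · simp only [indicator_of_notMem h, Pi.smul_apply, smul_zero] } 1 fun f => by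
    rw [one_mul, LinearMap.coe_mk, AddHom.coe_mk, Lp.norm_toLp, Lp.norm_def]
    exact ENNReal.toReal_mono (Lp.eLpNorm_ne_top f) (eLpNorm_indicator_le _)

variable {E F : Set X} (hE : MeasurableSet E) (hF : MeasurableSet F)

theorem coeFn_cut (f : Lp ℂ 2 μ) : cut hE f =ᵐ[μ] E.indicator f :=
  ((Lp.memLp f).indicator hE).coeFn_toLp

theorem norm_cut (f : Lp ℂ 2 μ) : ‖cut hE f‖ = (eLpNorm f 2 (μ.restrict E)).toReal := by
  rw [Lp.norm_def, eLpNorm_congr_ae (coeFn_cut hE f), eLpNorm_indicator_eq_eLpNorm_restrict hE]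

theorem norm_cut_le (f : Lp ℂ 2 μ) : ‖cut hE f‖ ≤ ‖f‖ := by
  rw [norm_cut, Lp.norm_def]
  exact ENNReal.toReal_mono (Lp.eLpNorm_ne_top f) (eLpNorm_restrict_le _ _ _ _)

theorem norm_cut_mono (h : E ⊆ F) (f : Lp ℂ 2 μ) : ‖cut hE f‖ ≤ ‖cut hF f‖ := by
  rw [norm_cut, norm_cut]
  exact ENNReal.toReal_mono ((eLpNorm_restrict_le _ _ _ _).trans_lt (Lp.eLpNorm_lt_top f)).ne
    (eLpNorm_mono_measure _ (Measure.restrict_mono_set μ h))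

theorem supportedIn_cut (f : Lp ℂ 2 μ) : SupportedIn (cut hE f) E := by
  filter_upwards [coeFn_cut hE f] with x hx hxE
  rw [hx, indicator_of_notMem hxE]

theorem SupportedIn.mono {f : Lp ℂ 2 μ} (h : SupportedIn f E) (hEF : E ⊆ F) : SupportedIn f F := by
  filter_upwards [h] with x hx hxF
  exact hx fun hxE => hxF (hEF hxE)

theorem SupportedIn.cut_eq {f : Lp ℂ 2 μ} (h : SupportedIn f E) : cut hE f = f := by
  refine Lp.ext ?_
  filter_upwards [coeFn_cut hE f, h] with x hx hx2
  rw [hx]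
  by_cases hxE : x ∈ E
  · rw [indicator_of_mem hxE]
  · rw [indicator_of_notMem hxE, hx2 hxE]

theorem SupportedIn.cut_eq_zero {f : Lp ℂ 2 μ} (h : SupportedIn f E) (hEF : Disjoint E F) :
    cut hF f = 0 := by
  refine Lp.ext ?_
  filter_upwards [coeFn_cut hF f, h, Lp.coeFn_zero ℂ 2 μ] with x hx hx2 hx3
  rw [hx, hx3, Pi.zero_apply]
  by_cases hxF : x ∈ F
  · rw [indicator_of_mem hxF, hx2 fun hxE => disjoint_left.1 hEF hxE hxF]
  · rw [indicator_of_notMem hxF]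

theorem inner_cut (u v : Lp ℂ 2 μ) : ⟪cut hE u, v⟫_ℂ = ⟪u, cut hE v⟫_ℂ := by
  rw [L2.inner_def, L2.inner_def]
  refine integral_congr_ae ?_
  filter_upwards [coeFn_cut hE u, coeFn_cut hE v] with x h1 h2
  rw [h1, h2]
  by_cases hx : x ∈ E <;> simp [hx]

theorem inner_cut_cut (u v : Lp ℂ 2 μ) : ⟪cut hE u, cut hE v⟫_ℂ = ⟪cut hE u, v⟫_ℂ := by
  rw [← inner_cut, (supportedIn_cut hE u).cut_eq hE]

theorem norm_sq_cut_add (f : Lp ℂ 2 μ) : ‖f‖ ^ 2 = ‖cut hE f‖ ^ 2 + ‖f - cut hE f‖ ^ 2 := by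
  have h : ⟪cut hE f, f - cut hE f⟫_ℂ = 0 := by
    rw [inner_sub_right, inner_cut_cut, sub_self]
  have := norm_add_sq_eq_norm_sq_add_norm_sq_of_inner_eq_zero _ _ h
  rw [add_sub_cancel] at this
  simpa only [sq] using this

theorem cut_sdiff (h : E ⊆ F) (f : Lp ℂ 2 μ) :
    cut (hF.diff hE) f = cut hF f - cut hE f := by
  refine Lp.ext ?_
  filter_upwards [coeFn_cut hF f, coeFn_cut hE f, coeFn_cut (hF.diff hE) f,
    Lp.coeFn_sub (cut hF f) (cut hE f)] with x h1 h2 h3 h4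
  rw [h3, h4, Pi.sub_apply, h1, h2]
  by_cases hxE : x ∈ E
  · simp [hxE, h hxE]
  · by_cases hxF : x ∈ F <;> simp [hxE, hxF]

theorem supportedIn_sub_cut {f : Lp ℂ 2 μ} (h : SupportedIn f (E ∪ F)) :
    SupportedIn (f - cut hE f) F := by
  filter_upwards [h, coeFn_cut hE f, Lp.coeFn_sub f (cut hE f)] with x h1 h2 h3 hx
  rw [h3, Pi.sub_apply, h2]
  by_cases hxE : x ∈ E
  · simp [hxE]
  · simp [hxE, h1 (fun h => h.elim hxE hx)]

theorem LocalNormLE.norm_cut_le {T : Lp ℂ 2 μ →L[ℂ] Lp ℂ 2 μ} {K : ℝ} (h : LocalNormLE T E F K)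
    (hK : 0 ≤ K) {f : Lp ℂ 2 μ} (hf : SupportedIn f E) : ‖cut hF (T f)‖ ≤ K * ‖f‖ := by
  rw [norm_cut]
  exact ENNReal.toReal_le_of_le_ofReal (by positivity) (h f hf)

theorem norm_sq_cut_eq_integral (f : Lp ℂ 2 μ) : ‖cut hE f‖ ^ 2 = ∫ x in E, ‖f x‖ ^ 2 ∂μ := by
  rw [← integral_indicator hE]
  have h1 : ‖cut hE f‖ ^ 2 = RCLike.re ⟪cut hE f, cut hE f⟫_ℂ := (inner_self_eq_norm_sq _).symm
  rw [h1, L2.inner_def, ← integral_re (L2.integrable_inner _ _)]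
  refine integral_congr_ae ?_
  filter_upwards [coeFn_cut hE f] with x hx
  rw [inner_self_eq_norm_sq, hx]
  by_cases h : x ∈ E <;> simp [h]

/-- By Pythagoras `‖f - 1_{E_n} f‖² = ‖f‖² - ‖1_{E_n} f‖²`, and the last term converges by monotone
convergence. -/
theorem tendsto_cut {E : ℕ → Set X} (hE : ∀ n, MeasurableSet (E n)) (hm : Monotone E)
    (hu : ⋃ n, E n = univ) (f : Lp ℂ 2 μ) : Tendsto (fun n => cut (hE n) f) atTop (𝓝 f) := by
  have hi : Integrable (fun x => ‖f x‖ ^ 2) μ := (Lp.memLp f).integrable_norm_pow (by norm_num)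
  have h1 := tendsto_setIntegral_of_monotone hE hm hi.integrableOn
  rw [hu] at h1
  have h2 : ∫ x in univ, ‖f x‖ ^ 2 ∂μ = ‖f‖ ^ 2 := by
    rw [← norm_sq_cut_eq_integral MeasurableSet.univ, SupportedIn.cut_eq]
    exact Eventually.of_forall fun x hx => (hx (mem_univ x)).elim
  rw [h2] at h1
  simp only [fun n => (norm_sq_cut_eq_integral (hE n) f).symm] at h1
  rw [tendsto_iff_norm_sub_tendsto_zero]
  have h3 : Tendsto (fun n => √(‖f‖ ^ 2 - ‖cut (hE n) f‖ ^ 2)) atTop (𝓝 0) := by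
    have := (tendsto_const_nhds (x := ‖f‖ ^ 2)).sub h1
    rw [sub_self] at this
    simpa using this.sqrt
  refine h3.congr fun n => ?_
  rw [norm_sub_rev, norm_sq_cut_add (hE n) f, add_sub_cancel_left, Real.sqrt_sq (norm_nonneg _)]

end Restriction

section Coverings

variable {X : Type*} [MetricSpace X] [MeasurableSpace X] [BorelSpace X] {μ : Measure X}

/-! ### Coverings by balls -/

/-- Removing the balls one after another splits `f` into orthogonal pieces, each supported in one
ball; Cauchy–Schwarz then sums the local norms in `ℓ²`. No bound on the overlap of the balls is
needed. -/
theorem norm_apply_le_of_supportedIn_biUnion {W : Type*} [NormedAddCommGroup W] [NormedSpace ℂ W]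
    (L : Lp ℂ 2 μ →L[ℂ] W) (s : Finset X) (ρ : ℝ) (k : X → ℝ)
    (h : ∀ z ∈ s, ∀ f, SupportedIn f (Metric.ball z ρ) → ‖L f‖ ≤ k z * ‖f‖)
    (f : Lp ℂ 2 μ) (hf : SupportedIn f (⋃ z ∈ s, Metric.ball z ρ)) :
    ‖L f‖ ≤ √(∑ z ∈ s, k z ^ 2) * ‖f‖ := by
  classical
  induction s using Finset.induction_on generalizing f with
  | empty =>
    have : f = 0 := by
      refine Lp.ext ?_
      filter_upwards [hf, Lp.coeFn_zero ℂ 2 μ] with x hx hx2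
      rw [hx2]
      exact hx (by simp)
    simp [this]
  | insert a s ha ih =>
    rw [Finset.set_biUnion_insert] at hf
    have hm : MeasurableSet (Metric.ball a ρ) := measurableSet_ball
    have h1 := h a (Finset.mem_insert_self _ _) _ (supportedIn_cut hm f)
    have h2 := ih (fun z hz => h z (Finset.mem_insert_of_mem hz)) _ (supportedIn_sub_cut hm hf)
    have h3 := norm_sq_cut_add hm f
    rw [Finset.sum_insert ha]
    set u := ‖cut hm f‖
    set v := ‖f - cut hm f‖
    set S := ∑ z ∈ s, k z ^ 2
    have hS : 0 ≤ S := Finset.sum_nonneg fun _ _ => sq_nonneg _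
    have h4 : ‖L f‖ ≤ k a * u + √S * v := by
      calc ‖L f‖ = ‖L (cut hm f) + L (f - cut hm f)‖ := by rw [← map_add, add_sub_cancel]
        _ ≤ _ := (norm_add_le _ _).trans (add_le_add h1 h2)
    refine h4.trans ?_
    rw [← Real.sqrt_sq (norm_nonneg f), h3, ← Real.sqrt_mul (by positivity)]
    refine Real.le_sqrt_of_sq_le ?_
    -- This is `(k_a u + √S v)² ≤ (k_a² + S)(u² + v²)`.
    nlinarith [sq_nonneg (k a * v - √S * u), Real.sq_sqrt hS]

theorem norm_sq_cut_le_of_subset_biUnion {E : Set X} (hE : MeasurableSet E) (s : Finset X) (ρ : ℝ)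
    (h : E ⊆ ⋃ z ∈ s, Metric.ball z ρ) (f : Lp ℂ 2 μ) :
    ‖cut hE f‖ ^ 2 ≤ ∑ z ∈ s, ‖cut (measurableSet_ball (x := z) (ε := ρ)) f‖ ^ 2 := by
  have hi : Integrable (fun x => ‖f x‖ ^ 2) μ := (Lp.memLp f).integrable_norm_pow (by norm_num)
  simp_rw [norm_sq_cut_eq_integral]
  have hU : MeasurableSet (⋃ z ∈ s, Metric.ball z ρ) :=
    s.measurableSet_biUnion fun _ _ => measurableSet_ball
  refine (setIntegral_mono_set hi.integrableOn (Eventually.of_forall fun _ => sq_nonneg _)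
    h.eventuallyLE).trans ?_
  clear h
  classical
  induction s using Finset.induction_on with
  | empty => simp
  | insert a s ha ih =>
    rw [Finset.sum_insert ha, Finset.set_biUnion_insert]
    have hU' : MeasurableSet (⋃ z ∈ s, Metric.ball z ρ) :=
      s.measurableSet_biUnion fun _ _ => measurableSet_ball
    refine le_trans ?_ (add_le_add_right (ih hU') _)
    have h1 : Metric.ball a ρ ∪ (⋃ z ∈ s, Metric.ball z ρ) =
        Metric.ball a ρ ∪ ((⋃ z ∈ s, Metric.ball z ρ) \ Metric.ball a ρ) := by simp
    rw [h1, setIntegral_union disjoint_sdiff_right (hU'.diff measurableSet_ball)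
      hi.integrableOn hi.integrableOn]
    exact add_le_add_right (setIntegral_mono_set hi.integrableOn
      (Eventually.of_forall fun _ => sq_nonneg _) (sdiff_subset).eventuallyLE) _

variable {d : ℝ}

theorem Doubling.pos (h : Doubling μ d) (x : X) {r : ℝ} (hr : 0 < r) :
    0 < μ.real (Metric.ball x r) :=
  ENNReal.toReal_pos (h.1 x r hr).1.ne' (h.1 x r hr).2.ne

theorem Doubling.ne_top (h : Doubling μ d) (x : X) (r : ℝ) : μ (Metric.ball x r) ≠ ∞ := by
  rcases le_or_gt r 0 with hr | hr
  · rw [Metric.ball_eq_empty.2 hr]; simp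
  · exact (h.1 x r hr).2.ne

theorem Doubling.mono (h : Doubling μ d) {x y : X} {r R : ℝ}
    (hs : Metric.ball x r ⊆ Metric.ball y R) :
    μ.real (Metric.ball x r) ≤ μ.real (Metric.ball y R) :=
  measureReal_mono hs (h.ne_top y R)

theorem Doubling.exists_const (h : Doubling μ d) :
    ∃ C : ℝ, 1 ≤ C ∧ ∀ (x y : X) (r R : ℝ), 0 < r → r ≤ R → dist x y ≤ 2 * R →
      μ.real (Metric.ball y R) ≤ C * (R / r) ^ d * μ.real (Metric.ball x r) := by
  obtain ⟨C, hC, hdb⟩ := h.2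
  -- `B(y, R)` lies in `B(x, 3R)`; the maximum with `1` is for later convenience.
  refine ⟨max 1 (C * 3 ^ d), le_max_left _ _, fun x y r R hr hR hxy => ?_⟩
  have hR0 : 0 < R := hr.trans_le hR
  have h1 := hdb x r (3 * (R / r)) hr (by
    have := (one_le_div hr).2 hR
    linarith)
  have h2 : 3 * (R / r) * r = 3 * R := by field_simp
  rw [h2, Real.mul_rpow (by norm_num) (by positivity)] at h1
  refine (h.mono (Metric.ball_subset_ball' ?_)).trans (h1.trans ?_)
  · rw [dist_comm]; linarith
  · rw [← mul_assoc]
    exact mul_le_mul_of_nonneg_right (mul_le_mul_of_nonneg_right (le_max_right _ _)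
      (Real.rpow_nonneg (by positivity) _)) measureReal_nonneg

/-- Take a `ρ`-separated set in `B(x, R)` of maximal cardinality; maximality makes the balls cover.
The half balls are disjoint and contained in `B(x, 2R)`, which bounds the total volume, and hence
the cardinality, so that a maximal set exists. The total volume, unlike the number of balls, is
bounded independently of `R/ρ`. -/
theorem Doubling.exists_covering (h : Doubling μ d) :
    ∃ C : ℝ, 0 < C ∧ ∀ (x : X) (ρ R : ℝ), 0 < ρ → ρ ≤ R →
      ∃ s : Finset X, Metric.ball x R ⊆ ⋃ z ∈ s, Metric.ball z ρ ∧
        ∑ z ∈ s, μ.real (Metric.ball z ρ) ≤ C * μ.real (Metric.ball x R) := by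
  classical
  obtain ⟨C, hC, hV⟩ := h.exists_const
  have hC0 : 0 < C := by linarith
  -- One factor `C * 2 ^ d` pays for halving the radius `ρ`, the other for enlarging `R` to `2R`.
  refine ⟨C * 2 ^ d * (C * 2 ^ d), by positivity, fun x ρ R hρ hR => ?_⟩
  have hR0 : 0 < R := hρ.trans_le hR
  let P : Finset X → Prop := fun s => (∀ z ∈ s, z ∈ Metric.ball x R) ∧
    ∀ z ∈ s, ∀ w ∈ s, z ≠ w → ρ ≤ dist z w
  have hsum : ∀ s, P s → ∑ z ∈ s, μ.real (Metric.ball z ρ) ≤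
      C * 2 ^ d * (C * 2 ^ d) * μ.real (Metric.ball x R) := by
    intro s hs
    have h1 : ∑ z ∈ s, μ.real (Metric.ball z ρ) ≤
        ∑ z ∈ s, C * 2 ^ d * μ.real (Metric.ball z (ρ / 2)) := by
      refine Finset.sum_le_sum fun z _ => ?_
      have := hV z z (ρ / 2) ρ (by positivity) (by linarith) (by rw [dist_self]; positivity)
      rwa [show ρ / (ρ / 2) = 2 by field_simp] at this
    have h2 : ∑ z ∈ s, μ.real (Metric.ball z (ρ / 2)) ≤ μ.real (Metric.ball x (2 * R)) := by
      rw [← measureReal_biUnion_finset (fun z hz w hw hzw => ?_) (fun _ _ => measurableSet_ball)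
        (fun z _ => h.ne_top _ _)]
      · refine measureReal_mono (iUnion₂_subset fun z hz => Metric.ball_subset_ball' ?_)
          (h.ne_top _ _)
        have := hs.1 z hz
        rw [Metric.mem_ball] at this
        linarith
      · refine Metric.ball_disjoint_ball ?_
        have := hs.2 z hz w hw hzw
        linarith
    have h3 := hV x x R (2 * R) hR0 (by linarith) (by rw [dist_self]; positivity)
    rw [show 2 * R / R = 2 by field_simp] at h3
    rw [← Finset.mul_sum] at h1
    calc _ ≤ _ := h1
      _ ≤ C * 2 ^ d * (C * 2 ^ d * μ.real (Metric.ball x R)) :=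
        mul_le_mul_of_nonneg_left (h2.trans h3) (by positivity)
      _ = _ := by ring
  have hVx := h.pos x hR0
  have hcard : ∀ s, P s → (s.card : ℝ) ≤
      C * 2 ^ d * (C * 2 ^ d) * (C * (R / ρ) ^ d) := by
    intro s hs
    have h1 : ∑ z ∈ s, μ.real (Metric.ball x R) ≤
        ∑ z ∈ s, C * (R / ρ) ^ d * μ.real (Metric.ball z ρ) := by
      refine Finset.sum_le_sum fun z hz => hV z x ρ R hρ hR ?_
      have := hs.1 z hz
      rw [Metric.mem_ball] at this
      linarith
    rw [Finset.sum_const, nsmul_eq_mul, ← Finset.mul_sum] at h1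
    have h2 := h1.trans (mul_le_mul_of_nonneg_left (hsum s hs) (by positivity))
    refine le_of_mul_le_mul_right (h2.trans (le_of_eq ?_)) hVx
    ring
  obtain ⟨B, hB⟩ := exists_nat_ge (C * 2 ^ d * (C * 2 ^ d) * (C * (R / ρ) ^ d))
  have hex : ∃ n, ∃ s, P s ∧ s.card = n := ⟨0, ∅, by simp [P], rfl⟩
  have hbd : ∀ n, (∃ s, P s ∧ s.card = n) → n ≤ B := by
    rintro n ⟨s, hs, rfl⟩
    exact_mod_cast (hcard s hs).trans hB
  obtain ⟨s, hs, hmax⟩ : ∃ s, P s ∧ ∀ t, P t → t.card ≤ s.card := by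
    obtain ⟨n₀, hn₀⟩ := hex
    have hg := Nat.findGreatest_spec (P := fun n => ∃ s, P s ∧ s.card = n) (hbd n₀ hn₀) hn₀
    obtain ⟨s, hs, hsc⟩ := hg
    refine ⟨s, hs, fun t ht => ?_⟩
    rw [hsc]
    exact Nat.le_findGreatest (hbd _ ⟨t, ht, rfl⟩) ⟨t, ht, rfl⟩
  refine ⟨s, fun y hy => ?_, hsum s hs⟩
  by_contra hcon
  simp only [mem_iUnion, Metric.mem_ball, not_exists, not_lt] at hcon
  have hys : y ∉ s := fun hys => by
    have := hcon y hys
    rw [dist_self] at this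
    linarith
  have hP : P (insert y s) := by
    refine ⟨fun z hz => ?_, fun z hz w hw hzw => ?_⟩
    · rcases Finset.mem_insert.1 hz with rfl | hz
      exacts [hy, hs.1 z hz]
    · rcases Finset.mem_insert.1 hz with hz' | hz' <;> rcases Finset.mem_insert.1 hw with hw' | hw'
      · exact (hzw (hz'.trans hw'.symm)).elim
      · exact hz' ▸ hcon w hw'
      · rw [dist_comm]; exact hw' ▸ hcon z hz'
      · exact hs.2 z hz' w hw' hzw
  have := hmax _ hP
  rw [Finset.card_insert_of_notMem hys] at this
  omega

/-- `‖S‖_{L²(B) → L²(B')} ≤ K μ(B)^{1/2} μ(B')^{1/2}` for any two balls of radius `ρ`. -/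
def BallBound (S : Lp ℂ 2 μ →L[ℂ] Lp ℂ 2 μ) (ρ K : ℝ) : Prop :=
  ∀ (x y : X) (f : Lp ℂ 2 μ), SupportedIn f (Metric.ball x ρ) →
    ‖cut (measurableSet_ball (x := y) (ε := ρ)) (S f)‖ ≤
      K * √(μ.real (Metric.ball x ρ)) * √(μ.real (Metric.ball y ρ)) * ‖f‖

/-- Cover both large balls by balls of radius `ρ` and sum the squares of the local bounds. As
`BallBound` is proportional to `μ(B)^{1/2} μ(B')^{1/2}`, the squares add up to the volumes of the
coverings, with no loss in `R/ρ` or `R'/ρ`. -/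
theorem Doubling.exists_ballBound_const (h : Doubling μ d) :
    ∃ C : ℝ, 0 < C ∧ ∀ (S : Lp ℂ 2 μ →L[ℂ] Lp ℂ 2 μ) (ρ K : ℝ), 0 < ρ → 0 ≤ K →
      BallBound S ρ K → ∀ (x y : X) (R R' : ℝ), ρ ≤ R → ρ ≤ R' → ∀ f : Lp ℂ 2 μ,
      SupportedIn f (Metric.ball x R) →
      ‖cut (measurableSet_ball (x := y) (ε := R')) (S f)‖ ≤
        C * K * √(μ.real (Metric.ball x R)) * √(μ.real (Metric.ball y R')) * ‖f‖ := by
  obtain ⟨C, hC, hcov⟩ := h.exists_covering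
  refine ⟨C, hC, fun S ρ K hρ hK hS x y R R' hR hR' f hf => ?_⟩
  obtain ⟨s, hs, hsum⟩ := hcov x ρ R hρ hR
  obtain ⟨s', hs', hsum'⟩ := hcov y ρ R' hρ hR'
  have h1 : ∀ w : X, ‖cut (measurableSet_ball (x := w) (ε := ρ)) (S f)‖ ≤
      √(∑ z ∈ s, (K * √(μ.real (Metric.ball z ρ)) * √(μ.real (Metric.ball w ρ))) ^ 2) * ‖f‖ :=
    fun w => norm_apply_le_of_supportedIn_biUnion ((cut measurableSet_ball).comp S) s ρ _
      (fun z _ g hg => hS z w g hg) f (hf.mono hs)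
  have h2 : ∀ w : X, ‖cut (measurableSet_ball (x := w) (ε := ρ)) (S f)‖ ^ 2 ≤
      K ^ 2 * (C * μ.real (Metric.ball x R)) * μ.real (Metric.ball w ρ) * ‖f‖ ^ 2 := by
    intro w
    have h3 := pow_le_pow_left₀ (norm_nonneg _) (h1 w) 2
    rw [mul_pow, Real.sq_sqrt (Finset.sum_nonneg fun _ _ => sq_nonneg _)] at h3
    refine h3.trans (mul_le_mul_of_nonneg_right ?_ (sq_nonneg _))
    simp_rw [mul_pow, Real.sq_sqrt measureReal_nonneg]
    rw [← Finset.sum_mul, ← Finset.mul_sum]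
    gcongr
  have h4 := norm_sq_cut_le_of_subset_biUnion (measurableSet_ball (x := y) (ε := R')) s' ρ hs' (S f)
  have h5 : ‖cut (measurableSet_ball (x := y) (ε := R')) (S f)‖ ^ 2 ≤
      K ^ 2 * (C * μ.real (Metric.ball x R)) * (C * μ.real (Metric.ball y R')) * ‖f‖ ^ 2 := by
    refine h4.trans ((Finset.sum_le_sum fun w _ => h2 w).trans ?_)
    rw [← Finset.sum_mul, ← Finset.mul_sum]
    gcongr
  refine le_of_sq_le_sq (h5.trans (le_of_eq ?_)) (by positivity)
  simp only [mul_pow, Real.sq_sqrt measureReal_nonneg]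
  ring

/-! ### Dyadic shells -/

/-- The ball `B(x, 2ρ)` for `j = 0`, the shell `B(x, 2^{j+1}ρ) \ B(x, 2^jρ)` for `j ≥ 1`. -/
def shell (x : X) (ρ : ℝ) (j : ℕ) : Set X :=
  Metric.ball x (2 ^ (j + 1) * ρ) \ if j = 0 then ∅ else Metric.ball x (2 ^ j * ρ)

theorem measurableSet_shell (x : X) (ρ : ℝ) (j : ℕ) : MeasurableSet (shell x ρ j) := by
  refine measurableSet_ball.diff ?_
  split_ifs
  exacts [MeasurableSet.empty, measurableSet_ball]

theorem shell_subset (x : X) (ρ : ℝ) (j : ℕ) : shell x ρ j ⊆ Metric.ball x (2 ^ (j + 1) * ρ) :=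
  sdiff_subset

theorem disjoint_ball_shell (x : X) {ρ : ℝ} (hρ : 0 < ρ) {j : ℕ} (hj : 1 ≤ j) :
    Disjoint (Metric.ball x ρ) (shell x ρ j) := by
  rw [shell, if_neg (by omega)]
  refine disjoint_sdiff_right.mono_left (Metric.ball_subset_ball ?_)
  exact le_mul_of_one_le_left hρ.le (one_le_pow₀ (by norm_num))

theorem sum_cut_shell (x : X) {ρ : ℝ} (hρ : 0 < ρ) (n : ℕ) (f : Lp ℂ 2 μ) :
    ∑ j ∈ Finset.range (n + 1), cut (measurableSet_shell x ρ j) f =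
      cut (measurableSet_ball (x := x) (ε := 2 ^ (n + 1) * ρ)) f := by
  have hcongr : ∀ {A B : Set X} (hA : MeasurableSet A) (hB : MeasurableSet B), A = B →
      cut hA f = cut hB f := by
    rintro A B hA hB rfl
    rfl
  induction n with
  | zero =>
    rw [zero_add, Finset.sum_range_one]
    exact hcongr (measurableSet_shell x ρ 0) measurableSet_ball (by simp [shell])
  | succ n ih =>
    rw [Finset.sum_range_succ, ih]
    have h1 : cut (measurableSet_shell x ρ (n + 1)) f =
        cut ((measurableSet_ball (x := x) (ε := 2 ^ (n + 1 + 1) * ρ)).diff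
          (measurableSet_ball (x := x) (ε := 2 ^ (n + 1) * ρ))) f :=
      hcongr (measurableSet_shell x ρ (n + 1)) _ (by simp [shell])
    have h2 : Metric.ball x (2 ^ (n + 1) * ρ) ⊆ Metric.ball x (2 ^ (n + 1 + 1) * ρ) :=
      Metric.ball_subset_ball (mul_le_mul_of_nonneg_right
        (pow_le_pow_right₀ (by norm_num) (by omega)) hρ.le)
    rw [h1, cut_sdiff measurableSet_ball measurableSet_ball h2, add_sub_cancel]

theorem tendsto_sum_cut_shell (x : X) {ρ : ℝ} (hρ : 0 < ρ) (f : Lp ℂ 2 μ) :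
    Tendsto (fun n => ∑ j ∈ Finset.range (n + 1), cut (measurableSet_shell x ρ j) f) atTop
      (𝓝 f) := by
  simp_rw [sum_cut_shell x hρ]
  refine tendsto_cut (fun n => measurableSet_ball) ?_ ?_ f
  · intro m n hmn
    refine Metric.ball_subset_ball (mul_le_mul_of_nonneg_right ?_ hρ.le)
    exact pow_le_pow_right₀ (by norm_num) (by omega)
  · rw [eq_univ_iff_forall]
    intro y
    obtain ⟨n, hn⟩ := pow_unbounded_of_one_lt (dist y x / ρ) (one_lt_two (α := ℝ))
    refine mem_iUnion.2 ⟨n, ?_⟩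
    rw [Metric.mem_ball]
    rw [div_lt_iff₀ hρ] at hn
    refine hn.trans_le (mul_le_mul_of_nonneg_right ?_ hρ.le)
    exact pow_le_pow_right₀ (by norm_num) (by omega)

/-- The decay `2^{-j(d/2+1)}` of a function on the shells of radius `ρ`. -/
def ShellDecay (d : ℝ) (x : X) (ρ a : ℝ) (F : Lp ℂ 2 μ) : Prop :=
  ∀ j : ℕ, ‖cut (measurableSet_shell x ρ j) F‖ ≤ a * ((2 : ℝ) ^ (-(d / 2 + 1))) ^ j

/-- The square root of the volume grows at most like `2^{jd/2}`, so the rate `2^{-j(d/2+1)}` leaves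
a summable factor `2^{-j}`. -/
theorem Doubling.exists_shell_const (h : Doubling μ d) :
    ∃ C : ℝ, 0 < C ∧ ∀ (x : X) (ρ : ℝ) (j : ℕ), 0 < ρ →
      √(μ.real (Metric.ball x (2 ^ (j + 1) * ρ))) * ((2 : ℝ) ^ (-(d / 2 + 1))) ^ j ≤
        C * √(μ.real (Metric.ball x ρ)) * (1 / 2) ^ j := by
  obtain ⟨C, hC, hV⟩ := h.exists_const
  have hC0 : 0 < C := by linarith
  refine ⟨√(C * 2 ^ d), by positivity, fun x ρ j hρ => ?_⟩
  have h1 := hV x x ρ (2 ^ (j + 1) * ρ) hρ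
    (le_mul_of_one_le_left hρ.le (one_le_pow₀ (by norm_num))) (by rw [dist_self]; positivity)
  rw [mul_div_cancel_right₀ _ hρ.ne'] at h1
  have h2 := Real.sqrt_le_sqrt h1
  rw [Real.sqrt_mul (by positivity)] at h2
  have h3 : √(C * ((2 : ℝ) ^ (j + 1)) ^ d) = √(C * 2 ^ d) * ((2 : ℝ) ^ (d / 2)) ^ j := by
    rw [Real.sqrt_eq_iff_mul_self_eq (by positivity) (by positivity), mul_mul_mul_comm,
      Real.mul_self_sqrt (by positivity), ← mul_pow, ← Real.rpow_add two_pos, add_halves,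
      pow_succ, Real.mul_rpow (by positivity) (by positivity), ← Real.rpow_natCast,
      ← Real.rpow_natCast, ← Real.rpow_mul two_pos.le, ← Real.rpow_mul two_pos.le]
    ring_nf
  rw [h3] at h2
  have h4 : ((2 : ℝ) ^ (d / 2)) ^ j * ((2 : ℝ) ^ (-(d / 2 + 1))) ^ j = (1 / 2) ^ j := by
    rw [← mul_pow, ← Real.rpow_add two_pos]
    congr 1
    rw [show d / 2 + -(d / 2 + 1) = -1 by ring, Real.rpow_neg_one]
    norm_num
  calc _ ≤ √(C * 2 ^ d) * ((2 : ℝ) ^ (d / 2)) ^ j * √(μ.real (Metric.ball x ρ)) *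
        ((2 : ℝ) ^ (-(d / 2 + 1))) ^ j := mul_le_mul_of_nonneg_right h2 (by positivity)
    _ = √(C * 2 ^ d) * √(μ.real (Metric.ball x ρ)) *
        (((2 : ℝ) ^ (d / 2)) ^ j * ((2 : ℝ) ^ (-(d / 2 + 1))) ^ j) := by ring
    _ = _ := by rw [h4]

/-- Split `F` and `G` into shells. Each block is controlled by the bound between the balls
containing the two shells, and the decay beats the volume growth, so the double series is dominated
by a product of two geometric series. The radii `R` and `R'` may differ and need only be at least
`ρ`. -/
theorem Doubling.exists_inner_le (h : Doubling μ d) :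
    ∃ C : ℝ, 0 < C ∧ ∀ (S : Lp ℂ 2 μ →L[ℂ] Lp ℂ 2 μ) (ρ K : ℝ), 0 < ρ → 0 ≤ K →
      BallBound S ρ K → ∀ (x y : X) (R R' a b : ℝ), ρ ≤ R → ρ ≤ R' → ∀ F G : Lp ℂ 2 μ,
      ShellDecay d x R a F → ShellDecay d y R' b G →
      ‖⟪G, S F⟫_ℂ‖ ≤ C * K * (√(μ.real (Metric.ball x R)) * a) *
        (√(μ.real (Metric.ball y R')) * b) := by
  obtain ⟨C₁, hC₁, h1⟩ := h.exists_ballBound_const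
  obtain ⟨C₂, hC₂, h2⟩ := h.exists_shell_const
  refine ⟨C₁ * C₂ * C₂ * 4, by positivity, fun S ρ K hρ hK hS x y R R' a b hR hR' F G hF hG => ?_⟩
  have hR0 : 0 < R := hρ.trans_le hR
  have hR0' : 0 < R' := hρ.trans_le hR'
  have ha : 0 ≤ a := by simpa using (norm_nonneg _).trans (hF 0)
  have hb : 0 ≤ b := by simpa using (norm_nonneg _).trans (hG 0)
  have hle : ∀ {R : ℝ} (j : ℕ), 0 < R → R ≤ 2 ^ (j + 1) * R := fun j hR =>
    le_mul_of_one_le_left hR.le (one_le_pow₀ (by norm_num))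
  have hterm : ∀ i j : ℕ, ‖⟪cut (measurableSet_shell y R' i) G,
      S (cut (measurableSet_shell x R j) F)⟫_ℂ‖ ≤
      C₁ * C₂ * C₂ * K * (√(μ.real (Metric.ball x R)) * a) * (√(μ.real (Metric.ball y R')) * b) *
        ((1 / 2) ^ i * (1 / 2) ^ j) := by
    intro i j
    rw [← inner_cut_cut]
    refine (norm_inner_le_norm _ _).trans ?_
    have h3 := (norm_cut_mono (measurableSet_shell y R' i) measurableSet_ball
      (shell_subset y R' i) _).trans (h1 S ρ K hρ hK hS x y (2 ^ (j + 1) * R) (2 ^ (i + 1) * R')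
        (hR.trans (hle j hR0)) (hR'.trans (hle i hR0')) _
        ((supportedIn_cut (measurableSet_shell x R j) F).mono (shell_subset x R j)))
    have hF' := hF j
    have hG' := hG i
    have h2x := h2 x R j hR0
    have h2y := h2 y R' i hR0'
    set w : ℝ := (2 : ℝ) ^ (-(d / 2 + 1))
    have hw : 0 ≤ w := by positivity
    calc _ ≤ (b * w ^ i) * (C₁ * K * √(μ.real (Metric.ball x (2 ^ (j + 1) * R))) *
          √(μ.real (Metric.ball y (2 ^ (i + 1) * R'))) * (a * w ^ j)) := by
          refine mul_le_mul hG' (h3.trans ?_) (norm_nonneg _) (by positivity)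
          exact mul_le_mul_of_nonneg_left hF' (by positivity)
      _ = C₁ * K * a * b * ((√(μ.real (Metric.ball x (2 ^ (j + 1) * R))) * w ^ j) *
          (√(μ.real (Metric.ball y (2 ^ (i + 1) * R'))) * w ^ i)) := by ring
      _ ≤ C₁ * K * a * b * ((C₂ * √(μ.real (Metric.ball x R)) * (1 / 2) ^ j) *
          (C₂ * √(μ.real (Metric.ball y R')) * (1 / 2) ^ i)) := by gcongr
      _ = _ := by ring
  have hlim : Tendsto (fun n => ‖⟪∑ i ∈ Finset.range (n + 1), cut (measurableSet_shell y R' i) G,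
      S (∑ j ∈ Finset.range (n + 1), cut (measurableSet_shell x R j) F)⟫_ℂ‖) atTop
      (𝓝 ‖⟪G, S F⟫_ℂ‖) :=
    ((tendsto_sum_cut_shell y hR0' G).inner
      ((S.continuous.tendsto _).comp (tendsto_sum_cut_shell x hR0 F))).norm
  have hgeo : ∀ n : ℕ, ∑ i ∈ Finset.range n, ((1 : ℝ) / 2) ^ i ≤ 2 := fun n =>
    (summable_geometric_two.sum_le_tsum _ fun _ _ => by positivity).trans tsum_geometric_two.le
  refine le_of_tendsto' hlim fun n => ?_
  rw [map_sum, sum_inner]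
  simp_rw [inner_sum]
  refine (norm_sum_le _ _).trans ((Finset.sum_le_sum fun i _ => norm_sum_le _ _).trans
    ((Finset.sum_le_sum fun i _ => Finset.sum_le_sum fun j _ => hterm i j).trans ?_))
  simp_rw [← Finset.mul_sum]
  rw [← Finset.sum_mul]
  set s := ∑ i ∈ Finset.range (n + 1), ((1 : ℝ) / 2) ^ i
  have hs0 : 0 ≤ s := Finset.sum_nonneg fun _ _ => by positivity
  have hs : s * s ≤ 4 := by nlinarith [hgeo (n + 1)]
  calc _ ≤ C₁ * C₂ * C₂ * K * (√(μ.real (Metric.ball x R)) * a) *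
        (√(μ.real (Metric.ball y R')) * b) * 4 := mul_le_mul_of_nonneg_left hs (by positivity)
    _ = _ := by ring

end Coverings

/-! ### Consequences of the Davies–Gaffney and on-diagonal estimates -/

section HeatBounds

variable {X : Type*} [MetricSpace X] [MeasurableSpace X] [BorelSpace X] {μ : Measure X} {d : ℝ}
  {H : Lp ℂ 2 μ →ₗ.[ℂ] Lp ℂ 2 μ}

/-! ### Off-diagonal bounds -/

theorem setDist_nonneg (E F : Set X) : 0 ≤ setDist E F :=
  Real.iInf_nonneg fun _ => dist_nonneg

/-- The restriction `t ≲ diam X` can be dropped: for larger `t` the exponent `d(E,F)²/(4t)` is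
bounded by `diam X/(4κ)`, and contractivity of the semigroup suffices after enlarging the constant.
-/
theorem DaviesGaffney.exists_bound (hDG : DaviesGaffney H) (hH : IsNonnegSelfAdjoint H) :
    ∃ C : ℝ, 0 < C ∧ ∀ t : ℝ, 0 < t → ∀ (E F : Set X), MeasurableSet E → ∀ hF : MeasurableSet F,
      ∀ f : Lp ℂ 2 μ, SupportedIn f E →
        ‖cut hF (heat H t f)‖ ≤ C * Real.exp (-(setDist E F ^ 2 / (4 * t))) * ‖f‖ := by
  obtain ⟨C, κ, hC, hκ, h⟩ := hDG
  refine ⟨max C (Real.exp (Metric.diam (univ : Set X) / (4 * κ))), by positivity,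
    fun t ht E F hE hF f hf => ?_⟩
  by_cases hb : BelowDiam X κ t
  · refine ((h t ht hb E F hE hF).norm_cut_le hF (by positivity) hf).trans ?_
    gcongr
    exact le_max_left _ _
  · rw [BelowDiam] at hb
    push Not at hb
    obtain ⟨hbd, hlt⟩ := hb
    set D := Metric.diam (univ : Set X)
    have hD : 0 ≤ D := Metric.diam_nonneg
    have hdist : setDist E F ≤ D := by
      rcases isEmpty_or_nonempty (E × F) with he | ⟨⟨p⟩⟩
      · rw [setDist, Real.iInf_of_isEmpty]; exact hD
      · refine (ciInf_le ⟨0, ?_⟩ p).trans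
          (Metric.dist_le_diam_of_mem hbd (mem_univ _) (mem_univ _))
        rintro _ ⟨q, rfl⟩
        exact dist_nonneg
    have h1 : setDist E F ^ 2 / (4 * t) ≤ D / (4 * κ) := by
      rw [div_le_div_iff₀ (by positivity) (by positivity)]
      have := setDist_nonneg E F
      nlinarith [mul_le_mul hdist hdist this hD, mul_le_mul_of_nonneg_left hlt.le hD]
    have h2 : 1 ≤ max C (Real.exp (D / (4 * κ))) * Real.exp (-(setDist E F ^ 2 / (4 * t))) := by
      calc (1 : ℝ) = Real.exp (D / (4 * κ)) * Real.exp (-(D / (4 * κ))) := by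
            rw [← Real.exp_add, add_neg_cancel, Real.exp_zero]
        _ ≤ _ := mul_le_mul (le_max_right _ _) (Real.exp_le_exp.2 (neg_le_neg h1))
            (Real.exp_pos _).le (by positivity)
    exact (norm_cut_le _ _).trans ((norm_heat_apply_le hH ht f).trans
      (le_mul_of_one_le_left (norm_nonneg _) h2))

/-- The Gaussian factor is traded for an arbitrary power `N` by `e^{-y} ≤ N! y^{-N}`. -/
theorem DaviesGaffney.exists_shell_bound (hDG : DaviesGaffney H) (hH : IsNonnegSelfAdjoint H)
    (N : ℕ) : ∃ C : ℝ, 0 < C ∧ ∀ (x : X) (r ρ t : ℝ) (j : ℕ) (f : Lp ℂ 2 μ), 0 < r → r ≤ ρ →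
      0 < t → 1 ≤ j → SupportedIn f (Metric.ball x r) →
      ‖cut (measurableSet_shell x ρ j) (heat H t f)‖ ≤ C * (t / (4 ^ j * ρ ^ 2)) ^ N * ‖f‖ := by
  obtain ⟨C, hC, h⟩ := hDG.exists_bound hH
  refine ⟨C * (N.factorial * 16 ^ N), by positivity, fun x r ρ t j f hr hρ ht hj hf => ?_⟩
  have hρ0 : 0 < ρ := hr.trans_le hρ
  -- For an empty shell `setDist` is `0` by convention and carries no information.
  rcases (shell x ρ j).eq_empty_or_nonempty with he | hne
  · refine (norm_cut_mono _ MeasurableSet.empty he.subset _).trans ?_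
    rw [norm_cut, Measure.restrict_empty, eLpNorm_measure_zero, ENNReal.toReal_zero]
    positivity
  · refine (h t ht _ _ measurableSet_ball (measurableSet_shell x ρ j) f hf).trans ?_
    refine mul_le_mul_of_nonneg_right ?_ (norm_nonneg _)
    rw [mul_assoc]
    refine mul_le_mul_of_nonneg_left ?_ hC.le
    -- Here `2^j ρ - r ≥ 2^j ρ / 2`, since `r ≤ ρ` and `j ≥ 1`.
    have hdist : 2 ^ j * ρ / 2 ≤ setDist (Metric.ball x r) (shell x ρ j) := by
      have : Nonempty (Metric.ball x r × shell x ρ j) :=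
        ⟨⟨x, Metric.mem_ball_self hr⟩, ⟨hne.some, hne.some_mem⟩⟩
      refine le_ciInf fun p => ?_
      obtain ⟨⟨y, hy⟩, ⟨z, hz⟩⟩ := p
      rw [shell, if_neg (by omega)] at hz
      have h1 := hz.2
      rw [Metric.mem_ball, not_lt] at h1
      rw [Metric.mem_ball] at hy
      have h2 := dist_triangle z y x
      have h3 : (2 : ℝ) ≤ 2 ^ j := by
        calc (2 : ℝ) = 2 ^ 1 := (pow_one _).symm
          _ ≤ 2 ^ j := pow_le_pow_right₀ (by norm_num) hj
      rw [dist_comm z y] at h2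
      dsimp only
      nlinarith
    set y : ℝ := 4 ^ j * ρ ^ 2 / (16 * t) with hy
    have hy0 : 0 < y := by positivity
    have h1 : y ≤ setDist (Metric.ball x r) (shell x ρ j) ^ 2 / (4 * t) := by
      have h4 : (4 : ℝ) ^ j = 2 ^ j * 2 ^ j := by rw [← mul_pow]; norm_num
      rw [hy, div_le_div_iff₀ (by positivity) (by positivity)]
      have h5 := pow_le_pow_left₀ (by positivity) hdist 2
      rw [h4]
      nlinarith
    have h2 := Real.pow_div_factorial_le_exp y hy0.le N
    calc Real.exp (-(setDist (Metric.ball x r) (shell x ρ j) ^ 2 / (4 * t)))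
        ≤ Real.exp (-y) := Real.exp_le_exp.2 (neg_le_neg h1)
      _ ≤ N.factorial * (y⁻¹) ^ N := by
          rw [Real.exp_neg, inv_le_iff_one_le_mul₀ (Real.exp_pos _), mul_comm]
          rw [div_le_iff₀ (by positivity)] at h2
          have h6 : y⁻¹ ^ N * y ^ N = 1 := by rw [← mul_pow, inv_mul_cancel₀ hy0.ne', one_pow]
          calc (1 : ℝ) = y⁻¹ ^ N * y ^ N := h6.symm
            _ ≤ y⁻¹ ^ N * (Real.exp y * N.factorial) :=
              mul_le_mul_of_nonneg_left h2 (by positivity)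
            _ = _ := by ring
      _ = _ := by
          rw [hy, inv_div, mul_div_assoc, mul_pow]
          ring

/-! ### Smoothing bounds -/

/-- By definition `∫ |p_t(x,y)|² dμ(y)` is the diagonal value at time `2t`. Hence almost every slice
`p_t(x,·)` is in `L²`, and its conjugate `k x` represents evaluation of `e^{-tH} f` at `x`. The
bound at `2t` is weakened to the ball of radius `√t`. -/
theorem DUE.exists_repr (hDUE : DUE H) (hd : Doubling μ d) [SFinite μ] :
    ∃ C : ℝ, 0 < C ∧ ∀ t : ℝ, 0 < t → ∃ k : X → Lp ℂ 2 μ,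
      (∀ᵐ x ∂μ, ‖k x‖ ^ 2 ≤ C / μ.real (Metric.ball x √t)) ∧
      ∀ f : Lp ℂ 2 μ, ∀ᵐ x ∂μ, heat H t f x = ⟪k x, f⟫_ℂ := by
  classical
  obtain ⟨p, hp, C, hC, hb⟩ := hDUE
  refine ⟨C, hC, fun t ht => ?_⟩
  obtain ⟨hmeas, hrep⟩ := hp t ht
  have hslice : ∀ᵐ x ∂μ, MemLp (fun y => star (p t x y)) 2 μ ∧
      (eLpNorm (fun y => star (p t x y)) 2 μ) ^ 2 ≤
        ENNReal.ofReal (C / μ.real (Metric.ball x √t)) := by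
    filter_upwards [hmeas.prodMk_left, hb (2 * t) (by positivity)] with x h1 h2
    have h1' : AEStronglyMeasurable (fun y => star (p t x y)) μ :=
      continuous_star.comp_aestronglyMeasurable h1
    have h3 : (eLpNorm (fun y => star (p t x y)) 2 μ) ^ 2 = diagKernel μ p (2 * t) x := by
      rw [eLpNorm_eq_lintegral_rpow_enorm_toReal (by norm_num) (by norm_num), ← ENNReal.rpow_natCast,
        ← ENNReal.rpow_mul, diagKernel]
      simp only [ENNReal.toReal_ofNat, Nat.cast_ofNat, one_div, ne_eq, OfNat.ofNat_ne_zero,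
        not_false_eq_true, inv_mul_cancel₀, ENNReal.rpow_one]
      refine lintegral_congr fun y => ?_
      rw [show 2 * t / 2 = t by ring, ← ofReal_norm, ← ofReal_norm, norm_star]
      exact_mod_cast ENNReal.rpow_natCast _ 2
    have hpos := hd.pos x (Real.sqrt_pos.2 ht)
    have h4 : diagKernel μ p (2 * t) x ≤ ENNReal.ofReal (C / μ.real (Metric.ball x √t)) := by
      refine h2.trans ?_
      rw [ENNReal.ofReal_div_of_pos hpos, ofReal_measureReal (hd.ne_top _ _)]
      gcongr
      linarith
    refine ⟨⟨h1', ?_⟩, h3 ▸ h4⟩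
    have h5 := (h3 ▸ h4).trans_lt ENNReal.ofReal_lt_top
    exact (ENNReal.pow_lt_top_iff.1 h5).resolve_right two_ne_zero
  refine ⟨fun x => if h : MemLp (fun y => star (p t x y)) 2 μ then h.toLp else 0, ?_, fun f => ?_⟩
  · filter_upwards [hslice] with x hx
    have hpos := hd.pos x (Real.sqrt_pos.2 ht)
    rw [dif_pos hx.1, Lp.norm_toLp, ← ENNReal.toReal_pow]
    exact ENNReal.toReal_le_of_le_ofReal (by positivity) hx.2
  · filter_upwards [hslice, hrep f] with x hx hx2
    rw [hx2, dif_pos hx.1, L2.inner_def]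
    refine integral_congr_ae ?_
    filter_upwards [hx.1.coeFn_toLp] with y hy
    rw [hy]
    simp [mul_comm]

theorem norm_inner_le_of_bounded_on {B : Set X} (hB : MeasurableSet B) (hBfin : μ B ≠ ∞)
    {f g : Lp ℂ 2 μ} (hf : SupportedIn f B) {c : ℝ} (hc : 0 ≤ c) (hg : ∀ᵐ x ∂μ, x ∈ B → ‖g x‖ ≤ c) :
    ‖⟪f, g⟫_ℂ‖ ≤ ‖f‖ * (c * √(μ.real B)) := by
  rw [← hf.cut_eq hB, ← inner_cut_cut, hf.cut_eq hB]
  refine (norm_inner_le_norm _ _).trans (mul_le_mul_of_nonneg_left ?_ (norm_nonneg _))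
  refine le_of_sq_le_sq ?_ (by positivity)
  rw [norm_sq_cut_eq_integral, mul_pow, Real.sq_sqrt measureReal_nonneg]
  have h1 : ∫ x in B, ‖g x‖ ^ 2 ∂μ ≤ ∫ x in B, c ^ 2 ∂μ := by
    refine setIntegral_mono_on_ae
      ((Lp.memLp g).integrable_norm_pow (by norm_num)).integrableOn
      (integrableOn_const hBfin) hB ?_
    filter_upwards [hg] with x hx hxB
    exact pow_le_pow_left₀ (norm_nonneg _) (hx hxB) 2
  refine h1.trans (le_of_eq ?_)
  rw [setIntegral_const, smul_eq_mul, mul_comm]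

theorem norm_heat_sq (f : Lp ℂ 2 μ) (t : ℝ) :
    ‖heat H t f‖ ^ 2 = ‖⟪f, heat H t (heat H t f)⟫_ℂ‖ := by
  rw [← inner_heat, inner_self_eq_norm_sq_to_K]
  simp

/-- A duality argument: with `h = e^{-tH} f`, one has `‖h‖² = |⟪f, e^{-tH} h⟫|`. On the support of
`f` the function `e^{-tH} h` is at most `‖k y‖ ‖h‖`, and one factor `‖h‖` cancels. The condition `r
≤ 2√t` makes the volumes at `y` and `x` comparable. -/
theorem DUE.exists_smoothing (hDUE : DUE H) (hd : Doubling μ d) [SFinite μ] :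
    ∃ C : ℝ, 0 < C ∧ ∀ (x : X) (r t : ℝ) (f : Lp ℂ 2 μ), 0 < r → 0 < t → r ≤ 2 * √t →
      SupportedIn f (Metric.ball x r) →
      ‖heat H t f‖ ≤ C * √(μ.real (Metric.ball x r) / μ.real (Metric.ball x √t)) * ‖f‖ := by
  obtain ⟨C, hC, hrep⟩ := hDUE.exists_repr hd
  obtain ⟨C', hC', hV⟩ := hd.exists_const
  refine ⟨√(C * C'), by positivity, fun x r t f hr ht hrt hf => ?_⟩
  have hst : 0 < √t := Real.sqrt_pos.2 ht
  obtain ⟨k, hk1, hk2⟩ := hrep t ht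
  set h := heat H t f
  set c := √(C * C' / μ.real (Metric.ball x √t)) * ‖h‖
  have hpos := hd.pos x hst
  have hbd : ∀ᵐ y ∂μ, y ∈ Metric.ball x r → ‖heat H t h y‖ ≤ c := by
    filter_upwards [hk1, hk2 h] with y h1 h2 hy
    rw [h2]
    refine (norm_inner_le_norm _ _).trans (mul_le_mul_of_nonneg_right ?_ (norm_nonneg _))
    refine Real.le_sqrt_of_sq_le (h1.trans ?_)
    have hposy := hd.pos y hst
    rw [Metric.mem_ball] at hy
    have h3 := hV y x √t √t hst le_rfl (by linarith)
    rw [div_self hst.ne', Real.one_rpow, mul_one] at h3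
    rw [div_le_div_iff₀ hposy hpos]
    calc _ ≤ C * (C' * μ.real (Metric.ball y √t)) := mul_le_mul_of_nonneg_left h3 hC.le
      _ = _ := by ring
  have h4 := norm_inner_le_of_bounded_on measurableSet_ball (hd.ne_top x r) hf (by positivity) hbd
  rw [← norm_heat_sq] at h4
  have h5 : ‖h‖ ^ 2 ≤ (√(C * C' / μ.real (Metric.ball x √t)) * √(μ.real (Metric.ball x r)) * ‖f‖) *
      ‖h‖ := h4.trans (le_of_eq (by ring))
  have h6 : √(C * C' / μ.real (Metric.ball x √t)) * √(μ.real (Metric.ball x r)) =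
      √(C * C') * √(μ.real (Metric.ball x r) / μ.real (Metric.ball x √t)) := by
    rw [← Real.sqrt_mul (by positivity), ← Real.sqrt_mul (by positivity)]
    congr 1
    ring
  rw [h6] at h5
  rcases (norm_nonneg h).eq_or_lt with h0 | h0
  · rw [← h0]; positivity
  · rw [sq] at h5
    exact le_of_mul_le_mul_right h5 h0

/-- Shrinking `ρ` to an admissible radius gives a bound uniform in the centre. On a bounded space
this radius is positive because there are two distinct points. -/
theorem LowerVolumeBound.exists_lower_bound [Nontrivial X] (hvol : LowerVolumeBound μ)
    (hd : Doubling μ d) {ρ : ℝ} (hρ : 0 < ρ) :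
    ∃ v : ℝ, 0 < v ∧ ∀ x : X, v ≤ μ.real (Metric.ball x ρ) := by
  obtain ⟨ν, c, κ, hν, hc, hκ, h⟩ := hvol
  obtain ⟨r, hr, hrρ, hrκ, hrd⟩ : ∃ r, 0 < r ∧ r ≤ ρ ∧ r ≤ κ ∧ BelowDiam X κ r := by
    by_cases hb : Bornology.IsBounded (univ : Set X)
    · have hD : 0 < Metric.diam (univ : Set X) := by
        obtain ⟨x, y, hxy⟩ := exists_pair_ne X
        exact (dist_pos.2 hxy).trans_le
          (Metric.dist_le_diam_of_mem hb (mem_univ _) (mem_univ _))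
      exact ⟨min ρ (min κ (κ * Metric.diam (univ : Set X))), by positivity, min_le_left _ _,
        (min_le_right _ _).trans (min_le_left _ _),
        fun _ => (min_le_right _ _).trans (min_le_right _ _)⟩
    · exact ⟨min ρ κ, by positivity, min_le_left _ _, min_le_right _ _, fun h => (hb h).elim⟩
  exact ⟨c * r ^ ν, by positivity, fun x =>
    (h x r hr hrκ hrd).trans (hd.mono (Metric.ball_subset_ball hrρ))⟩

/-- This is `L¹ → L²` smoothing, dual to `L² → L^∞`. The uniform lower bound on volumes is what
makes the kernel slices uniformly bounded in `L²`; `c` may blow up as `s → 0`. -/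
theorem DUE.exists_norm_heat_le_integral [Nontrivial X] (hDUE : DUE H) (hd : Doubling μ d)
    (hvol : LowerVolumeBound μ) [SFinite μ] {s : ℝ} (hs : 0 < s) :
    ∃ c : ℝ, 0 ≤ c ∧ ∀ a : Lp ℂ 2 μ, Integrable a μ → ‖heat H s a‖ ≤ c * ∫ x, ‖a x‖ ∂μ := by
  obtain ⟨C, hC, hrep⟩ := hDUE.exists_repr hd
  obtain ⟨v, hv, hvx⟩ := hvol.exists_lower_bound hd (Real.sqrt_pos.2 hs)
  refine ⟨√(C / v), by positivity, fun a ha => ?_⟩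
  obtain ⟨k, hk1, hk2⟩ := hrep s hs
  set h := heat H s a
  have hbd : ∀ᵐ y ∂μ, ‖heat H s h y‖ ≤ √(C / v) * ‖h‖ := by
    filter_upwards [hk1, hk2 h] with y h1 h2
    rw [h2]
    refine (norm_inner_le_norm _ _).trans (mul_le_mul_of_nonneg_right ?_ (norm_nonneg _))
    refine Real.le_sqrt_of_sq_le (h1.trans ?_)
    gcongr
    exact hvx y
  have h1 : ‖h‖ ^ 2 ≤ ∫ x, ‖a x‖ * (√(C / v) * ‖h‖) ∂μ := by
    rw [norm_heat_sq, L2.inner_def]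
    refine norm_integral_le_of_norm_le (ha.norm.mul_const _) ?_
    filter_upwards [hbd] with x hx
    exact (norm_inner_le_norm _ _).trans (mul_le_mul_of_nonneg_left hx (norm_nonneg _))
  rw [integral_mul_const] at h1
  rcases (norm_nonneg h).eq_or_lt with h0 | h0
  · rw [← h0]
    have : 0 ≤ ∫ x, ‖a x‖ ∂μ := integral_nonneg fun _ => norm_nonneg _
    positivity
  · rw [sq] at h1
    refine le_of_mul_le_mul_right (h1.trans (le_of_eq ?_)) h0
    ring

/-- Bessel's inequality gives `∑ |⟪k x, v_i⟫|² ≤ ‖k x‖²` at almost every `x`. This is bounded, and a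
bounded space has finite measure. -/
theorem DUE.exists_hilbertSchmidt [Nontrivial X] (hDUE : DUE H) (hd : Doubling μ d)
    (hvol : LowerVolumeBound μ) [SFinite μ] (hb : Bornology.IsBounded (univ : Set X))
    {t : ℝ} (ht : 0 < t) :
    ∃ C : ℝ, ∀ (n : ℕ) (v : Fin n → Lp ℂ 2 μ), Orthonormal ℂ v →
      ∑ i, ‖heat H t (v i)‖ ^ 2 ≤ C := by
  obtain ⟨C, hC, hrep⟩ := hDUE.exists_repr hd
  obtain ⟨w, hw, hwx⟩ := hvol.exists_lower_bound hd (Real.sqrt_pos.2 ht)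
  have hfin : μ univ ≠ ∞ := by
    obtain ⟨R, hR⟩ := hb.subset_ball (Classical.arbitrary X)
    rw [← univ_subset_iff.1 hR]
    exact hd.ne_top _ _
  refine ⟨C / w * μ.real univ, fun n v hv => ?_⟩
  obtain ⟨k, hk1, hk2⟩ := hrep t ht
  have hi : ∀ f : Lp ℂ 2 μ, Integrable (fun x => ‖f x‖ ^ 2) μ := fun f =>
    (Lp.memLp f).integrable_norm_pow (by norm_num)
  have h1 : ∀ f : Lp ℂ 2 μ, ‖f‖ ^ 2 = ∫ x, ‖f x‖ ^ 2 ∂μ := by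
    intro f
    rw [← setIntegral_univ, ← norm_sq_cut_eq_integral MeasurableSet.univ, SupportedIn.cut_eq]
    exact Eventually.of_forall fun x hx => (hx (mem_univ x)).elim
  simp_rw [h1]
  rw [← integral_finsetSum _ fun i _ => hi _]
  have h2 : ∀ᵐ x ∂μ, ∀ i, heat H t (v i) x = ⟪k x, v i⟫_ℂ := ae_all_iff.2 fun i => hk2 (v i)
  have hc : Integrable (fun _ : X => C / w) μ := by
    rw [integrable_const_iff]
    exact Or.inr ⟨hfin.lt_top⟩
  refine (integral_mono_ae (integrable_finsetSum _ fun i _ => hi _) hc ?_).trans (le_of_eq ?_)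
  · filter_upwards [hk1, h2] with x hx1 hx2
    simp_rw [hx2, norm_inner_symm (k x)]
    refine (hv.sum_inner_products_le (k x)).trans (hx1.trans ?_)
    gcongr
    exact hwx x
  · rw [integral_const, smul_eq_mul, mul_comm]

end HeatBounds

section Gap

variable {E : Type*} [NormedAddCommGroup E] [InnerProductSpace ℂ E] [CompleteSpace E]
  {H : E →ₗ.[ℂ] E}

/-! ### The spectral gap of an operator whose heat semigroup is Hilbert–Schmidt -/

/-- Tent functions of the resolvent, centred at the given spectral points and with disjoint
supports, are nonzero operators with mutually orthogonal ranges. On these supports `s > 1/3`, i.e.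
the energy `s⁻¹ - 1` is below `2`, so `e^{-H}` is at least `e^{-2}` there. -/
theorem exists_orthonormal_norm_heat_ge (hH : IsNonnegSelfAdjoint H) {n : ℕ} (p : Fin n → ℝ)
    (hp : Function.Injective p)
    (hs : ∀ i, p i ∈ spectrum ℝ (resolventOp H) ∧ p i ∈ Ioo (1 / 2 : ℝ) 1) :
    ∃ v : Fin n → E, Orthonormal ℂ v ∧ ∀ i, 1 ≤ Real.exp 2 * ‖heat H 1 (v i)‖ := by
  have hsa := hH.isSelfAdjoint_resolventOp
  -- The bound `η < 1/6` keeps every tent inside `s > 1/2 - 1/6 = 1/3`, and the separation `2η`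
  -- makes the tents disjoint.
  obtain ⟨η, hη0, hη6, hη⟩ : ∃ η : ℝ, 0 < η ∧ η < 1 / 6 ∧
      ∀ i j, i ≠ j → 2 * η ≤ |p i - p j| := by
    have h1 : ∀ᶠ η : ℝ in 𝓝[>] 0, ∀ i j, i ≠ j → 2 * η ≤ |p i - p j| := by
      refine eventually_all.2 fun i => eventually_all.2 fun j => ?_
      rcases eq_or_ne i j with hij | hij
      · exact Eventually.of_forall fun _ h => (h hij).elim
      · have hpos : 0 < |p i - p j| / 2 := by
          have := abs_pos.2 (sub_ne_zero.2 (hp.ne hij))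
          positivity
        filter_upwards [nhdsWithin_le_nhds (Iio_mem_nhds hpos)] with η h _
        have : η < |p i - p j| / 2 := h
        linarith
    have h2 : ∀ᶠ η : ℝ in 𝓝[>] 0, η < 1 / 6 :=
      nhdsWithin_le_nhds (Iio_mem_nhds (by norm_num))
    obtain ⟨η, h, h', h''⟩ := (h1.and (h2.and self_mem_nhdsWithin)).exists
    exact ⟨η, h'', h', h⟩
  let φ : Fin n → ℝ → ℝ := fun i s => max 0 (1 - |s - p i| / η)
  have hφc : ∀ i, Continuous (φ i) := fun i => by fun_prop
  have hφ0 : ∀ i s, η ≤ |s - p i| → φ i s = 0 := by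
    intro i s h
    have := (one_le_div hη0).2 h
    exact max_eq_left (by linarith)
  have hφp : ∀ i, φ i (p i) = 1 := by
    intro i
    simp [φ]
  have hw : ∀ i, ∃ w, cfc (φ i) (resolventOp H) w ≠ 0 := by
    intro i
    by_contra hcon
    push Not at hcon
    have h0 : cfc (φ i) (resolventOp H) = 0 := by
      ext w
      exact hcon w
    have := norm_apply_le_norm_cfc (φ i) (resolventOp H) (hs i).1 (hφc i).continuousOn hsa
    rw [h0, hφp] at this
    norm_num at this
  choose w hw using hw
  let u : Fin n → E := fun i => cfc (φ i) (resolventOp H) (w i)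
  have hu : ∀ i, ‖u i‖ ≠ 0 := fun i => norm_ne_zero_iff.2 (hw i)
  have horth : ∀ i j, i ≠ j → ⟪u i, u j⟫_ℂ = 0 := by
    intro i j hij
    have h1 : cfc (φ i) (resolventOp H) * cfc (φ j) (resolventOp H) = 0 := by
      rw [← cfc_mul _ _ _ (hφc i).continuousOn (hφc j).continuousOn]
      have : (fun s => φ i s * φ j s) = fun _ => 0 := by
        funext s
        rcases le_or_gt η |s - p i| with h | h
        · rw [hφ0 i s h, zero_mul]
        · rw [hφ0 j s, mul_zero]
          have h3 := hη i j hij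
          have h4 := abs_sub_le (p i) s (p j)
          rw [abs_sub_comm (p i) s] at h4
          linarith
      rw [this]
      exact cfc_const_zero ℝ _
    have h2 : ⟪u i, u j⟫_ℂ = ⟪w i, (cfc (φ i) (resolventOp H) * cfc (φ j) (resolventOp H)) (w j)⟫_ℂ :=
      (cfc_predicate (φ i) (resolventOp H) : IsSelfAdjoint _).isSymmetric _ _
    rw [h2, h1]
    simp
  -- `χ` inverts the symbol of `e^{-H}` on `s ≥ 1/3` and is truncated below so as to stay bounded by
  -- `e²`.
  let χ : ℝ → ℝ := fun s => Real.exp ((max s (1 / 3))⁻¹ - 1)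
  have hχc : Continuous χ := by
    have : ∀ s : ℝ, max s (1 / 3) ≠ 0 := fun s =>
      (lt_of_lt_of_le (by norm_num : (0 : ℝ) < 1 / 3) (le_max_right _ _)).ne'
    fun_prop (disch := exact this _)
  have hχ : ‖cfc χ (resolventOp H)‖ ≤ Real.exp 2 := by
    refine norm_cfc_le (Real.exp_pos _).le fun s _ => ?_
    rw [Real.norm_eq_abs, Real.abs_exp, Real.exp_le_exp]
    have : (max s (1 / 3))⁻¹ ≤ (1 / 3 : ℝ)⁻¹ := inv_anti₀ (by norm_num) (le_max_right _ _)
    norm_num at this ⊢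
    linarith
  have hheat : ∀ i, ‖u i‖ ≤ Real.exp 2 * ‖heat H 1 (u i)‖ := by
    intro i
    have hc := (vanishesAtTop_exp (t := 1) one_pos).continuousOn_spectrum hH
    have hc2 : ContinuousOn (fun s => onResolvent (fun x => Real.exp (-(1 * x))) s * φ i s)
        (spectrum ℝ (resolventOp H)) := hc.mul (hφc i).continuousOn
    have h1 : cfc χ (resolventOp H) * (heat H 1 * cfc (φ i) (resolventOp H)) =
        cfc (φ i) (resolventOp H) := by
      rw [heat, functionOf_eq, ← cfc_mul _ _ _ hc (hφc i).continuousOn,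
        ← cfc_mul _ _ _ hχc.continuousOn hc2]
      refine cfc_congr fun s hs' => ?_
      rcases le_or_gt η |s - p i| with h | h
      · rw [hφ0 i s h, mul_zero, mul_zero]
      · have h2 := (abs_lt.1 h).1
        have h3 := (hs i).2.1
        have h4 : 1 / 3 ≤ s := by linarith
        have h5 : 0 < s := by linarith
        rw [← mul_assoc, onResolvent, if_pos h5, one_mul]
        simp only [χ]
        rw [max_eq_left h4, ← Real.exp_add, add_neg_cancel, Real.exp_zero, one_mul]
    have h2 : u i = cfc χ (resolventOp H) (heat H 1 (u i)) := by
      conv_lhs => rw [show u i = cfc (φ i) (resolventOp H) (w i) from rfl, ← h1]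
      rfl
    conv_lhs => rw [h2]
    exact (ContinuousLinearMap.le_opNorm _ _).trans
      (mul_le_mul_of_nonneg_right hχ (norm_nonneg _))
  refine ⟨fun i => ((‖u i‖⁻¹ : ℝ) : ℂ) • u i, ⟨fun i => ?_, fun i j hij => ?_⟩, fun i => ?_⟩
  · rw [norm_smul, Complex.norm_real, norm_inv, norm_norm, inv_mul_cancel₀ (hu i)]
  · simp only [inner_smul_left, inner_smul_right, horth i j hij, mul_zero]
  · rw [map_smul, norm_smul, Complex.norm_real, norm_inv, norm_norm, mul_left_comm,
      ← div_eq_inv_mul, one_le_div (lt_of_le_of_ne (norm_nonneg _) (hu i).symm)]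
    exact hheat i

/-- The Hilbert–Schmidt bound allows only finitely many spectral points of the resolvent in `(1/2,
1)`. So the spectrum misses some interval `(1 - δ, 1)`, and the energies that occur are `0` and
those at least `δ`; functions agreeing there define the same operator. -/
theorem exists_functionOf_congr_of_hilbertSchmidt (hH : IsNonnegSelfAdjoint H)
    (hHS : ∃ C : ℝ, ∀ (n : ℕ) (v : Fin n → E), Orthonormal ℂ v → ∑ i, ‖heat H 1 (v i)‖ ^ 2 ≤ C) :
    ∃ b : ℝ, 0 < b ∧ ∀ g₁ g₂ : ℝ → ℝ, g₁ 0 = g₂ 0 → (∀ x, b ≤ x → g₁ x = g₂ x) →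
      functionOf H g₁ = functionOf H g₂ := by
  obtain ⟨C, hC⟩ := hHS
  have hfin : (spectrum ℝ (resolventOp H) ∩ Ioo (1 / 2 : ℝ) 1).Finite := by
    by_contra hinf
    obtain ⟨n, hn⟩ := exists_nat_gt (C * Real.exp 2 ^ 2)
    obtain ⟨t, ht, hcard⟩ := Set.Infinite.exists_subset_card_eq hinf n
    let e := t.equivFinOfCardEq hcard
    obtain ⟨v, hv, hge⟩ := exists_orthonormal_norm_heat_ge hH (fun i => (e.symm i : ℝ))
      (Subtype.val_injective.comp e.symm.injective) (fun i => ht (e.symm i).2)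
    have h1 : (n : ℝ) ≤ ∑ i, Real.exp 2 ^ 2 * ‖heat H 1 (v i)‖ ^ 2 := by
      calc (n : ℝ) = ∑ i : Fin n, (1 : ℝ) := by simp
        _ ≤ _ := Finset.sum_le_sum fun i _ => by
          rw [← mul_pow]
          exact one_le_pow₀ (hge i)
    rw [← Finset.mul_sum] at h1
    have h2 := mul_le_mul_of_nonneg_left (hC n v hv) (by positivity : 0 ≤ Real.exp 2 ^ 2)
    linarith
  obtain ⟨δ, hδ0, hδ1, hδ⟩ : ∃ δ : ℝ, 0 < δ ∧ δ < 1 / 2 ∧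
      ∀ s ∈ spectrum ℝ (resolventOp H) ∩ Ioo (1 / 2 : ℝ) 1, s ≤ 1 - δ := by
    have h1 : ∀ᶠ δ : ℝ in 𝓝[>] 0,
        ∀ s ∈ spectrum ℝ (resolventOp H) ∩ Ioo (1 / 2 : ℝ) 1, s ≤ 1 - δ := by
      refine (eventually_all_finite hfin).2 fun s hs => ?_
      have : 0 < 1 - s := by
        have := hs.2.2
        linarith
      filter_upwards [nhdsWithin_le_nhds (Iio_mem_nhds this)] with δ h
      have : δ < 1 - s := h
      linarith
    have h2 : ∀ᶠ δ : ℝ in 𝓝[>] 0, δ < 1 / 2 :=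
      nhdsWithin_le_nhds (Iio_mem_nhds (by norm_num))
    obtain ⟨δ, h, h', h''⟩ := (h1.and (h2.and self_mem_nhdsWithin)).exists
    exact ⟨δ, h'', h', h⟩
  refine ⟨δ, hδ0, fun g₁ g₂ h0 h => cfc_congr fun s hs => ?_⟩
  have hs' := hH.spectrum_subset hs
  by_cases hpos : 0 < s
  · simp only [hpos, if_true]
    rcases hs'.2.eq_or_lt with rfl | hlt
    · simpa using h0
    · have h1 : s ≤ 1 - δ := by
        rcases le_or_gt s (1 / 2) with h2 | h2
        · linarith
        · exact hδ s ⟨hs, h2, hlt⟩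
      refine h _ ?_
      have h2 : 1 + δ ≤ s⁻¹ := by
        rw [← one_div, le_div_iff₀ hpos]
        nlinarith
      linarith
  · simp [hpos]

end Gap

section Reproducing

/-! ### The functions in the reproducing formula -/

/-- The function `x ↦ ∫_x^∞ t^k e^{-ct} dt`. -/
def gammaTail : ℕ → ℝ → ℝ → ℝ
  | 0, c, x => Real.exp (-(c * x)) / c
  | k + 1, c, x => x ^ (k + 1) * Real.exp (-(c * x)) / c + (k + 1) / c * gammaTail k c x

theorem hasDerivAt_gammaTail (k : ℕ) {c : ℝ} (hc : c ≠ 0) (x : ℝ) :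
    HasDerivAt (gammaTail k c) (-(x ^ k * Real.exp (-(c * x)))) x := by
  have he : HasDerivAt (fun x => Real.exp (-(c * x))) (Real.exp (-(c * x)) * -c) x := by
    have := ((hasDerivAt_id x).const_mul c).neg.exp
    simpa using this
  induction k with
  | zero =>
    refine (he.div_const c).congr_deriv ?_
    field_simp
  | succ k ih =>
    refine ((((hasDerivAt_pow (k + 1) x).mul he).div_const c).add
      (ih.const_mul ((k + 1) / c))).congr_deriv ?_
    push_cast
    field_simp
    ring

theorem vanishesAtTop_pow_mul_gammaTail (k l : ℕ) {c : ℝ} (hc : 0 < c) :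
    VanishesAtTop fun x => x ^ l * gammaTail k c x := by
  induction k with
  | zero =>
    have := (vanishesAtTop_pow_mul_exp l hc).const_mul c⁻¹
    convert this using 2 with x
    rw [gammaTail]
    ring
  | succ k ih =>
    have := ((vanishesAtTop_pow_mul_exp (l + (k + 1)) hc).const_mul c⁻¹).add
      (ih.const_mul ((k + 1) / c))
    convert this using 2 with x
    rw [gammaTail]
    ring

theorem gammaTail_zero (k : ℕ) (c : ℝ) : gammaTail k c 0 = k.factorial * (c⁻¹) ^ (k + 1) := by
  induction k with
  | zero => simp [gammaTail]
  | succ k ih =>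
    rw [gammaTail, ih, Nat.factorial_succ]
    push_cast
    ring

/-- The function `x ↦ ∫_x^∞ ψ_{k+1}(t) (e^{-t} - e^{-2t})² dt/t`. -/
def reproTail (k : ℕ) (x : ℝ) : ℝ := gammaTail k 3 x - 2 * gammaTail k 4 x + gammaTail k 5 x

/-- The function `ψ_m(t) (e^{-t} - e^{-2t})²`. -/
def reproKernel (m : ℕ) (t : ℝ) : ℝ :=
  psi m t * (Real.exp (-t) - Real.exp (-(2 * t))) ^ 2

/-- The rates come from `e^{-t} (e^{-t} - e^{-2t})² = e^{-3t} - 2 e^{-4t} + e^{-5t}`. -/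
theorem hasDerivAt_reproTail (k : ℕ) {t : ℝ} (ht : 0 < t) :
    HasDerivAt (reproTail k) (-(reproKernel (k + 1) t / t)) t := by
  refine (((hasDerivAt_gammaTail k (by norm_num) t).sub
    ((hasDerivAt_gammaTail k (by norm_num) t).const_mul 2)).add
    (hasDerivAt_gammaTail k (by norm_num) t)).congr_deriv ?_
  have h3 : Real.exp (-(3 * t)) = Real.exp (-t) ^ 3 := by rw [← Real.exp_nat_mul]; ring_nf
  have h4 : Real.exp (-(4 * t)) = Real.exp (-t) ^ 4 := by rw [← Real.exp_nat_mul]; ring_nf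
  have h5 : Real.exp (-(5 * t)) = Real.exp (-t) ^ 5 := by rw [← Real.exp_nat_mul]; ring_nf
  have h2 : Real.exp (-(2 * t)) = Real.exp (-t) ^ 2 := by rw [← Real.exp_nat_mul]; ring_nf
  rw [reproKernel, psi, h2, h3, h4, h5]
  field_simp
  ring

theorem vanishesAtTop_pow_mul_reproTail (k l : ℕ) :
    VanishesAtTop fun x => x ^ l * reproTail k x := by
  have := ((vanishesAtTop_pow_mul_gammaTail k l (c := 3) (by norm_num)).sub
    ((vanishesAtTop_pow_mul_gammaTail k l (c := 4) (by norm_num)).const_mul 2)).add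
    (vanishesAtTop_pow_mul_gammaTail k l (c := 5) (by norm_num))
  convert this using 2 with x
  rw [reproTail]
  ring

theorem vanishesAtTop_reproTail (k : ℕ) : VanishesAtTop (reproTail k) := by
  simpa using vanishesAtTop_pow_mul_reproTail k 0

/-- This is the normalising constant of the reproducing formula, equal to `k! (3^{-n} - 2·4^{-n} +
5^{-n})` with `n = k + 1`. As `15 < 16`, `4^{-n}` is below the geometric mean of `3^{-n}` and
`5^{-n}`, hence below their arithmetic mean. -/
theorem reproTail_zero_pos (k : ℕ) : 0 < reproTail k 0 := by
  rw [reproTail, gammaTail_zero, gammaTail_zero, gammaTail_zero]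
  set n := k + 1
  have hlt : ((16 : ℝ)⁻¹) ^ n < (15⁻¹ : ℝ) ^ n :=
    pow_lt_pow_left₀ (by norm_num) (by positivity) (by omega)
  have h1 : ((16 : ℝ)⁻¹) ^ n = (4⁻¹ : ℝ) ^ n * (4⁻¹ : ℝ) ^ n := by rw [← mul_pow]; norm_num
  have h2 : ((15 : ℝ)⁻¹) ^ n = (3⁻¹ : ℝ) ^ n * (5⁻¹ : ℝ) ^ n := by rw [← mul_pow]; norm_num
  rw [h1, h2] at hlt
  have ha : (0 : ℝ) < (3⁻¹ : ℝ) ^ n := by positivity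
  have hb : (0 : ℝ) < (4⁻¹ : ℝ) ^ n := by positivity
  have hc : (0 : ℝ) < (5⁻¹ : ℝ) ^ n := by positivity
  have hf : (0 : ℝ) < k.factorial := by positivity
  set a := (3⁻¹ : ℝ) ^ n
  set b := (4⁻¹ : ℝ) ^ n
  set c := (5⁻¹ : ℝ) ^ n
  have : 0 < a - 2 * b + c := by
    by_contra hcon
    push Not at hcon
    nlinarith [sq_nonneg (a - c)]
  calc (0 : ℝ) < k.factorial * (a - 2 * b + c) := mul_pos hf this
    _ = _ := by ring

theorem vanishesAtTop_expDiff : VanishesAtTop fun t => Real.exp (-t) - Real.exp (-(2 * t)) := by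
  have := (vanishesAtTop_exp (t := 1) one_pos).sub (vanishesAtTop_exp (t := 2) two_pos)
  simpa using this

theorem vanishesAtTop_reproKernel (m : ℕ) : VanishesAtTop (reproKernel m) := by
  have h1 := vanishesAtTop_psi m one_pos
  simp only [one_mul] at h1
  have := h1.mul (vanishesAtTop_expDiff.mul vanishesAtTop_expDiff)
  convert this using 2 with x
  rw [reproKernel, sq]

theorem reproKernel_zero (m : ℕ) : reproKernel m 0 = 0 := by simp [reproKernel]

/-- The sum telescopes: `G` increases from `0` to `3` and satisfies `G(2y) - G(y) ≥ min(y, y⁻¹)`.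
The bound does not depend on `c`, so it holds whatever the ratio between the dyadic grid and the
radius or energy. -/
theorem sum_min_two_pow_le {c : ℝ} (hc : 0 < c) (n : ℕ) :
    ∑ i ∈ Finset.range n, min (2 ^ i * c) (2 ^ i * c)⁻¹ ≤ 3 := by
  let G : ℝ → ℝ := fun y => if y < 1 then y else 3 - 2 * y⁻¹
  have hG3 : ∀ y, G y ≤ 3 := by
    intro y
    simp only [G]
    split_ifs with h
    · linarith
    · have : 0 < y⁻¹ := inv_pos.2 (by linarith)
      linarith
  have hstep : ∀ y, 0 < y → min y y⁻¹ ≤ G (2 * y) - G y := by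
    intro y hy
    simp only [G]
    have hyy : y * y⁻¹ = 1 := mul_inv_cancel₀ hy.ne'
    have hi : 0 < y⁻¹ := inv_pos.2 hy
    rcases lt_or_ge (2 * y) 1 with h | h
    · rw [if_pos h, if_pos (by linarith)]
      exact (min_le_left _ _).trans (by linarith)
    · rw [if_neg (by linarith), mul_inv]
      rcases lt_or_ge y 1 with h' | h'
      · rw [if_pos h']
        refine (min_le_left _ _).trans ?_
        nlinarith
      · rw [if_neg (by linarith)]
        exact (min_le_right _ _).trans (by linarith)
  have key : ∑ i ∈ Finset.range n, min (2 ^ i * c) (2 ^ i * c)⁻¹ ≤ G (2 ^ n * c) - G c := by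
    induction n with
    | zero => simp
    | succ n ih =>
      rw [Finset.sum_range_succ]
      have := hstep (2 ^ n * c) (by positivity)
      rw [← mul_assoc, ← pow_succ'] at this
      linarith
  have hGc : 0 ≤ G c := by
    simp only [G]
    split_ifs with h
    · exact hc.le
    · have : c⁻¹ ≤ 1 := inv_le_one_of_one_le₀ (by linarith)
      linarith
  linarith [hG3 (2 ^ n * c)]

theorem sq_psi_one_le {y : ℝ} (hy : 0 < y) : psi 1 y ^ 2 ≤ min y y⁻¹ := by
  have h1 := Real.add_one_le_exp y
  have h3 : y ^ 2 / 2 ≤ Real.exp y := by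
    have := Real.pow_div_factorial_le_exp y hy.le 2
    simpa using this
  have hE : 0 < Real.exp (-y) := Real.exp_pos _
  have hee : Real.exp y * Real.exp (-y) = 1 := by rw [← Real.exp_add]; simp
  have ha : y * Real.exp (-y) ≤ 1 := by nlinarith
  have hb : y ^ 2 * Real.exp (-y) ≤ 2 := by nlinarith
  have hc : Real.exp (-y) ≤ 1 := by rw [Real.exp_le_one_iff]; linarith
  have ha2 : y * Real.exp (-y) ≤ 1 / 2 := by
    have h4 := Real.add_one_le_exp (y - 1)
    have h5 : Real.exp (y - 1) * Real.exp (-y) = Real.exp (-1) := by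
      rw [← Real.exp_add]; congr 1; ring
    have h6 : Real.exp (-1) ≤ 1 / 2 := by
      rw [Real.exp_neg, one_div]
      refine inv_anti₀ two_pos ?_
      have := Real.add_one_le_exp 1
      linarith
    nlinarith
  rw [psi, pow_one]
  refine le_min ?_ ?_
  · calc (y * Real.exp (-y)) ^ 2 = y * (Real.exp (-y) * (y * Real.exp (-y))) := by ring
      _ ≤ y * (1 * 1) := by gcongr
      _ = y := by ring
  · rw [← one_div, le_div_iff₀ hy]
    calc (y * Real.exp (-y)) ^ 2 * y = (y ^ 2 * Real.exp (-y)) * (y * Real.exp (-y)) := by ring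
      _ ≤ 2 * (1 / 2) := mul_le_mul hb ha2 (by positivity) (by norm_num)
      _ = 1 := by norm_num

variable {E : Type*} [NormedAddCommGroup E] [InnerProductSpace ℂ E] [CompleteSpace E]
  {H : E →ₗ.[ℂ] E}

/-- A discrete quadratic estimate: `ψ_1(y)²` is at most `min(y, y⁻¹)`, so at each energy the dyadic
sum is at most `3`. -/
theorem sum_norm_sq_psiOp_le (hH : IsNonnegSelfAdjoint H) {b : ℝ} (hb : 0 < b) (n : ℕ) (f : E) :
    ∑ i ∈ Finset.range n, ‖psiOp H 1 (2 ^ i * b) f‖ ^ 2 ≤ 3 * ‖f‖ ^ 2 := by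
  refine sum_norm_sq_functionOf_le hH _ (fun i => vanishesAtTop_psi 1 (by positivity))
    (by norm_num) (fun x hx => ?_) f
  rcases hx.eq_or_lt with rfl | hx
  · simp [psi]
  · refine (Finset.sum_le_sum fun i _ => sq_psi_one_le (by positivity)).trans ?_
    simp_rw [mul_assoc]
    exact sum_min_two_pow_le (by positivity) n

/-- The operator `e^{-uH} - e^{-2uH}`. -/
def heatDiff (H : E →ₗ.[ℂ] E) (u : ℝ) : E →L[ℂ] E := heat H u - heat H (2 * u)

theorem heatDiff_eq (hH : IsNonnegSelfAdjoint H) {u : ℝ} (hu : 0 < u) :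
    heatDiff H u = functionOf H fun x => Real.exp (-(u * x)) - Real.exp (-(2 * (u * x))) := by
  rw [heatDiff, heat, heat,
    ← functionOf_sub hH (vanishesAtTop_exp hu) (vanishesAtTop_exp (by positivity))]
  simp only [mul_assoc]

/-- One operator at the dyadic scale `v` dominates the differences for all `u ∈ [v, 2v]`, via
`e^{-ux}(1 - e^{-ux}) ≤ 2 vx e^{-vx}`. The integral in `u` thereby reduces to a dyadic sum. -/
theorem norm_heatDiff_le_psiOp (hH : IsNonnegSelfAdjoint H) {u v : ℝ} (hv : 0 < v) (hvu : v ≤ u)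
    (huv : u ≤ 2 * v) (f : E) : ‖heatDiff H u f‖ ≤ 2 * ‖psiOp H 1 v f‖ := by
  have hu : 0 < u := hv.trans_le hvu
  have h1 := (vanishesAtTop_psi 1 hv).const_mul 2
  have h2 : ‖functionOf H (fun x => 2 * psi 1 (v * x)) f‖ = 2 * ‖psiOp H 1 v f‖ := by
    rw [functionOf_const_mul hH (vanishesAtTop_psi 1 hv), smul_apply, norm_smul]
    simp [psiOp]
  rw [← h2, heatDiff_eq hH hu]
  refine norm_functionOf_mono hH (vanishesAtTop_expDiff.comp_mul hu) h1 (fun x hx => ?_) f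
  have hux : 0 ≤ u * x := by positivity
  have hvx : 0 ≤ v * x := by positivity
  have h3 : Real.exp (-(2 * (u * x))) = Real.exp (-(u * x)) * Real.exp (-(u * x)) := by
    rw [← Real.exp_add]; congr 1; ring
  have h4 : Real.exp (-(u * x)) ≤ Real.exp (-(v * x)) := by
    rw [Real.exp_le_exp]; nlinarith
  have h5 : 1 - u * x ≤ Real.exp (-(u * x)) := by
    have := Real.add_one_le_exp (-(u * x))
    linarith
  have h6 : Real.exp (-(u * x)) ≤ 1 := by rw [Real.exp_le_one_iff]; linarith
  have h7 : 0 < Real.exp (-(u * x)) := Real.exp_pos _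
  rw [h3, abs_of_nonneg (by nlinarith), psi, pow_one, abs_of_nonneg (by positivity)]
  have h8 : u * x ≤ 2 * (v * x) := by nlinarith
  calc _ = Real.exp (-(u * x)) * (1 - Real.exp (-(u * x))) := by ring
    _ ≤ Real.exp (-(v * x)) * (2 * (v * x)) :=
      mul_le_mul h4 (by linarith) (by linarith) (Real.exp_pos _).le
    _ = _ := by ring

theorem norm_heat_sub_heat_add_le (hH : IsNonnegSelfAdjoint H) {s t : ℝ} (hs : 0 < s) (ht : 0 < t)
    (f : E) : ‖heat H t f - heat H (t + s) f‖ ≤ s / t * ‖f‖ := by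
  have h1 : heat H t f - heat H (t + s) f =
      functionOf H (fun x => Real.exp (-(t * x)) - Real.exp (-((t + s) * x))) f := by
    rw [functionOf_sub hH (vanishesAtTop_exp ht) (vanishesAtTop_exp (by positivity)), sub_apply]
    rfl
  rw [h1]
  refine norm_functionOf_apply_le hH (by positivity) (fun x hx => ?_) f
  have h3 : Real.exp (-((t + s) * x)) = Real.exp (-(t * x)) * Real.exp (-(s * x)) := by
    rw [← Real.exp_add]; congr 1; ring
  have h5 : 1 - s * x ≤ Real.exp (-(s * x)) := by
    have := Real.add_one_le_exp (-(s * x))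
    linarith
  have hsx : 0 ≤ s * x := by positivity
  have h6 : Real.exp (-(s * x)) ≤ 1 := by rw [Real.exp_le_one_iff]; linarith
  have h7 : 0 < Real.exp (-(t * x)) := Real.exp_pos _
  have h8 : t * x * Real.exp (-(t * x)) ≤ 1 := by
    have := Real.add_one_le_exp (t * x)
    have hee : Real.exp (t * x) * Real.exp (-(t * x)) = 1 := by rw [← Real.exp_add]; simp
    nlinarith
  rw [h3, abs_of_nonneg (by nlinarith)]
  calc _ = Real.exp (-(t * x)) * (1 - Real.exp (-(s * x))) := by ring
    _ ≤ Real.exp (-(t * x)) * (s * x) := by gcongr; linarith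
    _ = s / t * (t * x * Real.exp (-(t * x))) := by field_simp
    _ ≤ s / t * 1 := by gcongr
    _ = s / t := mul_one _

end Reproducing

section ShellBounds

variable {X : Type*} [MetricSpace X] [MeasurableSpace X] [BorelSpace X] {μ : Measure X} {d : ℝ}
  {H : Lp ℂ 2 μ →ₗ.[ℂ] Lp ℂ 2 μ}

/-! ### Decay of heat differences of atoms -/

/-- The ratio of decay of `ShellDecay`. -/
abbrev decayRate (d : ℝ) : ℝ := (2 : ℝ) ^ (-(d / 2 + 1))

theorem decayRate_pos (d : ℝ) : 0 < decayRate d := by positivity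

theorem decayRate_le_one (hd : 0 < d) : decayRate d ≤ 1 :=
  Real.rpow_le_one_of_one_le_of_nonpos (by norm_num) (by linarith)

/-- Of the `N + 1` powers of `t/ρ²`, one is kept and the others are bounded through `t ≤ B ρ²`. The
factor `4^{-j(N+1)}` is faster than `K` copies of the shell decay; the spare copies will be traded
for powers of `u/r²` or `r²/u`. -/
theorem DaviesGaffney.exists_decay (hDG : DaviesGaffney H) (hH : IsNonnegSelfAdjoint H)
    (d : ℝ) (K : ℕ) (B : ℝ) : ∃ C : ℝ, 0 < C ∧ ∀ (x : X) (r ρ t : ℝ) (j : ℕ) (f : Lp ℂ 2 μ),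
      0 < r → r ≤ ρ → 0 < t → t ≤ B * ρ ^ 2 → 1 ≤ j → SupportedIn f (Metric.ball x r) →
      ‖cut (measurableSet_shell x ρ j) (heat H t f)‖ ≤
        C * (t / ρ ^ 2) * (decayRate d ^ j) ^ K * ‖f‖ := by
  obtain ⟨N, hN⟩ := exists_nat_ge ((d / 2 + 1) * K)
  obtain ⟨C, hC, h⟩ := hDG.exists_shell_bound hH (N + 1)
  refine ⟨C * (|B| + 1) ^ N, by positivity, fun x r ρ t j f hr hρ ht htB hj hf => ?_⟩
  have hρ0 : 0 < ρ := hr.trans_le hρ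
  refine (h x r ρ t j f hr hρ ht hj hf).trans (mul_le_mul_of_nonneg_right ?_ (norm_nonneg _))
  have h1 : t / ρ ^ 2 ≤ |B| + 1 := by
    rw [div_le_iff₀ (by positivity)]
    refine htB.trans (mul_le_mul_of_nonneg_right ?_ (by positivity))
    linarith [le_abs_self B]
  have h2 : ((4 : ℝ)⁻¹) ^ (N + 1) ≤ decayRate d ^ K := by
    rw [decayRate, ← Real.rpow_natCast, ← Real.rpow_natCast, ← Real.rpow_mul two_pos.le,
      show ((4 : ℝ)⁻¹) = 2 ^ (-2 : ℝ) by
        rw [Real.rpow_neg two_pos.le]; norm_num, ← Real.rpow_mul two_pos.le]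
    refine Real.rpow_le_rpow_of_exponent_le (by norm_num) ?_
    have : (0 : ℝ) ≤ N := Nat.cast_nonneg _
    push_cast
    linarith
  have h3 : (t / (4 ^ j * ρ ^ 2)) ^ (N + 1) =
      (t / ρ ^ 2) ^ N * (t / ρ ^ 2) * (((4 : ℝ)⁻¹) ^ (N + 1)) ^ j := by
    rw [← pow_succ, ← pow_mul, mul_comm (N + 1) j, pow_mul, ← mul_pow]
    congr 1
    rw [inv_pow]
    field_simp
  rw [h3, show (decayRate d ^ j) ^ K = (decayRate d ^ K) ^ j by rw [← pow_mul, mul_comm, pow_mul]]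
  calc C * ((t / ρ ^ 2) ^ N * (t / ρ ^ 2) * (((4 : ℝ)⁻¹) ^ (N + 1)) ^ j)
      ≤ C * ((|B| + 1) ^ N * (t / ρ ^ 2) * (decayRate d ^ K) ^ j) := by gcongr
    _ = _ := by ring

theorem heatDiff_ballOp_eq_sum (hH : IsNonnegSelfAdjoint H) (M : ℕ) {r u : ℝ} (hr : 0 < r)
    (hu : 0 < u) (f : Lp ℂ 2 μ) :
    heatDiff H u (ballOp H M r f) = ∑ i ∈ Finset.range (M + 1),
      ((-1) ^ i * (M.choose i : ℂ)) • (heat H (u + i * r ^ 2) f - heat H (2 * u + i * r ^ 2) f) := by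
  rw [ballOp_eq_sum, sum_apply, map_sum]
  refine Finset.sum_congr rfl fun i _ => ?_
  rw [smul_apply, map_smul, heatDiff, sub_apply, ← heat_mul_heat_pow hH hu (by positivity),
    ← heat_mul_heat_pow hH (by positivity) (by positivity)]
  rfl

theorem norm_coeff_le (M i : ℕ) : ‖((-1) ^ i * (M.choose i : ℂ))‖ ≤ 2 ^ M := by
  rw [norm_mul, norm_pow, norm_neg, norm_one, one_pow, one_mul, Complex.norm_natCast]
  exact_mod_cast Nat.choose_le_two_pow M i

theorem commute_heatDiff_ballOp (H : Lp ℂ 2 μ →ₗ.[ℂ] Lp ℂ 2 μ) (u : ℝ) (M : ℕ) (r : ℝ) :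
    Commute (heatDiff H u) (ballOp H M r) :=
  (commute_functionOf_ballOp H _ M r).sub_left (commute_functionOf_ballOp H _ M r)

/-- An `L²` bound `z² v` and a fast decay on shells give the bound `z v` and some decay. -/
theorem le_of_le_of_le_pow {w z v c y : ℝ} {K : ℕ} (hw : 0 < w) (hz : 0 ≤ z) (hv : 0 ≤ v)
    (hc : 0 ≤ c) (hzw : z ^ K ≤ c * (z * v)) (h1 : y ≤ z * z * v) (h2 : y ≤ w ^ (K + 1)) :
    y ≤ (1 + c) * (z * w * v) := by
  have h0 : 0 ≤ z * w * v := by positivity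
  -- If `z ≤ w` the `L²` bound suffices. Otherwise all but one factor `w` can be replaced by `z`,
  -- and `z^K ≤ c z v`.
  rcases le_or_gt z w with h | h
  · calc y ≤ z * z * v := h1
      _ ≤ z * w * v := by gcongr
      _ ≤ _ := by nlinarith
  · calc y ≤ w ^ K * w := by rw [← pow_succ]; exact h2
      _ ≤ z ^ K * w := by gcongr
      _ ≤ c * (z * v) * w := by gcongr
      _ ≤ _ := by nlinarith

/-- The decay of `(e^{-uH} - e^{-2uH}) B_Q f` for `u ≤ r²`. -/
theorem DaviesGaffney.exists_shellDecay_of_le (hDG : DaviesGaffney H) (hH : IsNonnegSelfAdjoint H)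
    (hd : 0 < d) (M : ℕ) : ∃ C : ℝ, 0 < C ∧ ∀ (x : X) (r u : ℝ) (f : Lp ℂ 2 μ),
      0 < r → 0 < u → u ≤ r ^ 2 → SupportedIn f (Metric.ball x r) →
      ShellDecay d x r (‖heatDiff H u f‖ + C * √(u / r ^ 2) * ‖f‖)
        (heatDiff H u (ballOp H M r f)) := by
  obtain ⟨C, hC, h⟩ := hDG.exists_decay hH d 2 (M + 2)
  set C' := 4 * C * (M + 2) + 1 with hC'
  have hC'0 : 0 < C' := by positivity
  refine ⟨(M + 1) * (2 ^ M * (C' * 2)), by positivity, fun x r u f hr hu hur hf j => ?_⟩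
  have hcomm : heatDiff H u (ballOp H M r f) = ballOp H M r (heatDiff H u f) :=
    DFunLike.congr_fun (commute_heatDiff_ballOp H u M r).eq f
  have hw := decayRate_pos d
  have hw1 := decayRate_le_one hd
  -- No decay is required on the central ball, and contractivity of `B_Q` leaves `‖D_u f‖`. This
  -- norm has no power of `u/r²` to spare; it is summed later by the quadratic estimate.
  rcases Nat.eq_zero_or_pos j with rfl | hj
  · rw [pow_zero, mul_one]
    refine (norm_cut_le _ _).trans ?_
    rw [hcomm]
    refine (norm_ballOp_apply_le hH M hr _).trans (le_add_of_nonneg_right (by positivity))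
  set q := u / r ^ 2 with hq
  have hq0 : 0 < q := by positivity
  have hq1 : q ≤ 1 := (div_le_one (by positivity)).2 hur
  set W := decayRate d ^ j with hW
  have hW0 : 0 < W := by positivity
  have hW1 : W ≤ 1 := pow_le_one₀ hw.le hw1
  have hterm : ∀ i ∈ Finset.range (M + 1), ‖cut (measurableSet_shell x r j)
      (heat H (u + i * r ^ 2) f - heat H (2 * u + i * r ^ 2) f)‖ ≤ C' * 2 * √q * W * ‖f‖ := by
    intro i hi
    have hiM : (i : ℝ) ≤ M := by exact_mod_cast Nat.lt_succ_iff.1 (Finset.mem_range.1 hi)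
    have hi0 : (0 : ℝ) ≤ i := Nat.cast_nonneg _
    have hr2 : 0 < r ^ 2 := by positivity
    have hbase : ‖cut (measurableSet_shell x r j)
        (heat H (u + i * r ^ 2) f - heat H (2 * u + i * r ^ 2) f)‖ ≤
        2 * (C * ((2 * u + i * r ^ 2) / r ^ 2) * W ^ 2 * ‖f‖) := by
      rw [map_sub]
      refine (norm_sub_le _ _).trans ?_
      have e1 := h x r r (u + i * r ^ 2) j f hr le_rfl (by positivity) (by nlinarith) hj hf
      have e2 := h x r r (2 * u + i * r ^ 2) j f hr le_rfl (by positivity) (by nlinarith) hj hf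
      have e3 : C * ((u + i * r ^ 2) / r ^ 2) * W ^ 2 * ‖f‖ ≤
          C * ((2 * u + i * r ^ 2) / r ^ 2) * W ^ 2 * ‖f‖ := by
        gcongr
        linarith
      linarith
    have hsq : √q * √q = q := Real.mul_self_sqrt hq0.le
    have hsq1 : √q ≤ 1 := Real.sqrt_le_one.2 hq1
    -- For `i = 0` the heat times are at most `2u`, so the off-diagonal bound itself supplies `q =
    -- u/r²`.
    rcases Nat.eq_zero_or_pos i with rfl | hi1
    · refine hbase.trans ?_
      have e4 : (2 * u + ((0 : ℕ) : ℝ) * r ^ 2) / r ^ 2 = 2 * q := by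
        rw [hq]; push_cast; ring
      rw [e4]
      have e5 : q * W ^ 2 ≤ √q * W := by
        calc q * W ^ 2 = √q * √q * W ^ 2 := by rw [hsq]
          _ = √q * W * (√q * W) := by ring
          _ ≤ √q * W * (1 * 1) := by gcongr
          _ = √q * W := by ring
      calc 2 * (C * (2 * q) * W ^ 2 * ‖f‖) = 4 * C * (q * W ^ 2) * ‖f‖ := by ring
        _ ≤ 4 * C * (√q * W) * ‖f‖ := by gcongr
        _ ≤ C' * 2 * (√q * W) * ‖f‖ := by
            have : 4 * C ≤ C' * 2 := by
              rw [hC']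
              have : (0 : ℝ) ≤ C * M := by positivity
              linarith
            gcongr
        _ = _ := by ring
    -- For `i ≥ 1` the heat times are of order `r²` and the decay contains no `q`. The gain `q`
    -- comes from the difference of two heat operators in `L²` norm, and the two estimates are
    -- interpolated.
    · have hi1' : (1 : ℝ) ≤ i := by exact_mod_cast hi1
      rcases (norm_nonneg f).eq_or_lt with hf0 | hf0
      · have : f = 0 := norm_eq_zero.1 hf0.symm
        simp [this]
      have hl2 : ‖cut (measurableSet_shell x r j)
          (heat H (u + i * r ^ 2) f - heat H (2 * u + i * r ^ 2) f)‖ ≤ q * ‖f‖ := by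
        refine (norm_cut_le _ _).trans ?_
        have e6 := norm_heat_sub_heat_add_le hH hu (t := u + i * r ^ 2) (by positivity) f
        rw [show u + i * r ^ 2 + u = 2 * u + i * r ^ 2 by ring] at e6
        refine e6.trans (mul_le_mul_of_nonneg_right ?_ hf0.le)
        rw [hq]
        exact div_le_div_of_nonneg_left hu.le hr2 (by nlinarith)
      have hdec : ‖cut (measurableSet_shell x r j)
          (heat H (u + i * r ^ 2) f - heat H (2 * u + i * r ^ 2) f)‖ ≤ C' * W ^ 2 * ‖f‖ := by
        refine hbase.trans ?_
        have e7 : (2 * u + i * r ^ 2) / r ^ 2 ≤ M + 2 := by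
          rw [div_le_iff₀ hr2]
          nlinarith
        calc _ ≤ 2 * (C * (M + 2) * W ^ 2 * ‖f‖) := by gcongr
          _ ≤ _ := by
            have : 2 * (C * (M + 2)) ≤ C' := by
              rw [hC']
              have : (0 : ℝ) ≤ C * M := by positivity
              linarith
            calc _ = 2 * (C * (M + 2)) * W ^ 2 * ‖f‖ := by ring
              _ ≤ _ := by gcongr
      have hC'1 : 1 ≤ C' := by
        rw [hC']
        have : (0 : ℝ) ≤ C * M := by positivity
        linarith
      have e8 := le_of_le_of_le_pow (K := 1) (c := 1) (v := 1) (z := √q)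
          (y := ‖cut (measurableSet_shell x r j)
          (heat H (u + i * r ^ 2) f - heat H (2 * u + i * r ^ 2) f)‖ / (C' * ‖f‖)) hW0
          (Real.sqrt_nonneg q) zero_le_one zero_le_one (by simp) (by
            rw [div_le_iff₀ (by positivity), hsq]
            refine hl2.trans ?_
            have : q * ‖f‖ ≤ C' * (q * ‖f‖) := le_mul_of_one_le_left (by positivity) hC'1
            linarith) (by
            rw [div_le_iff₀ (by positivity)]
            exact hdec.trans (le_of_eq (by ring)))
      rw [div_le_iff₀ (by positivity)] at e8
      exact e8.trans (le_of_eq (by ring))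
  rw [heatDiff_ballOp_eq_sum hH M hr hu, map_sum]
  refine (norm_sum_le _ _).trans ?_
  refine (Finset.sum_le_sum fun i hi => ?_ :
    _ ≤ ∑ i ∈ Finset.range (M + 1), 2 ^ M * (C' * 2 * √q * W * ‖f‖)).trans ?_
  · rw [map_smul, norm_smul]
    exact mul_le_mul (norm_coeff_le M i) (hterm i hi) (norm_nonneg _) (by positivity)
  · rw [Finset.sum_const, Finset.card_range, nsmul_eq_mul]
    have : 0 ≤ ‖heatDiff H u f‖ * W := by positivity
    push_cast
    nlinarith

set_option maxHeartbeats 800000 in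
/-- The decay of `(e^{-uH} - e^{-2uH}) B_Q f` for `r² ≤ u`. -/
theorem exists_shellDecay_of_ge [SFinite μ] (hdb : Doubling μ d) (hDG : DaviesGaffney H)
    (hDUE : DUE H) (hH : IsNonnegSelfAdjoint H) (hd : 0 < d) {M : ℕ} (hM : 1 ≤ M) :
    ∃ C : ℝ, 0 < C ∧ ∀ (x : X) (r u : ℝ) (f : Lp ℂ 2 μ),
      0 < r → 0 < u → r ^ 2 ≤ u → SupportedIn f (Metric.ball x r) →
      ShellDecay d x √u (C * √(r ^ 2 / u) *
        √(μ.real (Metric.ball x r) / μ.real (Metric.ball x √u)) * ‖f‖)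
        (heatDiff H u (ballOp H M r f)) := by
  -- Besides the decay wanted, `n + 1` copies are to be exchanged for `√q` and for the volume ratio
  -- `v`, which is bounded below by a multiple of `√q^n` as `n ≥ d`.
  obtain ⟨n, hn⟩ := exists_nat_ge d
  obtain ⟨C₀, hC₀, h⟩ := hDG.exists_decay hH d (n + 2) (M + 2)
  obtain ⟨C₁, hC₁, hsm⟩ := hDUE.exists_smoothing hdb
  obtain ⟨C₂, hC₂, hV⟩ := hdb.exists_const
  have hC₂0 : 0 < C₂ := by linarith
  set a₁ := (M + 1) * (2 ^ M * (2 * (C₀ * (M + 2)))) with ha₁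
  set a₂ := 2 * (C₁ * √(C₂ * 2 ^ d)) with ha₂
  have ha₁0 : 0 < a₁ := by positivity
  have ha₂0 : 0 < a₂ := by positivity
  refine ⟨(a₁ + a₂) * (1 + √C₂), by positivity, fun x r u f hr hu hru hf j => ?_⟩
  have hw := decayRate_pos d
  have hw1 := decayRate_le_one hd
  have hsu : 0 < √u := Real.sqrt_pos.2 hu
  have hsu2 : √u ^ 2 = u := Real.sq_sqrt hu.le
  have hrsu : r ≤ √u := Real.le_sqrt_of_sq_le hru
  set q := r ^ 2 / u with hq
  have hq0 : 0 < q := by positivity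
  have hq1 : q ≤ 1 := (div_le_one hu).2 hru
  have hsq : √q * √q = q := Real.mul_self_sqrt hq0.le
  have hsq1 : √q ≤ 1 := Real.sqrt_le_one.2 hq1
  have hsq0 : 0 < √q := Real.sqrt_pos.2 hq0
  have hVr := hdb.pos x hr
  have hVu := hdb.pos x hsu
  set v := √(μ.real (Metric.ball x r) / μ.real (Metric.ball x √u)) with hv
  have hv0 : 0 < v := by positivity
  set W := decayRate d ^ j with hW
  have hW0 : 0 < W := by positivity
  have hW1 : W ≤ 1 := pow_le_one₀ hw.le hw1
  rcases (norm_nonneg f).eq_or_lt with hf0 | hf0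
  · have : f = 0 := norm_eq_zero.1 hf0.symm
    simp [this]
  -- One factor of `B_Q` applied with `e^{-3uH/4}` gives `r²/u` up to a constant, the remaining
  -- `e^{-uH/4}` smooths `f` and gives `v`, and all other factors are contractions.
  have hl2 : ‖heatDiff H u (ballOp H M r f)‖ ≤ a₂ * (q * v) * ‖f‖ := by
    obtain ⟨M, rfl⟩ : ∃ M', M = M' + 1 := ⟨M - 1, by omega⟩
    set g := heat H (u / 4) f with hg
    have e0 : heat H u = heat H (3 * u / 4) * heat H (u / 4) := by
      rw [← heat_add hH (by positivity) (by positivity)]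
      congr 1
      ring
    have e1 : heatDiff H u (ballOp H (M + 1) r f) =
        (1 - heat H u) (ballOp H M r (heat H (3 * u / 4) g - heat H (3 * u / 4 + r ^ 2) g)) := by
      have c1 : heatDiff H u = (1 - heat H u) * heat H u := by
        rw [heatDiff, two_mul, heat_add hH hu hu, sub_mul, one_mul]
      have c2 : ballOp H (M + 1) r = ballOp H M r * (1 - heat H (r ^ 2)) := pow_succ _ _
      have c3 : Commute (heat H u) (ballOp H M r) := commute_functionOf_ballOp H _ M r
      have c4 : Commute (heat H u) (1 - heat H (r ^ 2)) :=
        (Commute.one_right _).sub_right (commute_functionOf H _ _)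
      have c5 : (1 - heat H (r ^ 2)) * heat H (3 * u / 4) =
          heat H (3 * u / 4) - heat H (3 * u / 4 + r ^ 2) := by
        rw [sub_mul, one_mul, ← heat_add hH (by positivity) (by positivity), add_comm]
      have c6 : heatDiff H u * ballOp H (M + 1) r = (1 - heat H u) *
          (ballOp H M r * ((heat H (3 * u / 4) - heat H (3 * u / 4 + r ^ 2)) * heat H (u / 4))) := by
        rw [c1, c2, mul_assoc, ← mul_assoc (heat H u), c3.eq, mul_assoc, c4.eq, e0, ← c5]
        simp only [mul_assoc]
      exact DFunLike.congr_fun c6 f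
    have e2 : ‖g‖ ≤ C₁ * √(C₂ * 2 ^ d) * v * ‖f‖ := by
      have hs4 : √(u / 4) = √u / 2 := by
        rw [Real.sqrt_div hu.le, show (4 : ℝ) = 2 ^ 2 by norm_num, Real.sqrt_sq two_pos.le]
      have h1 := hsm x r (u / 4) f hr (by positivity) (by rw [hs4]; linarith) hf
      rw [hs4] at h1
      refine h1.trans (mul_le_mul_of_nonneg_right ?_ (norm_nonneg _))
      rw [mul_assoc]
      refine mul_le_mul_of_nonneg_left ?_ hC₁.le
      rw [hv, ← Real.sqrt_mul (by positivity)]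
      refine Real.sqrt_le_sqrt ?_
      have h2 := hV x x (√u / 2) √u (by positivity) (by linarith) (by rw [dist_self]; positivity)
      rw [show √u / (√u / 2) = 2 by field_simp] at h2
      have h3 := hdb.pos x (half_pos hsu)
      rw [mul_div_assoc', div_le_div_iff₀ h3 hVu]
      calc _ ≤ μ.real (Metric.ball x r) * (C₂ * 2 ^ d * μ.real (Metric.ball x (√u / 2))) := by
            gcongr
        _ = _ := by ring
    rw [e1]
    refine (norm_sub_heat_apply_le hH hu _).trans ((norm_ballOp_apply_le hH M hr _).trans ?_)
    refine (norm_heat_sub_heat_add_le hH (by positivity) (by positivity) g).trans ?_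
    calc r ^ 2 / (3 * u / 4) * ‖g‖ = 4 / 3 * q * ‖g‖ := by rw [hq]; field_simp
      _ ≤ 2 * q * (C₁ * √(C₂ * 2 ^ d) * v * ‖f‖) := by
          gcongr
          norm_num
      _ = _ := by rw [ha₂]; ring
  rcases Nat.eq_zero_or_pos j with rfl | hj
  · rw [show W = 1 from pow_zero _, mul_one]
    refine (norm_cut_le _ _).trans (hl2.trans ?_)
    have h1 : q * v ≤ √q * v := by
      refine mul_le_mul_of_nonneg_right ?_ hv0.le
      nlinarith
    have h2 : a₂ ≤ (a₁ + a₂) * (1 + √C₂) := by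
      have : 0 ≤ √C₂ := Real.sqrt_nonneg _
      nlinarith
    calc a₂ * (q * v) * ‖f‖ ≤ (a₁ + a₂) * (1 + √C₂) * (√q * v) * ‖f‖ := by gcongr
      _ = _ := by ring
  have hdec : ‖cut (measurableSet_shell x √u j) (heatDiff H u (ballOp H M r f))‖ ≤
      a₁ * W ^ (n + 2) * ‖f‖ := by
    rw [heatDiff_ballOp_eq_sum hH M hr hu, map_sum]
    refine (norm_sum_le _ _).trans ?_
    refine (Finset.sum_le_sum fun i hi => ?_ : _ ≤ ∑ i ∈ Finset.range (M + 1),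
      2 ^ M * (2 * (C₀ * (M + 2) * W ^ (n + 2) * ‖f‖))).trans (le_of_eq ?_)
    · have hiM : (i : ℝ) ≤ M := by exact_mod_cast Nat.lt_succ_iff.1 (Finset.mem_range.1 hi)
      have hi0 : (0 : ℝ) ≤ i := Nat.cast_nonneg _
      rw [map_smul, norm_smul]
      refine mul_le_mul (norm_coeff_le M i) ?_ (norm_nonneg _) (by positivity)
      have hone : ∀ t, 0 < t → t ≤ (M + 2) * u → ‖cut (measurableSet_shell x √u j) (heat H t f)‖ ≤
          C₀ * (M + 2) * W ^ (n + 2) * ‖f‖ := by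
        intro t ht htu
        refine (h x r √u t j f hr hrsu ht (by rwa [hsu2]) hj hf).trans ?_
        rw [hsu2]
        have : t / u ≤ M + 2 := by rwa [div_le_iff₀ hu]
        gcongr
      have hir : i * r ^ 2 ≤ M * u := mul_le_mul hiM hru (by positivity) (by positivity)
      have b1 := hone (u + i * r ^ 2) (by positivity) (by nlinarith)
      have b2 := hone (2 * u + i * r ^ 2) (by positivity) (by nlinarith)
      rw [map_sub]
      refine (norm_sub_le _ _).trans ?_
      linarith
    · rw [Finset.sum_const, Finset.card_range, nsmul_eq_mul, ha₁]
      push_cast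
      ring
  -- Doubling gives `v² ≥ C₂⁻¹ (r/√u)^d`, and `r/√u = √q ≤ 1`.
  have hz : √q ^ (n + 1) ≤ √C₂ * (√q * v) := by
    rw [pow_succ']
    have h1 : √q ^ n ≤ √C₂ * v := by
      refine le_of_sq_le_sq ?_ (by positivity)
      rw [mul_pow, Real.sq_sqrt hC₂0.le, hv, Real.sq_sqrt (by positivity)]
      have h2 := hV x x r √u hr hrsu (by rw [dist_self]; positivity)
      have h3 : √q = r / √u := by rw [hq, Real.sqrt_div (by positivity), Real.sqrt_sq hr.le]
      have h4 : (√q ^ n) ^ 2 ≤ √q ^ d := by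
        rw [← pow_mul, ← Real.rpow_natCast]
        refine Real.rpow_le_rpow_of_exponent_ge hsq0 hsq1 ?_
        push_cast
        linarith
      refine h4.trans ?_
      rw [mul_div_assoc', le_div_iff₀ hVu]
      calc √q ^ d * μ.real (Metric.ball x √u)
          ≤ √q ^ d * (C₂ * (√u / r) ^ d * μ.real (Metric.ball x r)) := by gcongr
        _ = (√q * (√u / r)) ^ d * (C₂ * μ.real (Metric.ball x r)) := by
            rw [Real.mul_rpow hsq0.le (by positivity)]; ring
        _ = C₂ * μ.real (Metric.ball x r) := by
            rw [h3, show r / √u * (√u / r) = 1 by field_simp, Real.one_rpow, one_mul]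
    calc _ ≤ √q * (√C₂ * v) := mul_le_mul_of_nonneg_left h1 hsq0.le
      _ = _ := by ring
  have key := le_of_le_of_le_pow (K := n + 1) (c := √C₂) (v := v) (z := √q)
    (y := ‖cut (measurableSet_shell x √u j) (heatDiff H u (ballOp H M r f))‖ /
      ((a₁ + a₂) * ‖f‖)) hW0 hsq0.le hv0.le (Real.sqrt_nonneg _) hz (by
        rw [div_le_iff₀ (by positivity), hsq]
        refine (norm_cut_le _ _).trans (hl2.trans ?_)
        calc a₂ * (q * v) * ‖f‖ ≤ (a₁ + a₂) * (q * v) * ‖f‖ := by gcongr; linarith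
          _ = _ := by ring) (by
        rw [div_le_iff₀ (by positivity)]
        refine hdec.trans ?_
        calc a₁ * W ^ (n + 2) * ‖f‖ ≤ (a₁ + a₂) * W ^ (n + 2) * ‖f‖ := by gcongr; linarith
          _ = _ := by ring)
  rw [div_le_iff₀ (by positivity)] at key
  exact key.trans (le_of_eq (by ring))

/-- The size of `(e^{-uH} - e^{-2uH}) B_Q f` relative to `‖f‖`, where `Q` has radius `r`. -/
def diffSize (H : Lp ℂ 2 μ →ₗ.[ℂ] Lp ℂ 2 μ) (r u : ℝ) (f : Lp ℂ 2 μ) : ℝ :=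
  ‖heatDiff H u f‖ + √(min (u / r ^ 2) (u / r ^ 2)⁻¹) * ‖f‖

/-- The scale is `ρ = max(r, √u)`. For `u ≥ r²` the smoothing factor `v` exactly compensates the
passage from `μ(Q)` to `μ(B(x, √u))`, so both regimes have the same form. -/
theorem exists_shellDecay [SFinite μ] (hdb : Doubling μ d) (hDG : DaviesGaffney H)
    (hDUE : DUE H) (hH : IsNonnegSelfAdjoint H) (hd : 0 < d) {M : ℕ} (hM : 1 ≤ M) :
    ∃ C : ℝ, 0 < C ∧ ∀ (x : X) (r u : ℝ) (f : Lp ℂ 2 μ), 0 < r → 0 < u →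
      SupportedIn f (Metric.ball x r) →
      ∃ ρ a : ℝ, √u ≤ ρ ∧ ShellDecay d x ρ a (heatDiff H u (ballOp H M r f)) ∧
        √(μ.real (Metric.ball x ρ)) * a ≤
          C * √(μ.real (Metric.ball x r)) * diffSize H r u f := by
  obtain ⟨C₁, hC₁, h₁⟩ := hDG.exists_shellDecay_of_le hH hd M
  obtain ⟨C₂, hC₂, h₂⟩ := exists_shellDecay_of_ge hdb hDG hDUE hH hd hM
  refine ⟨1 + C₁ + C₂, by positivity, fun x r u f hr hu hf => ?_⟩
  have hVr := hdb.pos x hr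
  have hr2 : 0 < r ^ 2 := by positivity
  have hD : 0 ≤ ‖heatDiff H u f‖ := norm_nonneg _
  have hf0 : 0 ≤ ‖f‖ := norm_nonneg _
  rw [diffSize]
  rcases le_total u (r ^ 2) with h | h
  · refine ⟨r, _, Real.sqrt_le_iff.2 ⟨hr.le, h⟩, h₁ x r u f hr hu h hf, ?_⟩
    have hq1 : u / r ^ 2 ≤ 1 := (div_le_one hr2).2 h
    rw [min_eq_left (hq1.trans ((one_le_inv₀ (by positivity)).2 hq1))]
    set s := √(u / r ^ 2) * ‖f‖
    have hs : 0 ≤ s := by positivity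
    have e : ‖heatDiff H u f‖ + C₁ * √(u / r ^ 2) * ‖f‖ ≤
        (1 + C₁ + C₂) * (‖heatDiff H u f‖ + s) := by
      have : C₁ * √(u / r ^ 2) * ‖f‖ = C₁ * s := by ring
      rw [this]
      nlinarith [mul_nonneg hC₁.le hD, mul_nonneg hC₂.le hD, mul_nonneg hC₂.le hs]
    calc _ ≤ √(μ.real (Metric.ball x r)) * ((1 + C₁ + C₂) * (‖heatDiff H u f‖ + s)) := by gcongr
      _ = _ := by ring
  · refine ⟨√u, _, le_rfl, h₂ x r u f hr hu h hf, ?_⟩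
    have hq1 : 1 ≤ u / r ^ 2 := (one_le_div hr2).2 h
    have hVu := hdb.pos x (Real.sqrt_pos.2 hu)
    rw [min_eq_right ((inv_le_one_of_one_le₀ hq1).trans hq1), inv_div]
    set s := √(r ^ 2 / u) * ‖f‖
    have hs : 0 ≤ s := by positivity
    have e : √(μ.real (Metric.ball x √u)) *
        √(μ.real (Metric.ball x r) / μ.real (Metric.ball x √u)) = √(μ.real (Metric.ball x r)) := by
      rw [← Real.sqrt_mul hVu.le, mul_div_cancel₀ _ hVu.ne']
    calc _ = C₂ * (√(μ.real (Metric.ball x √u)) *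
          √(μ.real (Metric.ball x r) / μ.real (Metric.ball x √u))) * s := by ring
      _ = C₂ * √(μ.real (Metric.ball x r)) * s := by rw [e]
      _ ≤ (1 + C₁ + C₂) * √(μ.real (Metric.ball x r)) * (‖heatDiff H u f‖ + s) := by
          gcongr <;> linarith

/-- A bound of `diffSize` on the dyadic interval `[v, 2v]`. -/
def dyadicSize (H : Lp ℂ 2 μ →ₗ.[ℂ] Lp ℂ 2 μ) (r v : ℝ) (f : Lp ℂ 2 μ) : ℝ :=
  2 * (‖psiOp H 1 v f‖ + √(min (v / r ^ 2) (v / r ^ 2)⁻¹) * ‖f‖)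

theorem diffSize_le_dyadicSize (hH : IsNonnegSelfAdjoint H) {r u v : ℝ} (hr : 0 < r) (hv : 0 < v)
    (hvu : v ≤ u) (huv : u ≤ 2 * v) (f : Lp ℂ 2 μ) : diffSize H r u f ≤ dyadicSize H r v f := by
  have h1 := norm_heatDiff_le_psiOp hH hv hvu huv f
  have hq : 0 < v / r ^ 2 := by positivity
  have hu : 0 < u := hv.trans_le hvu
  have h2 : min (u / r ^ 2) (u / r ^ 2)⁻¹ ≤ 2 ^ 2 * min (v / r ^ 2) (v / r ^ 2)⁻¹ := by
    rw [mul_min_of_nonneg _ _ (by norm_num)]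
    refine min_le_min ?_ ?_
    · rw [mul_div_assoc']
      gcongr
      linarith
    · have : (u / r ^ 2)⁻¹ ≤ (v / r ^ 2)⁻¹ := by gcongr
      have h0 : 0 < (v / r ^ 2)⁻¹ := by positivity
      linarith
  have h3 := Real.sqrt_le_sqrt h2
  rw [Real.sqrt_mul (by norm_num), Real.sqrt_sq two_pos.le] at h3
  have h4 := mul_le_mul_of_nonneg_right h3 (norm_nonneg f)
  rw [diffSize, dyadicSize]
  linarith

/-- Both parts of `dyadicSize` are square summable over the dyadic grid with constant `3`, whence
`48 = 8·3 + 8·3`. -/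
theorem sum_sq_dyadicSize_le (hH : IsNonnegSelfAdjoint H) {r b : ℝ} (hr : 0 < r) (hb : 0 < b)
    (n : ℕ) (f : Lp ℂ 2 μ) :
    ∑ i ∈ Finset.range n, dyadicSize H r (2 ^ i * b) f ^ 2 ≤ 48 * ‖f‖ ^ 2 := by
  have h1 := sum_norm_sq_psiOp_le hH hb n f
  have h2 := sum_min_two_pow_le (c := b / r ^ 2) (by positivity) n
  have h3 : ∀ i ∈ Finset.range n, dyadicSize H r (2 ^ i * b) f ^ 2 ≤
      8 * ‖psiOp H 1 (2 ^ i * b) f‖ ^ 2 +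
        8 * ‖f‖ ^ 2 * min (2 ^ i * (b / r ^ 2)) (2 ^ i * (b / r ^ 2))⁻¹ := by
    intro i _
    rw [dyadicSize, ← mul_div_assoc]
    set m := min (2 ^ i * b / r ^ 2) (2 ^ i * b / r ^ 2)⁻¹
    have hm : 0 ≤ m := by positivity
    have hs := Real.sq_sqrt hm
    calc _ ≤ 8 * ‖psiOp H 1 (2 ^ i * b) f‖ ^ 2 + 8 * ‖f‖ ^ 2 * √m ^ 2 := by
          nlinarith [sq_nonneg (‖psiOp H 1 (2 ^ i * b) f‖ - √m * ‖f‖)]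
      _ = _ := by rw [hs]
  refine (Finset.sum_le_sum h3).trans ?_
  rw [Finset.sum_add_distrib, ← Finset.mul_sum, ← Finset.mul_sum]
  nlinarith [sq_nonneg ‖f‖]

end ShellBounds

section BilinearBounds

variable {X : Type*} [MetricSpace X] [MeasurableSpace X] [BorelSpace X] {μ : Measure X} {d : ℝ}
  {H : Lp ℂ 2 μ →ₗ.[ℂ] Lp ℂ 2 μ}

/-! ### Bilinear estimates on atoms -/

/-- `T` commutes with the functions of `H` and satisfies the estimates of `PropertyH`. -/
structure HasBallBounds (H : Lp ℂ 2 μ →ₗ.[ℂ] Lp ℂ 2 μ) (κ : ℝ) (m : ℕ) (A : ℝ)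
    (T : Lp ℂ 2 μ →L[ℂ] Lp ℂ 2 μ) : Prop where
  commute : ∀ g : ℝ → ℝ, Commute (functionOf H g) T
  bound : ∀ u, 0 < u → BelowDiam X κ √u → BallBound (T * psiOp H m u) √u A

theorem PropertyH.hasBallBounds {κ A : ℝ} {m : ℕ} {T : Lp ℂ 2 μ →L[ℂ] Lp ℂ 2 μ}
    (hH : IsNonnegSelfAdjoint H) (hA : 0 ≤ A) (hT : CommutesWith H T)
    (h : PropertyH H κ m A T) : HasBallBounds H κ m A T := by
  refine ⟨fun g => hT.commute_functionOf hH g, fun u hu hub x y f hf => ?_⟩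
  have h1 := h √u (Real.sqrt_pos.2 hu) hub x y
  rw [Real.sq_sqrt hu.le, ← Real.sqrt_eq_rpow, ← Real.sqrt_eq_rpow] at h1
  exact h1.norm_cut_le measurableSet_ball (by positivity) hf

/-- The symmetric factorisation puts one heat difference on each side, so that both atoms are
localised before `T ψ_m(uH)` acts. -/
theorem reproKernel_functionOf (hH : IsNonnegSelfAdjoint H) (m : ℕ) {u : ℝ} (hu : 0 < u) :
    functionOf H (fun x => reproKernel m (u * x)) =
      heatDiff H u * psiOp H m u * heatDiff H u := by
  have h1 := vanishesAtTop_expDiff.comp_mul hu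
  have h2 := vanishesAtTop_psi m hu
  rw [heatDiff_eq hH hu, psiOp, ← functionOf_mul hH h1 h2, ← functionOf_mul hH (h1.mul h2) h1]
  refine functionOf_congr hH fun x _ => ?_
  rw [reproKernel]
  ring

theorem commute_heatDiff {T : Lp ℂ 2 μ →L[ℂ] Lp ℂ 2 μ}
    (h : ∀ g : ℝ → ℝ, Commute (functionOf H g) T) (u : ℝ) : Commute (heatDiff H u) T :=
  (h _).sub_left (h _)

theorem inner_heatDiff (u : ℝ) (f g : Lp ℂ 2 μ) :
    ⟪heatDiff H u f, g⟫_ℂ = ⟪f, heatDiff H u g⟫_ℂ := by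
  rw [heatDiff, sub_apply, sub_apply, inner_sub_left, inner_sub_right,
    inner_heat, inner_heat]

/-- The functional `S ↦ ⟪g, T S f⟫`. -/
def matrixCoeff (T : Lp ℂ 2 μ →L[ℂ] Lp ℂ 2 μ) (f g : Lp ℂ 2 μ) :
    (Lp ℂ 2 μ →L[ℂ] Lp ℂ 2 μ) →L[ℂ] ℂ :=
  (innerSL ℂ g ∘L T) ∘L ContinuousLinearMap.apply ℂ (Lp ℂ 2 μ) f

theorem matrixCoeff_apply (T S : Lp ℂ 2 μ →L[ℂ] Lp ℂ 2 μ) (f g : Lp ℂ 2 μ) :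
    matrixCoeff T f g S = ⟪g, T (S f)⟫_ℂ := rfl

/-- For each `u` in the dyadic interval one heat difference is moved past `T` onto the other atom.
Then both arguments have shell decay at scales at least `√u`, and the sum over pairs of shells
applies. -/
theorem exists_matrixCoeff_dyadic_le [SFinite μ] (hdb : Doubling μ d) (hDG : DaviesGaffney H)
    (hDUE : DUE H) (hH : IsNonnegSelfAdjoint H) (hd : 0 < d) {M : ℕ} (hM : 1 ≤ M) (k : ℕ) :
    ∃ C : ℝ, 0 < C ∧ ∀ (A : ℝ) (T : Lp ℂ 2 μ →L[ℂ] Lp ℂ 2 μ), 0 ≤ A →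
      (∀ g : ℝ → ℝ, Commute (functionOf H g) T) → ∀ v : ℝ, 0 < v →
      (∀ u ∈ Icc v (2 * v), BallBound (T * psiOp H (k + 1) u) √u A) →
      ∀ (x y : X) (r r' : ℝ) (f g : Lp ℂ 2 μ), 0 < r → 0 < r' →
      SupportedIn f (Metric.ball x r) → SupportedIn g (Metric.ball y r') →
      ‖matrixCoeff T (ballOp H M r f) (ballOp H M r' g)
        (functionOf H (fun x => reproTail k (v * x)) -
          functionOf H (fun x => reproTail k (2 * v * x)))‖ ≤
      C * A * √(μ.real (Metric.ball x r)) * √(μ.real (Metric.ball y r')) *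
        (dyadicSize H r v f * dyadicSize H r' v g) := by
  obtain ⟨C₁, hC₁, h1⟩ := exists_shellDecay hdb hDG hDUE hH hd hM
  obtain ⟨C₂, hC₂, h2⟩ := hdb.exists_inner_le
  refine ⟨C₂ * C₁ * C₁, by positivity, fun A T hA hT v hv hb x y r r' f g hr hr' hf hg => ?_⟩
  have hVx := hdb.pos x hr
  have hVy := hdb.pos y hr'
  have key : ∀ u ∈ Icc v (2 * v), ‖matrixCoeff T (ballOp H M r f) (ballOp H M r' g)
      (functionOf H fun x => reproKernel (k + 1) (u * x))‖ ≤
      C₂ * C₁ * C₁ * A * √(μ.real (Metric.ball x r)) * √(μ.real (Metric.ball y r')) *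
        (dyadicSize H r v f * dyadicSize H r' v g) := by
    intro u hu
    have hu0 : 0 < u := hv.trans_le hu.1
    obtain ⟨ρ, a, hρ, hF, ha⟩ := h1 x r u f hr hu0 hf
    obtain ⟨ρ', a', hρ', hG, ha'⟩ := h1 y r' u g hr' hu0 hg
    have ha2 := ha.trans (mul_le_mul_of_nonneg_left
      (diffSize_le_dyadicSize hH hr hv hu.1 hu.2 f) (by positivity))
    have ha2' := ha'.trans (mul_le_mul_of_nonneg_left
      (diffSize_le_dyadicSize hH hr' hv hu.1 hu.2 g) (by positivity))
    have e : matrixCoeff T (ballOp H M r f) (ballOp H M r' g)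
        (functionOf H fun x => reproKernel (k + 1) (u * x)) =
        ⟪heatDiff H u (ballOp H M r' g), (T * psiOp H (k + 1) u)
          (heatDiff H u (ballOp H M r f))⟫_ℂ := by
      rw [reproKernel_functionOf hH _ hu0, matrixCoeff_apply, inner_heatDiff]
      congr 1
      have := (commute_heatDiff hT u).eq
      have e2 : T * (heatDiff H u * psiOp H (k + 1) u * heatDiff H u) =
          heatDiff H u * (T * psiOp H (k + 1) u * heatDiff H u) := by
        simp only [← mul_assoc]
        rw [this]
      exact DFunLike.congr_fun e2 _
    have h3 := h2 _ √u A (Real.sqrt_pos.2 hu0) hA (hb u hu) x y ρ ρ' a a' hρ hρ' _ _ hF hG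
    have hn : ∀ {z ρ b} {F : Lp ℂ 2 μ}, ShellDecay d z ρ b F → 0 ≤ b := fun hF => by
      simpa using (norm_nonneg _).trans (hF 0)
    have ha0 := hn hF
    have ha0' := hn hG
    rw [e]
    refine h3.trans ?_
    calc _ ≤ C₂ * A * (C₁ * √(μ.real (Metric.ball x r)) * dyadicSize H r v f) *
          (C₁ * √(μ.real (Metric.ball y r')) * dyadicSize H r' v g) := by
          refine mul_le_mul (mul_le_mul_of_nonneg_left ha2 (by positivity)) ha2' (by positivity) ?_
          have : 0 ≤ dyadicSize H r v f := by rw [dyadicSize]; positivity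
          positivity
      _ = _ := by ring
  -- The interval `[v, 2v]` has length `v`, so integration against `du/u` costs no more than a
  -- factor `1`.
  have h4 := norm_apply_functionOf_sub_le hH (vanishesAtTop_reproTail k)
    (vanishesAtTop_reproKernel (k + 1)) (reproKernel_zero _)
    (fun t ht => hasDerivAt_reproTail k ht) hv (by linarith : v ≤ 2 * v) _ key
  refine h4.trans (le_of_eq ?_)
  field_simp
  ring

/-- The difference telescopes into dyadic blocks. Cauchy–Schwarz over the blocks and the square sums
of `dyadicSize` give a bound independent of `b` and `n`. -/
theorem exists_matrixCoeff_le_of_ballBound [SFinite μ] (hdb : Doubling μ d) (hDG : DaviesGaffney H)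
    (hDUE : DUE H) (hH : IsNonnegSelfAdjoint H) (hd : 0 < d) {M : ℕ} (hM : 1 ≤ M) (k : ℕ) :
    ∃ C : ℝ, 0 < C ∧ ∀ (A : ℝ) (T : Lp ℂ 2 μ →L[ℂ] Lp ℂ 2 μ), 0 ≤ A →
      (∀ g : ℝ → ℝ, Commute (functionOf H g) T) → ∀ (b : ℝ) (n : ℕ), 0 < b →
      (∀ u ∈ Icc b (2 ^ n * b), BallBound (T * psiOp H (k + 1) u) √u A) →
      ∀ (x y : X) (r r' : ℝ) (f g : Lp ℂ 2 μ), 0 < r → 0 < r' →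
      SupportedIn f (Metric.ball x r) → SupportedIn g (Metric.ball y r') →
      ‖matrixCoeff T (ballOp H M r f) (ballOp H M r' g)
        (functionOf H (fun x => reproTail k (b * x)) -
          functionOf H (fun x => reproTail k (2 ^ n * b * x)))‖ ≤
      C * A * √(μ.real (Metric.ball x r)) * √(μ.real (Metric.ball y r')) * (‖f‖ * ‖g‖) := by
  obtain ⟨C, hC, h⟩ := exists_matrixCoeff_dyadic_le hdb hDG hDUE hH hd hM k
  refine ⟨C * 48, by positivity, fun A T hA hT b n hb hbd x y r r' f g hr hr' hf hg => ?_⟩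
  set l := matrixCoeff T (ballOp H M r f) (ballOp H M r' g)
  set c := C * A * √(μ.real (Metric.ball x r)) * √(μ.real (Metric.ball y r'))
  have hc : 0 ≤ c := by positivity
  have htel := Finset.sum_range_sub' (fun i => functionOf H fun x => reproTail k (2 ^ i * b * x)) n
  rw [pow_zero, one_mul] at htel
  rw [← htel, map_sum]
  refine (norm_sum_le _ _).trans ?_
  have h1 : ∀ i ∈ Finset.range n, ‖l ((functionOf H fun x => reproTail k (2 ^ i * b * x)) -
      functionOf H fun x => reproTail k (2 ^ (i + 1) * b * x))‖ ≤
      c * (dyadicSize H r (2 ^ i * b) f * dyadicSize H r' (2 ^ i * b) g) := by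
    intro i hi
    have e : (2 : ℝ) ^ (i + 1) * b = 2 * (2 ^ i * b) := by ring
    rw [e]
    refine h A T hA hT (2 ^ i * b) (by positivity) (fun u hu => hbd u ⟨?_, ?_⟩) x y r r' f g hr hr'
      hf hg
    · exact (le_mul_of_one_le_left hb.le (one_le_pow₀ (by norm_num))).trans hu.1
    · rw [← e] at hu
      refine hu.2.trans (mul_le_mul_of_nonneg_right ?_ hb.le)
      exact pow_le_pow_right₀ (by norm_num) (Finset.mem_range.1 hi)
  refine (Finset.sum_le_sum h1).trans ?_
  rw [← Finset.mul_sum]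
  have h2 := Real.sum_mul_le_sqrt_mul_sqrt (Finset.range n) (fun i => dyadicSize H r (2 ^ i * b) f)
    (fun i => dyadicSize H r' (2 ^ i * b) g)
  have h3 : ∀ {r : ℝ} (f : Lp ℂ 2 μ), 0 < r →
      √(∑ i ∈ Finset.range n, dyadicSize H r (2 ^ i * b) f ^ 2) ≤ √48 * ‖f‖ := by
    intro r f hr
    refine (Real.sqrt_le_sqrt (sum_sq_dyadicSize_le hH hr hb n f)).trans (le_of_eq ?_)
    rw [Real.sqrt_mul (by norm_num), Real.sqrt_sq (norm_nonneg f)]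
  calc _ ≤ c * ((√48 * ‖f‖) * (√48 * ‖g‖)) := by
        refine mul_le_mul_of_nonneg_left (h2.trans ?_) hc
        exact mul_le_mul (h3 f hr) (h3 g hr') (Real.sqrt_nonneg _) (by positivity)
    _ = c * (√48 * √48) * (‖f‖ * ‖g‖) := by ring
    _ = _ := by rw [Real.mul_self_sqrt (by norm_num)]; ring

/-- `γ(LH)(1 - e^{-r²H})^M h → 0` as `L → ∞`. -/
theorem exists_norm_reproTail_ballOp_le (hH : IsNonnegSelfAdjoint H) {M : ℕ} (hM : 1 ≤ M) (k : ℕ) :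
    ∃ C : ℝ, 0 ≤ C ∧ ∀ (L r : ℝ) (f : Lp ℂ 2 μ), 0 < L → 0 < r →
      ‖functionOf H (fun x => reproTail k (L * x)) (ballOp H M r f)‖ ≤ C * r ^ 2 / L * ‖f‖ := by
  obtain ⟨G, hG, hb⟩ := (vanishesAtTop_pow_mul_reproTail k 1).exists_bound
  obtain ⟨M, rfl⟩ : ∃ M', M = M' + 1 := ⟨M - 1, by omega⟩
  refine ⟨G, hG, fun L r f hL hr => ?_⟩
  have hγ := (vanishesAtTop_reproTail k).comp_mul hL
  have he := vanishesAtTop_exp (t := r ^ 2) (by positivity)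
  have e : functionOf H (fun x => reproTail k (L * x)) * (1 - heat H (r ^ 2)) =
      functionOf H fun x => reproTail k (L * x) - reproTail k (L * x) * Real.exp (-(r ^ 2 * x)) := by
    rw [functionOf_sub hH hγ (hγ.mul he), functionOf_mul hH hγ he, mul_sub, mul_one]
    rfl
  have e2 : ballOp H (M + 1) r f = (1 - heat H (r ^ 2)) (ballOp H M r f) :=
    DFunLike.congr_fun (pow_succ' (1 - heat H (r ^ 2)) M) f
  rw [e2, ← mul_apply_eq_comp, e]
  refine (norm_functionOf_apply_le hH (by positivity : 0 ≤ G * r ^ 2 / L) (fun x hx => ?_) _).trans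
    (mul_le_mul_of_nonneg_left (norm_ballOp_apply_le hH M hr f) (by positivity))
  have h1 := hb (L * x) (by positivity)
  rw [pow_one, abs_mul, abs_of_nonneg (by positivity : 0 ≤ L * x)] at h1
  have h2 : |1 - Real.exp (-(r ^ 2 * x))| ≤ r ^ 2 * x := by
    have := Real.add_one_le_exp (-(r ^ 2 * x))
    have h3 : Real.exp (-(r ^ 2 * x)) ≤ 1 := Real.exp_le_one_iff.2 (by nlinarith [sq_nonneg r])
    rw [abs_of_nonneg (by linarith)]
    linarith
  rw [show reproTail k (L * x) - reproTail k (L * x) * Real.exp (-(r ^ 2 * x)) =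
    reproTail k (L * x) * (1 - Real.exp (-(r ^ 2 * x))) by ring, abs_mul, le_div_iff₀ hL]
  calc |reproTail k (L * x)| * |1 - Real.exp (-(r ^ 2 * x))| * L
      ≤ |reproTail k (L * x)| * (r ^ 2 * x) * L := by gcongr
    _ = L * x * |reproTail k (L * x)| * r ^ 2 := by ring
    _ ≤ _ := by gcongr

/-- The bilinear estimate follows from bounds uniform in `b → 0`. -/
theorem norm_inner_le_of_matrixCoeff_le (hH : IsNonnegSelfAdjoint H) (k : ℕ)
    (T : Lp ℂ 2 μ →L[ℂ] Lp ℂ 2 μ) (f g : Lp ℂ 2 μ) {K b₀ : ℝ} (hb₀ : 0 < b₀)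
    (h : ∀ n : ℕ, ‖matrixCoeff T f g (functionOf H fun x => reproTail k ((2 ^ n)⁻¹ * b₀ * x))‖ ≤ K) :
    ‖⟪g, T f⟫_ℂ‖ ≤ (reproTail k 0)⁻¹ * K := by
  have hγ := reproTail_zero_pos k
  have h1 := tendsto_functionOf_nhdsGT_zero hH (vanishesAtTop_reproTail k) f
  have h2 : Tendsto (fun n : ℕ => ((2 : ℝ) ^ n)⁻¹ * b₀) atTop (𝓝[>] 0) := by
    refine tendsto_nhdsWithin_iff.2 ⟨?_, Eventually.of_forall fun n => ?_⟩
    · have := (tendsto_inv_atTop_zero.comp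
        (tendsto_pow_atTop_atTop_of_one_lt (by norm_num : (1 : ℝ) < 2))).mul_const b₀
      simpa using this
    · simp only [mem_Ioi]
      positivity
  have h3 := ((innerSL ℂ g ∘L T).continuous.tendsto _).comp (h1.comp h2)
  have h4 := le_of_tendsto h3.norm (Eventually.of_forall h)
  rw [map_smul, norm_smul, Complex.norm_real, Real.norm_of_nonneg hγ.le] at h4
  rw [inv_mul_eq_div, le_div_iff₀ hγ, mul_comm]
  exact h4

/-- With `b` fixed, the upper end of the range of `u` is sent to infinity, where `B_Q` makes the
remainder vanish; then `b → 0`. -/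
theorem exists_bilinear_bound_of_unbounded [SFinite μ] (hdb : Doubling μ d)
    (hDG : DaviesGaffney H) (hDUE : DUE H) (hH : IsNonnegSelfAdjoint H) (hd : 0 < d) {M : ℕ}
    (hM : 1 ≤ M) (k : ℕ) (hX : ¬ Bornology.IsBounded (univ : Set X)) (κ : ℝ) :
    ∃ C : ℝ, 0 < C ∧ ∀ (A : ℝ) (T : Lp ℂ 2 μ →L[ℂ] Lp ℂ 2 μ), 0 ≤ A →
      HasBallBounds H κ (k + 1) A T →
      ∀ (x y : X) (r r' : ℝ) (f g : Lp ℂ 2 μ), 0 < r → 0 < r' →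
      SupportedIn f (Metric.ball x r) → SupportedIn g (Metric.ball y r') →
      ‖⟪ballOp H M r' g, T (ballOp H M r f)⟫_ℂ‖ ≤
      C * A * √(μ.real (Metric.ball x r)) * √(μ.real (Metric.ball y r')) * (‖f‖ * ‖g‖) := by
  obtain ⟨C, hC, h⟩ := exists_matrixCoeff_le_of_ballBound hdb hDG hDUE hH hd hM k
  obtain ⟨C', hC', h'⟩ := exists_norm_reproTail_ballOp_le hH hM k
  have hγ := reproTail_zero_pos k
  refine ⟨(reproTail k 0)⁻¹ * C, by positivity, fun A T hA hT x y r r' f g hr hr' hf hg => ?_⟩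
  refine (norm_inner_le_of_matrixCoeff_le hH k T _ _ one_pos (K := C * A *
    √(μ.real (Metric.ball x r)) * √(μ.real (Metric.ball y r')) * (‖f‖ * ‖g‖)) fun n => ?_).trans
    (le_of_eq (by ring))
  set l := matrixCoeff T (ballOp H M r f) (ballOp H M r' g)
  set b : ℝ := (2 ^ n)⁻¹ * 1 with hb
  have hb0 : 0 < b := by positivity
  have h1 : ∀ N : ℕ, ‖l (functionOf H (fun x => reproTail k (b * x)) -
      functionOf H (fun x => reproTail k (2 ^ N * b * x)))‖ ≤ C * A *
    √(μ.real (Metric.ball x r)) * √(μ.real (Metric.ball y r')) * (‖f‖ * ‖g‖) := fun N =>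
    h A T hA hT.commute b N hb0 (fun u hu => hT.bound u (hb0.trans_le hu.1) fun hX' =>
      absurd hX' hX) x y r r' f g hr hr' hf hg
  have h2 : Tendsto (fun N : ℕ => l (functionOf H (fun x => reproTail k (2 ^ N * b * x)))) atTop
      (𝓝 0) := by
    have h3 : Tendsto (fun N : ℕ => functionOf H (fun x => reproTail k (2 ^ N * b * x))
        (ballOp H M r f)) atTop (𝓝 0) := by
      refine squeeze_zero_norm (fun N => h' (2 ^ N * b) r f (by positivity) hr) ?_
      have h5 := (tendsto_inv_atTop_zero.comp
        (tendsto_pow_atTop_atTop_of_one_lt (by norm_num : (1 : ℝ) < 2))).mul_const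
        (C' * r ^ 2 / b * ‖f‖)
      rw [zero_mul] at h5
      refine h5.congr fun N => ?_
      simp only [Function.comp_apply]
      field_simp
    have h4 := ((innerSL ℂ (ballOp H M r' g) ∘L T).continuous.tendsto _).comp h3
    rw [map_zero] at h4
    exact h4
  have h3 := (tendsto_const_nhds (x := l (functionOf H (fun x => reproTail k (b * x))))).sub h2
  rw [sub_zero] at h3
  refine le_of_tendsto h3.norm (Eventually.of_forall fun N => ?_)
  rw [← map_sub]
  exact h1 N

end BilinearBounds

/-! ### The low-frequency part on a bounded space -/

theorem vanishesAtTop_gammaTail_mul_exp (k : ℕ) {c a : ℝ} (hc : a < c) :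
    VanishesAtTop fun x => gammaTail k c x * Real.exp (a * x) := by
  have hexp : ∀ x, Real.exp (-(c * x)) * Real.exp (a * x) = Real.exp (-((c - a) * x)) := fun x => by
    rw [← Real.exp_add]; ring_nf
  induction k with
  | zero =>
    have := (vanishesAtTop_exp (t := c - a) (by linarith)).const_mul c⁻¹
    convert this using 2 with x
    rw [gammaTail, ← hexp]
    ring
  | succ k ih =>
    have := ((vanishesAtTop_pow_mul_exp (k + 1) (c := c - a) (by linarith)).const_mul c⁻¹).add
      (ih.const_mul ((k + 1) / c))
    convert this using 2 with x
    rw [gammaTail, ← hexp]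
    ring

/-- The slowest exponential in `reproTail` is `e^{-3x}`, so a factor `e^{2x}` can be given away:
half of it goes to `ψ_m` and half to the two outer heat operators. -/
theorem vanishesAtTop_reproTail_mul_exp (k : ℕ) :
    VanishesAtTop fun x => reproTail k x * Real.exp (2 * x) := by
  have := ((vanishesAtTop_gammaTail_mul_exp k (c := 3) (a := 2) (by norm_num)).sub
    ((vanishesAtTop_gammaTail_mul_exp k (c := 4) (a := 2) (by norm_num)).const_mul
      2)).add (vanishesAtTop_gammaTail_mul_exp k (c := 5) (a := 2) (by norm_num))
  convert this using 2 with x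
  rw [reproTail]
  ring

/-- `reproTail k (u x) = e^{-ux/2} ψ_m(ux) q(x) e^{-ux/2}` for `x ≥ b`. -/
theorem exists_reproTail_factor (k m : ℕ) {u b : ℝ} (hu : 0 < u) (hb : 0 < b) :
    ∃ q : ℝ → ℝ, VanishesAtTop q ∧ ∀ x, b ≤ x → reproTail k (u * x) =
      Real.exp (-(u / 2 * x)) * psi m (u * x) * q x * Real.exp (-(u / 2 * x)) := by
  have h := (vanishesAtTop_reproTail_mul_exp k).comp_mul hu
  -- Replacing `x` by `max x b` avoids the singularity of `x^{-m}` at `0`; values below `b` are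
  -- irrelevant because of the spectral gap.
  have h2 : VanishesAtTop fun x => (reproTail k (u * max x b) * Real.exp (2 * (u * max x b))) *
      ((u * max x b) ^ m)⁻¹ := by
    have hmax : Tendsto (fun x => max x b) atTop atTop :=
      tendsto_atTop_mono (fun x => le_max_left _ _) tendsto_id
    have hpos : ∀ x, 0 < (u * max x b) ^ m := fun x => by
      have : 0 < max x b := hb.trans_le (le_max_right _ _)
      positivity
    refine ⟨?_, ?_⟩
    · refine ContinuousOn.mul (h.cont.comp (by fun_prop) fun x _ => ?_)
        (ContinuousOn.inv₀ (by fun_prop) fun x _ => (hpos x).ne')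
      exact mem_Ici.2 (hb.le.trans (le_max_right _ _))
    · have h3 := h.lim.comp hmax
      have h4 := h3.norm.mul_const ((u * b) ^ m)⁻¹
      rw [norm_zero, zero_mul] at h4
      refine squeeze_zero_norm (fun x => ?_) h4
      rw [norm_mul, Real.norm_of_nonneg (inv_nonneg.2 (hpos x).le)]
      refine mul_le_mul_of_nonneg_left ?_ (norm_nonneg _)
      gcongr
      exact le_max_right _ _
  refine ⟨_, h2, fun x hx => ?_⟩
  have hx0 : 0 < x := hb.trans_le hx
  simp only [max_eq_left hx, psi]
  have e : Real.exp (-(u / 2 * x)) * Real.exp (-(u / 2 * x)) * Real.exp (-(u * x)) *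
      Real.exp (2 * (u * x)) = 1 := by
    rw [← Real.exp_add, ← Real.exp_add, ← Real.exp_add, Real.exp_eq_one_iff]
    ring
  have hne : (u * x) ^ m ≠ 0 := by positivity
  calc reproTail k (u * x) = reproTail k (u * x) * ((u * x) ^ m * ((u * x) ^ m)⁻¹) *
        (Real.exp (-(u / 2 * x)) * Real.exp (-(u / 2 * x)) * Real.exp (-(u * x)) *
      Real.exp (2 * (u * x))) := by rw [e, mul_inv_cancel₀ hne, mul_one, mul_one]
    _ = _ := by ring

section BoundedSpace

variable {X : Type*} [MetricSpace X] [MeasurableSpace X] [BorelSpace X] {μ : Measure X} {d : ℝ}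
  {H : Lp ℂ 2 μ →ₗ.[ℂ] Lp ℂ 2 μ}

/-- Small balls use the smoothing estimate at fixed `t`; large balls have volume bounded below, so
contractivity suffices. -/
theorem DUE.exists_norm_heat_le_sqrt [Nontrivial X] [SFinite μ] (hDUE : DUE H)
    (hd : Doubling μ d) (hvol : LowerVolumeBound μ) (hH : IsNonnegSelfAdjoint H) {t : ℝ}
    (ht : 0 < t) :
    ∃ C : ℝ, 0 < C ∧ ∀ (x : X) (r : ℝ) (f : Lp ℂ 2 μ), 0 < r →
      SupportedIn f (Metric.ball x r) → ‖heat H t f‖ ≤ C * √(μ.real (Metric.ball x r)) * ‖f‖ := by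
  obtain ⟨C, hC, h⟩ := hDUE.exists_smoothing hd
  obtain ⟨v, hv, hvx⟩ := hvol.exists_lower_bound hd (Real.sqrt_pos.2 ht)
  refine ⟨(C + 1) / √v, by positivity, fun x r f hr hf => ?_⟩
  have hsv : 0 < √v := Real.sqrt_pos.2 hv
  rcases le_total r (2 * √t) with hrt | hrt
  · refine (h x r t f hr ht hrt hf).trans ?_
    rw [Real.sqrt_div measureReal_nonneg]
    have h1 := Real.sqrt_le_sqrt (hvx x)
    calc _ ≤ (C + 1) * (√(μ.real (Metric.ball x r)) / √v) * ‖f‖ := by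
          gcongr
          linarith
      _ = _ := by ring
  · refine (norm_heat_apply_le hH ht f).trans (le_mul_of_one_le_left (norm_nonneg f) ?_)
    have h1 : v ≤ μ.real (Metric.ball x r) := (hvx x).trans
      (hd.mono (Metric.ball_subset_ball (by linarith [Real.sqrt_nonneg t])))
    have h2 := Real.sqrt_le_sqrt h1
    rw [div_mul_eq_mul_div, one_le_div hsv]
    nlinarith

/-- The whole space is a single ball, to which the bound at radius `ρ` extends by covering. -/
theorem Doubling.exists_norm_le_of_isBounded [Nonempty X] (hd : Doubling μ d)
    (hX : Bornology.IsBounded (univ : Set X)) (ρ : ℝ) (hρ : 0 < ρ) :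
    ∃ C : ℝ, 0 < C ∧ ∀ (S : Lp ℂ 2 μ →L[ℂ] Lp ℂ 2 μ) (K : ℝ), 0 ≤ K → BallBound S ρ K →
      ∀ f, ‖S f‖ ≤ C * K * ‖f‖ := by
  obtain ⟨C, hC, h⟩ := hd.exists_ballBound_const
  obtain ⟨x⟩ := ‹Nonempty X›
  obtain ⟨R, hR⟩ := hX.subset_ball x
  have hball : Metric.ball x (max R ρ) = univ :=
    univ_subset_iff.1 (hR.trans (Metric.ball_subset_ball (le_max_left _ _)))
  have hpos := hd.pos x (hρ.trans_le (le_max_right R ρ))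
  refine ⟨C * μ.real (Metric.ball x (max R ρ)), by positivity, fun S K hK hS f => ?_⟩
  have hsupp : ∀ f : Lp ℂ 2 μ, SupportedIn f (Metric.ball x (max R ρ)) := fun f =>
    Eventually.of_forall fun y hy => absurd (hball ▸ mem_univ y) hy
  have h1 := h S ρ K hρ hK hS x x (max R ρ) (max R ρ) (le_max_right _ _)
    (le_max_right _ _) f (hsupp f)
  rw [(hsupp (S f)).cut_eq] at h1
  refine h1.trans (le_of_eq ?_)
  linear_combination (C * K * ‖f‖) * Real.mul_self_sqrt hpos.le

/-- The dyadic argument covers all scales up to `u = (κ diam X)²`. The remainder `reproTail k (uH)`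
is factored as `e^{-uH/2} ψ_m(uH) q(H) e^{-uH/2}` on atoms. The middle part composed with `T` is
bounded on `L²` by a multiple of `A`, and each outer heat operator contributes the square root of
the volume of one ball. -/
theorem exists_bilinear_bound_of_isBounded [Nontrivial X] [SFinite μ] (hdb : Doubling μ d)
    (hvol : LowerVolumeBound μ) (hDG : DaviesGaffney H) (hDUE : DUE H)
    (hH : IsNonnegSelfAdjoint H) (hd : 0 < d) {M : ℕ} (hM : 1 ≤ M) (k : ℕ)
    (hX : Bornology.IsBounded (univ : Set X)) {κ : ℝ} (hκ : 0 < κ) :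
    ∃ C : ℝ, 0 < C ∧ ∀ (A : ℝ) (T : Lp ℂ 2 μ →L[ℂ] Lp ℂ 2 μ), 0 ≤ A →
      HasBallBounds H κ (k + 1) A T →
      ∀ (x y : X) (r r' : ℝ) (f g : Lp ℂ 2 μ), 0 < r → 0 < r' →
      SupportedIn f (Metric.ball x r) → SupportedIn g (Metric.ball y r') →
      ‖⟪ballOp H M r' g, T (ballOp H M r f)⟫_ℂ‖ ≤
      C * A * √(μ.real (Metric.ball x r)) * √(μ.real (Metric.ball y r')) * (‖f‖ * ‖g‖) := by
  have hD : 0 < Metric.diam (univ : Set X) := by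
    obtain ⟨x, y, hxy⟩ := exists_pair_ne X
    exact (dist_pos.2 hxy).trans_le (Metric.dist_le_diam_of_mem hX (mem_univ _) (mem_univ _))
  set ρ := κ * Metric.diam (univ : Set X) with hρ
  have hρ0 : 0 < ρ := by positivity
  set u := ρ ^ 2 with hu
  have hu0 : 0 < u := by positivity
  have hsu : √u = ρ := Real.sqrt_sq hρ0.le
  obtain ⟨C₁, hC₁, h1⟩ := exists_matrixCoeff_le_of_ballBound hdb hDG hDUE hH hd hM k
  obtain ⟨b, hb, hgap⟩ := exists_functionOf_congr_of_hilbertSchmidt hH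
    (hDUE.exists_hilbertSchmidt hdb hvol hX one_pos)
  obtain ⟨q, hq, hqe⟩ := exists_reproTail_factor k (k + 1) hu0 hb
  obtain ⟨Q, hQ, hQb⟩ := hq.exists_bound
  obtain ⟨C₂, hC₂, h2⟩ := hDUE.exists_norm_heat_le_sqrt hdb hvol hH (half_pos hu0)
  obtain ⟨C₃, hC₃, h3⟩ := hdb.exists_norm_le_of_isBounded hX ρ hρ0
  have hγ := reproTail_zero_pos k
  refine ⟨(reproTail k 0)⁻¹ * (C₁ + C₃ * Q * C₂ * C₂), by positivity,
    fun A T hA hT x y r r' f g hr hr' hf hg => ?_⟩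
  set V := √(μ.real (Metric.ball x r))
  set V' := √(μ.real (Metric.ball y r'))
  set l := matrixCoeff T (ballOp H M r f) (ballOp H M r' g) with hl
  have hrem : ‖l (functionOf H fun x => reproTail k (u * x))‖ ≤
      C₃ * Q * C₂ * C₂ * A * V * V' * (‖f‖ * ‖g‖) := by
    obtain ⟨M, rfl⟩ : ∃ M', M = M' + 1 := ⟨M - 1, by omega⟩
    have ht := vanishesAtTop_exp (half_pos hu0)
    have hψ := vanishesAtTop_psi (k + 1) hu0
    have hγ := (vanishesAtTop_reproTail k).comp_mul hu0
    have hr2 := vanishesAtTop_exp (t := r ^ 2) (by positivity)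
    set P := heat H (u / 2)
    set Ψ := psiOp H (k + 1) u
    set q' := functionOf H q
    have hprod := ((ht.mul hψ).mul hq).mul ht
    have eprod : functionOf H (fun x => Real.exp (-(u / 2 * x)) * psi (k + 1) (u * x) * q x *
        Real.exp (-(u / 2 * x))) = P * Ψ * q' * P := by
      rw [functionOf_mul hH ((ht.mul hψ).mul hq) ht, functionOf_mul hH (ht.mul hψ) hq,
        functionOf_mul hH ht hψ]
      rfl
    -- The factorisation holds only on `[b, ∞)`. The factor `1 - e^{-r²H}` of `B_Q` makes both sides
    -- vanish at energy `0`, which is all that the spectral gap requires.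
    have e1 : functionOf H (fun x => reproTail k (u * x)) * (1 - heat H (r ^ 2)) =
        P * Ψ * q' * P * (1 - heat H (r ^ 2)) := by
      rw [← eprod, mul_sub, mul_sub, mul_one, mul_one, heat, ← functionOf_mul hH hγ hr2,
        ← functionOf_mul hH hprod hr2, ← functionOf_sub hH hγ (hγ.mul hr2),
        ← functionOf_sub hH hprod (hprod.mul hr2)]
      refine hgap _ _ (by simp) fun x hx => ?_
      simp only [hqe x hx]
    have e2 : functionOf H (fun x => reproTail k (u * x)) (ballOp H (M + 1) r f) =
        (P * Ψ * q' * P) (ballOp H (M + 1) r f) := by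
      have : ballOp H (M + 1) r = (1 - heat H (r ^ 2)) * ballOp H M r := pow_succ' _ _
      have e3 := congrArg (· * ballOp H M r) e1
      simp only [mul_assoc _ (1 - heat H (r ^ 2)), ← this] at e3
      exact DFunLike.congr_fun e3 f
    have e4 : l (functionOf H fun x => reproTail k (u * x)) =
        ⟪P (ballOp H (M + 1) r' g), (T * Ψ) (q' (P (ballOp H (M + 1) r f)))⟫_ℂ := by
      rw [hl, matrixCoeff_apply, e2, inner_heat]
      congr 1
      have := (hT.commute (fun x => Real.exp (-(u / 2 * x)))).eq
      exact (DFunLike.congr_fun this (Ψ (q' (P (ballOp H (M + 1) r f))))).symm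
    have hP : ∀ (z : X) (s : ℝ) (w : Lp ℂ 2 μ), 0 < s → SupportedIn w (Metric.ball z s) →
        ‖P (ballOp H (M + 1) s w)‖ ≤ C₂ * √(μ.real (Metric.ball z s)) * ‖w‖ := by
      intro z s w hs hw
      have e5 : P (ballOp H (M + 1) s w) = ballOp H (M + 1) s (P w) :=
        DFunLike.congr_fun (commute_functionOf_ballOp H _ (M + 1) s).eq w
      rw [e5]
      exact (norm_ballOp_apply_le hH _ hs _).trans (h2 z s w hs hw)
    have hbb : BallBound (T * Ψ) ρ A := by
      have := hT.bound u hu0 (fun _ => hsu.le)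
      rwa [hsu] at this
    rw [e4]
    refine (norm_inner_le_norm _ _).trans ?_
    calc _ ≤ (C₂ * V' * ‖g‖) * (C₃ * A * (Q * (C₂ * V * ‖f‖))) := by
          refine mul_le_mul (hP y r' g hr' hg) ((h3 _ A hA hbb _).trans ?_) (norm_nonneg _)
            (by positivity)
          refine mul_le_mul_of_nonneg_left ?_ (by positivity)
          exact (norm_functionOf_apply_le hH hQ hQb _).trans
            (mul_le_mul_of_nonneg_left (hP x r f hr hf) hQ)
      _ = _ := by ring
  refine (norm_inner_le_of_matrixCoeff_le hH k T _ _ hu0 (K := (C₁ + C₃ * Q * C₂ * C₂) * A *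
    V * V' * (‖f‖ * ‖g‖)) fun n => ?_).trans (le_of_eq (by ring))
  -- Starting at `2^{-n} u`, the chain of `n` dyadic blocks ends exactly at `u`, the largest scale
  -- at which the hypothesis holds.
  have h4 := h1 A T hA hT.commute ((2 ^ n)⁻¹ * u) n (by positivity) (fun w hw =>
    hT.bound w ((by positivity : (0 : ℝ) < (2 ^ n)⁻¹ * u).trans_le hw.1) fun _ => ?_)
    x y r r' f g hr hr' hf hg
  · have e5 : (2 : ℝ) ^ n * ((2 ^ n)⁻¹ * u) = u := by field_simp
    rw [e5, map_sub] at h4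
    have h5 := norm_le_norm_sub_add (l (functionOf H fun x => reproTail k ((2 ^ n)⁻¹ * u * x)))
      (l (functionOf H fun x => reproTail k (u * x)))
    refine h5.trans ((add_le_add h4 hrem).trans (le_of_eq (by ring)))
  · have e5 : (2 : ℝ) ^ n * ((2 ^ n)⁻¹ * u) = u := by field_simp
    rw [e5] at hw
    rw [← hρ, ← hsu]
    exact Real.sqrt_le_sqrt hw.2

/-- The bilinear estimate on pairs of atoms. -/
theorem exists_bilinear_bound [Nontrivial X] [SFinite μ] (hdb : Doubling μ d)
    (hvol : LowerVolumeBound μ) (hDG : DaviesGaffney H) (hDUE : DUE H)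
    (hH : IsNonnegSelfAdjoint H) (hd : 0 < d) {M : ℕ} (hM : 1 ≤ M) {m : ℕ} (hm : 1 ≤ m)
    {κ : ℝ} (hκ : 0 < κ) :
    ∃ C : ℝ, 0 < C ∧ ∀ (A : ℝ) (T : Lp ℂ 2 μ →L[ℂ] Lp ℂ 2 μ), 0 ≤ A →
      HasBallBounds H κ m A T →
      ∀ (x y : X) (r r' : ℝ) (f g : Lp ℂ 2 μ), 0 < r → 0 < r' →
      SupportedIn f (Metric.ball x r) → SupportedIn g (Metric.ball y r') →
      ‖⟪ballOp H M r' g, T (ballOp H M r f)⟫_ℂ‖ ≤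
      C * A * √(μ.real (Metric.ball x r)) * √(μ.real (Metric.ball y r')) * (‖f‖ * ‖g‖) := by
  obtain ⟨k, rfl⟩ : ∃ k, m = k + 1 := ⟨m - 1, by omega⟩
  by_cases hX : Bornology.IsBounded (univ : Set X)
  · exact exists_bilinear_bound_of_isBounded hdb hvol hDG hDUE hH hd hM k hX hκ
  · exact exists_bilinear_bound_of_unbounded hdb hDG hDUE hH hd hM k hX κ

/-! ### The operators `T e^{-sH}` -/

theorem psiOp_mul_heat (hH : IsNonnegSelfAdjoint H) (m : ℕ) {u v s t : ℝ} (hu : 0 < u)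
    (hv : 0 < v) (hs : 0 < s) (ht : 0 < t) (h : u + s = v + t) (f : Lp ℂ 2 μ) :
    psiOp H m u (heat H s f) = (((u / v) ^ m : ℝ) : ℂ) • psiOp H m v (heat H t f) := by
  have h1 := vanishesAtTop_psi m hu
  have h2 := vanishesAtTop_exp hs
  have h3 := vanishesAtTop_psi m hv
  have h4 := vanishesAtTop_exp ht
  have e : psiOp H m u * heat H s = (((u / v) ^ m : ℝ) : ℂ) • (psiOp H m v * heat H t) := by
    rw [psiOp, psiOp, heat, heat, ← functionOf_mul hH h1 h2, ← functionOf_mul hH h3 h4,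
      Complex.coe_smul, ← functionOf_const_mul hH (h3.mul h4)]
    refine functionOf_congr hH fun x _ => ?_
    have e1 : Real.exp (-(u * x)) * Real.exp (-(s * x)) =
        Real.exp (-(v * x)) * Real.exp (-(t * x)) := by
      rw [← Real.exp_add, ← Real.exp_add]
      congr 1
      linear_combination (-x) * h
    have e2 : (u / v) ^ m * (v * x) ^ m = (u * x) ^ m := by
      rw [← mul_pow]; congr 1; field_simp
    simp only [psi]
    rw [mul_assoc, e1, ← e2]
    ring
  exact DFunLike.congr_fun e f

theorem psiOp_mul_heat_eq (hH : IsNonnegSelfAdjoint H) (m : ℕ) {u s : ℝ} (hu : 0 < u)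
    (hs : 0 < s) (f : Lp ℂ 2 μ) :
    psiOp H m u (heat H s f) = (((u / (u + s)) ^ m : ℝ) : ℂ) • psiOp H m (u + s) f := by
  have h1 := vanishesAtTop_psi m hu
  have h2 := vanishesAtTop_exp hs
  have h3 := vanishesAtTop_psi m (add_pos hu hs)
  have e : psiOp H m u * heat H s = (((u / (u + s)) ^ m : ℝ) : ℂ) • psiOp H m (u + s) := by
    rw [psiOp, psiOp, heat, ← functionOf_mul hH h1 h2, 
      Complex.coe_smul, ← functionOf_const_mul hH h3]
    refine functionOf_congr hH fun x _ => ?_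
    have e1 : Real.exp (-(u * x)) * Real.exp (-(s * x)) = Real.exp (-((u + s) * x)) := by
      rw [← Real.exp_add]
      congr 1
      ring
    have e2 : (u / (u + s)) ^ m * ((u + s) * x) ^ m = (u * x) ^ m := by
      rw [← mul_pow]; congr 1; field_simp
    simp only [psi]
    rw [mul_assoc, e1, ← e2]
    ring
  exact DFunLike.congr_fun e f

/-- The operator `ψ_m(uH) e^{-sH}` is `(u/(u+s))^m` times `ψ_m((u+s)H)`, so the bound at radius
`√(u+s)` is used on larger balls. Doubling loses `((u+s)/u)^{d/2}`, which the prefactor absorbs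
since `m ≥ d/2`. The constant is uniform in `s`. -/
theorem exists_hasBallBounds_mul_heat [Nontrivial X] (hdb : Doubling μ d)
    (hvol : LowerVolumeBound μ) (hH : IsNonnegSelfAdjoint H) {m : ℕ}
    (hm : d / 2 ≤ m) {κ : ℝ} (hκ : 0 < κ) :
    ∃ C : ℝ, 1 ≤ C ∧ ∀ (A : ℝ) (T : Lp ℂ 2 μ →L[ℂ] Lp ℂ 2 μ), 0 ≤ A → HasBallBounds H κ m A T →
      ∀ s, 0 < s → HasBallBounds H κ m (C * A) (T * heat H s) := by
  obtain ⟨C₁, hC₁, h1⟩ := hdb.exists_const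
  -- If `√(u+s)` exceeds the admissible radius `ρ`, only the part of `s` that reaches `ρ²` is
  -- absorbed; the rest remains as a contraction. The prefactor `(u/ρ²)^m` is then dominated by the
  -- volumes of balls of radius `√u`.
  obtain ⟨C₂, hC₂, h2⟩ : ∃ C₂ : ℝ, 0 < C₂ ∧ ∀ (A : ℝ) (T : Lp ℂ 2 μ →L[ℂ] Lp ℂ 2 μ), 0 ≤ A →
      HasBallBounds H κ m A T → ∀ u, 0 < u → BelowDiam X κ √u → ∀ s, 0 < s →
      ¬ BelowDiam X κ √(u + s) → BallBound (T * heat H s * psiOp H m u) √u (C₂ * A) := by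
    by_cases hX : Bornology.IsBounded (univ : Set X)
    swap
    · exact ⟨1, one_pos, fun A T _ _ u _ _ s _ hn => absurd (fun h => absurd h hX) hn⟩
    have hD : 0 < Metric.diam (univ : Set X) := by
      obtain ⟨x, y, hxy⟩ := exists_pair_ne X
      exact (dist_pos.2 hxy).trans_le (Metric.dist_le_diam_of_mem hX (mem_univ _) (mem_univ _))
    set ρ := κ * Metric.diam (univ : Set X) with hρ
    have hρ0 : 0 < ρ := by positivity
    obtain ⟨C₃, hC₃, h3⟩ := hdb.exists_norm_le_of_isBounded hX ρ hρ0
    obtain ⟨v, hv, hvx⟩ := hvol.exists_lower_bound hdb hρ0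
    refine ⟨C₃ * (C₁ / v), by positivity, fun A T hA hT u hu hub s hs hus x y f hf => ?_⟩
    have hun : ρ < √(u + s) := by
      by_contra hle
      exact hus fun _ => not_lt.1 hle
    have hule : √u ≤ ρ := hub hX
    have hus2 : ρ ^ 2 < u + s := (Real.lt_sqrt hρ0.le).1 hun
    have hsu := Real.sqrt_pos.2 hu
    have hu2 : u = √u ^ 2 := (Real.sq_sqrt hu.le).symm
    have hcomm : T * heat H s * psiOp H m u = T * (psiOp H m u * heat H s) := by
      rw [mul_assoc]
      congr 1
      exact (commute_functionOf H _ _).eq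
    have e1 : (T * heat H s * psiOp H m u) f = (((u / ρ ^ 2) ^ m : ℝ) : ℂ) •
        (T * psiOp H m (ρ ^ 2)) (heat H (u + s - ρ ^ 2) f) := by
      rw [hcomm]
      have := psiOp_mul_heat hH m hu (by positivity : 0 < ρ ^ 2) hs (by linarith :
        0 < u + s - ρ ^ 2) (by ring) f
      change T (psiOp H m u (heat H s f)) = _
      rw [this, map_smul]
      rfl
    have hbb : BallBound (T * psiOp H m (ρ ^ 2)) ρ A := by
      have := hT.bound (ρ ^ 2) (by positivity) (fun _ => (Real.sqrt_sq hρ0.le).le)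
      rwa [Real.sqrt_sq hρ0.le] at this
    have hvol' : ∀ z : X, (√u / ρ) ^ d ≤ C₁ / v * μ.real (Metric.ball z √u) := by
      intro z
      have h4 := (hvx z).trans (h1 z z √u ρ hsu hule (by rw [dist_self]; positivity))
      have e4 : (√u / ρ) ^ d * (ρ / √u) ^ d = 1 := by
        rw [← Real.mul_rpow (by positivity) (by positivity),
          show √u / ρ * (ρ / √u) = 1 by field_simp, Real.one_rpow]
      have h5 := mul_le_mul_of_nonneg_left h4 (by positivity : 0 ≤ (√u / ρ) ^ d)
      rw [div_mul_eq_mul_div, le_div_iff₀ hv]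
      calc _ ≤ _ := h5
        _ = C₁ * μ.real (Metric.ball z √u) * ((√u / ρ) ^ d * (ρ / √u) ^ d) := by ring
        _ = _ := by rw [e4, mul_one]
    have hpow : (u / ρ ^ 2) ^ m ≤ C₁ / v * (√(μ.real (Metric.ball x √u)) *
        √(μ.real (Metric.ball y √u))) := by
      have h6 : (u / ρ ^ 2) ^ m ≤ (√u / ρ) ^ d := by
        rw [show u / ρ ^ 2 = (√u / ρ) ^ 2 by rw [div_pow, ← hu2], ← pow_mul, ← Real.rpow_natCast]
        refine Real.rpow_le_rpow_of_exponent_ge (by positivity) ((div_le_one hρ0).2 hule) ?_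
        push_cast
        linarith
      refine h6.trans ?_
      rw [← Real.sqrt_mul measureReal_nonneg]
      have hc : 0 ≤ C₁ / v := by positivity
      calc (√u / ρ) ^ d = √((√u / ρ) ^ d * (√u / ρ) ^ d) :=
            (Real.sqrt_mul_self (by positivity)).symm
        _ ≤ √((C₁ / v * μ.real (Metric.ball x √u)) * (C₁ / v * μ.real (Metric.ball y √u))) :=
            Real.sqrt_le_sqrt (mul_le_mul (hvol' x) (hvol' y) (by positivity) (by positivity))
        _ = √((C₁ / v) ^ 2 * (μ.real (Metric.ball x √u) * μ.real (Metric.ball y √u))) := by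
            congr 1; ring
        _ = _ := by rw [Real.sqrt_mul (by positivity), Real.sqrt_sq hc]
    refine (norm_cut_le _ _).trans ?_
    rw [e1, norm_smul, Complex.norm_real, Real.norm_of_nonneg (by positivity)]
    calc _ ≤ (C₁ / v * (√(μ.real (Metric.ball x √u)) * √(μ.real (Metric.ball y √u)))) *
          (C₃ * A * ‖f‖) := by
          refine mul_le_mul hpow ((h3 _ A hA hbb _).trans (mul_le_mul_of_nonneg_left
            (norm_heat_apply_le hH (by linarith) f) (by positivity))) (norm_nonneg _)
            (by positivity)
      _ = _ := by ring
  refine ⟨C₁ + C₂, by linarith, fun A T hA hT s hs => ⟨fun g => (hT.commute g).mul_right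
    (commute_functionOf H _ _), fun u hu hub x y f hf => ?_⟩⟩
  have hsu := Real.sqrt_pos.2 hu
  by_cases hus : BelowDiam X κ √(u + s)
  swap
  · refine (h2 A T hA hT u hu hub s hs hus x y f hf).trans ?_
    gcongr
    linarith
  have hw : 0 < u + s := by positivity
  have hsw := Real.sqrt_pos.2 hw
  have hle : √u ≤ √(u + s) := Real.sqrt_le_sqrt (by linarith)
  have e1 : (T * heat H s * psiOp H m u) f = (((u / (u + s)) ^ m : ℝ) : ℂ) •
      (T * psiOp H m (u + s)) f := by
    have hcomm : T * heat H s * psiOp H m u = T * (psiOp H m u * heat H s) := by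
      rw [mul_assoc]
      congr 1
      exact (commute_functionOf H _ _).eq
    rw [hcomm]
    change T (psiOp H m u (heat H s f)) = _
    rw [psiOp_mul_heat_eq hH m hu hs, map_smul]
    rfl
  have h3 := (norm_cut_mono (hE := measurableSet_ball (x := y) (ε := √u))
    (hF := measurableSet_ball) (Metric.ball_subset_ball hle) ((T * psiOp H m (u + s)) f)).trans
    (hT.bound (u + s) hw hus x y f (hf.mono (Metric.ball_subset_ball hle)))
  set q := √(u + s) / √u with hq
  have hq1 : 1 ≤ q := (one_le_div hsu).2 hle
  have hV : ∀ z : X, √(μ.real (Metric.ball z √(u + s))) ≤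
      √(C₁ * q ^ d) * √(μ.real (Metric.ball z √u)) := by
    intro z
    rw [← Real.sqrt_mul (by positivity)]
    exact Real.sqrt_le_sqrt (h1 z z √u _ hsu hle (by rw [dist_self]; positivity))
  -- In terms of `q = √(u+s)/√u ≥ 1` this is `q^d ≤ q^{2m}`.
  have hqm : (u / (u + s)) ^ m * q ^ d ≤ 1 := by
    have e2 : u / (u + s) = (q ^ 2)⁻¹ := by
      rw [hq, div_pow, Real.sq_sqrt hu.le, Real.sq_sqrt hw.le, inv_div]
    rw [e2, inv_pow, ← pow_mul, ← Real.rpow_natCast, inv_mul_le_iff₀ (by positivity), mul_one]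
    refine Real.rpow_le_rpow_of_exponent_le hq1 ?_
    push_cast
    linarith
  rw [e1, map_smul, norm_smul, Complex.norm_real, Real.norm_of_nonneg (by positivity)]
  calc _ ≤ (u / (u + s)) ^ m * (A * (√(C₁ * q ^ d) * √(μ.real (Metric.ball x √u))) *
        (√(C₁ * q ^ d) * √(μ.real (Metric.ball y √u))) * ‖f‖) := by
        refine mul_le_mul_of_nonneg_left (h3.trans ?_) (by positivity)
        have := hV x
        have := hV y
        gcongr
    _ = (u / (u + s)) ^ m * (√(C₁ * q ^ d) * √(C₁ * q ^ d)) * (A * √(μ.real (Metric.ball x √u)) *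
        √(μ.real (Metric.ball y √u)) * ‖f‖) := by ring
    _ = C₁ * ((u / (u + s)) ^ m * q ^ d) * (A * √(μ.real (Metric.ball x √u)) *
        √(μ.real (Metric.ball y √u)) * ‖f‖) := by
        rw [Real.mul_self_sqrt (by positivity)]; ring
    _ ≤ (C₁ + C₂) * (A * √(μ.real (Metric.ball x √u)) *
        √(μ.real (Metric.ball y √u)) * ‖f‖) := by
        refine mul_le_mul_of_nonneg_right ?_ (by positivity)
        nlinarith
    _ = _ := by ring

end BoundedSpace

section Atoms

variable {X : Type*} [MetricSpace X] [MeasurableSpace X] [BorelSpace X] {μ : Measure X} {d : ℝ}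
  {H : Lp ℂ 2 μ →ₗ.[ℂ] Lp ℂ 2 μ} {M : ℕ}

/-! ### Atoms in `L¹` -/

theorem iUnion_shell (x : X) {ρ : ℝ} (hρ : 0 < ρ) : ⋃ j, shell x ρ j = univ := by
  refine eq_univ_of_forall fun y => mem_iUnion.2 ?_
  have hex : ∃ n : ℕ, dist y x < 2 ^ (n + 1) * ρ := by
    obtain ⟨n, hn⟩ := pow_unbounded_of_one_lt (dist y x / ρ) (by norm_num : (1 : ℝ) < 2)
    refine ⟨n, ((div_lt_iff₀ hρ).1 hn).trans_le ?_⟩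
    gcongr
    · norm_num
    · omega
  classical
  refine ⟨Nat.find hex, Nat.find_spec hex, ?_⟩
  split_ifs with h
  · exact notMem_empty y
  · obtain ⟨j, hj⟩ := Nat.exists_eq_succ_of_ne_zero h
    rw [hj]
    exact Nat.find_min hex (by omega : j < Nat.find hex)

theorem lintegral_enorm_le_norm_cut {E : Set X} (hE : MeasurableSet E) (hEfin : μ E ≠ ∞)
    (f : Lp ℂ 2 μ) : ∫⁻ x in E, ‖f x‖ₑ ∂μ ≤ ENNReal.ofReal (√(μ.real E) * ‖cut hE f‖) := by
  have h1 := eLpNorm_le_eLpNorm_mul_rpow_measure_univ (μ := μ.restrict E) (p := 1) (q := 2)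
    (by norm_num) (Lp.aestronglyMeasurable f).restrict
  rw [eLpNorm_one_eq_lintegral_enorm, Measure.restrict_apply_univ] at h1
  refine h1.trans (le_of_eq ?_)
  rw [ENNReal.ofReal_mul (Real.sqrt_nonneg _), norm_cut, ENNReal.ofReal_toReal
    ((eLpNorm_restrict_le _ _ _ _).trans_lt (Lp.eLpNorm_lt_top f)).ne, mul_comm, Real.sqrt_eq_rpow,
    ← ENNReal.ofReal_rpow_of_nonneg measureReal_nonneg (by norm_num), ofReal_measureReal hEfin]
  norm_num

/-- On each shell Cauchy–Schwarz costs the square root of the volume, which the decay beats by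
`2^{-j}`. -/
theorem Doubling.exists_lintegral_le_of_shellDecay (hd : Doubling μ d) :
    ∃ C : ℝ, 0 < C ∧ ∀ (x : X) (ρ a : ℝ) (F : Lp ℂ 2 μ), 0 < ρ → ShellDecay d x ρ a F →
      ∫⁻ y, ‖F y‖ₑ ∂μ ≤ ENNReal.ofReal (C * √(μ.real (Metric.ball x ρ)) * a) := by
  obtain ⟨C, hC, h⟩ := hd.exists_shell_const
  refine ⟨C * 2, by positivity, fun x ρ a F hρ hF => ?_⟩
  have ha : 0 ≤ a := by simpa using (norm_nonneg _).trans (hF 0)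
  set c := C * √(μ.real (Metric.ball x ρ)) * a with hc
  have hc0 : 0 ≤ c := by positivity
  have hterm : ∀ j, ∫⁻ y in shell x ρ j, ‖F y‖ₑ ∂μ ≤ ENNReal.ofReal (c * (1 / 2) ^ j) := by
    intro j
    have hsub := shell_subset x ρ j
    have hfin : μ (shell x ρ j) ≠ ∞ :=
      ((measure_mono hsub).trans_lt (hd.ne_top _ _).lt_top).ne
    refine (lintegral_enorm_le_norm_cut (measurableSet_shell x ρ j) hfin F).trans
      (ENNReal.ofReal_le_ofReal ?_)
    calc _ ≤ √(μ.real (Metric.ball x (2 ^ (j + 1) * ρ))) *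
          (a * ((2 : ℝ) ^ (-(d / 2 + 1))) ^ j) :=
          mul_le_mul (Real.sqrt_le_sqrt (measureReal_mono hsub (hd.ne_top _ _))) (hF j)
            (norm_nonneg _) (Real.sqrt_nonneg _)
      _ = (√(μ.real (Metric.ball x (2 ^ (j + 1) * ρ))) * ((2 : ℝ) ^ (-(d / 2 + 1))) ^ j) * a := by
          ring
      _ ≤ (C * √(μ.real (Metric.ball x ρ)) * (1 / 2) ^ j) * a :=
          mul_le_mul_of_nonneg_right (h x ρ j hρ) ha
      _ = _ := by rw [hc]; ring
  calc ∫⁻ y, ‖F y‖ₑ ∂μ = ∫⁻ y in ⋃ j, shell x ρ j, ‖F y‖ₑ ∂μ := by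
        rw [iUnion_shell x hρ, Measure.restrict_univ]
    _ ≤ ∑' j, ∫⁻ y in shell x ρ j, ‖F y‖ₑ ∂μ := lintegral_iUnion_le _ _
    _ ≤ ∑' j : ℕ, ENNReal.ofReal (c * (1 / 2) ^ j) := ENNReal.tsum_le_tsum hterm
    _ = ENNReal.ofReal (∑' j : ℕ, c * (1 / 2) ^ j) :=
        (ENNReal.ofReal_tsum_of_nonneg (fun j => by positivity)
          (summable_geometric_two.mul_left c)).symm
    _ = _ := by
        rw [tsum_mul_left, tsum_geometric_two, hc]
        congr 1
        ring

/-- `‖B_Q f‖` decays away from `Q`. -/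
theorem DaviesGaffney.exists_shellDecay_ballOp (hDG : DaviesGaffney H) (hH : IsNonnegSelfAdjoint H)
    (d : ℝ) (M : ℕ) : ∃ C : ℝ, 0 < C ∧ ∀ (x : X) (r : ℝ) (f : Lp ℂ 2 μ), 0 < r →
      SupportedIn f (Metric.ball x r) → ShellDecay d x r (C * ‖f‖) (ballOp H M r f) := by
  obtain ⟨C, hC, h⟩ := hDG.exists_decay hH d 1 M
  set C' := (M + 1) * (2 ^ M * (C * M)) with hC'
  have hC'0 : 0 ≤ C' := by positivity
  refine ⟨1 + C', by positivity, fun x r f hr hf j => ?_⟩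
  rcases Nat.eq_zero_or_pos j with rfl | hj
  · rw [pow_zero, mul_one]
    refine (norm_cut_le _ _).trans ((norm_ballOp_apply_le hH M hr f).trans ?_)
    exact le_mul_of_one_le_left (norm_nonneg _) (by linarith)
  have hw := decayRate_pos d
  have hterm : ∀ i ∈ Finset.range (M + 1),
      ‖cut (measurableSet_shell x r j) ((heat H (r ^ 2) ^ i) f)‖ ≤
      C * M * decayRate d ^ j * ‖f‖ := by
    intro i hi
    have hiM : (i : ℝ) ≤ M := by exact_mod_cast Nat.lt_succ_iff.1 (Finset.mem_range.1 hi)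
    rcases Nat.eq_zero_or_pos i with rfl | hi0
    · rw [pow_zero, one_apply_eq_self, hf.cut_eq_zero _ (disjoint_ball_shell x hr hj), norm_zero]
      positivity
    · have hi1 : (0 : ℝ) < i := by exact_mod_cast hi0
      have h1 := h x r r (i * r ^ 2) j f hr le_rfl (by positivity) (by gcongr) hj hf
      rw [heat_pow hH (by positivity) hi0]
      rw [pow_one, mul_div_cancel_right₀ _ (by positivity : r ^ 2 ≠ 0)] at h1
      refine h1.trans ?_
      gcongr
  rw [ballOp_eq_sum, sum_apply, map_sum]
  refine (norm_sum_le _ _).trans ?_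
  refine (Finset.sum_le_sum fun i hi => ?_ : _ ≤ ∑ i ∈ Finset.range (M + 1),
    2 ^ M * (C * M * decayRate d ^ j * ‖f‖)).trans ?_
  · rw [smul_apply, map_smul, norm_smul]
    exact mul_le_mul (norm_coeff_le M i) (hterm i hi) (norm_nonneg _) (by positivity)
  · rw [Finset.sum_const, Finset.card_range, nsmul_eq_mul]
    push_cast
    calc _ = C' * ‖f‖ * decayRate d ^ j := by rw [hC']; ring
      _ ≤ _ := by
        gcongr
        linarith

theorem sqrt_mul_norm_le_one (hd : Doubling μ d) {x : X} {r : ℝ} (hr : 0 < r) {f : Lp ℂ 2 μ}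
    (hf : ‖f‖ ≤ μ.real (Metric.ball x r) ^ (-(1 / 2) : ℝ)) :
    √(μ.real (Metric.ball x r)) * ‖f‖ ≤ 1 := by
  have hV := hd.pos x hr
  rw [Real.rpow_neg hV.le, ← Real.sqrt_eq_rpow] at hf
  have hs := Real.sqrt_pos.2 hV
  calc _ ≤ √(μ.real (Metric.ball x r)) * (√(μ.real (Metric.ball x r)))⁻¹ := by gcongr
    _ = 1 := mul_inv_cancel₀ hs.ne'

theorem exists_lintegral_atom_le (hd : Doubling μ d) (hDG : DaviesGaffney H)
    (hH : IsNonnegSelfAdjoint H) (M : ℕ) :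
    ∃ C : ℝ, 0 < C ∧ ∀ a : Lp ℂ 2 μ, IsAtom H M a → ∫⁻ y, ‖a y‖ₑ ∂μ ≤ ENNReal.ofReal C := by
  obtain ⟨C₁, hC₁, h1⟩ := hd.exists_lintegral_le_of_shellDecay
  obtain ⟨C₂, hC₂, h2⟩ := hDG.exists_shellDecay_ballOp hH d M
  refine ⟨C₁ * C₂, by positivity, ?_⟩
  rintro a ⟨x, r, f, hr, hs, hf, rfl⟩
  refine (h1 x r _ _ hr (h2 x r f hr hs)).trans (ENNReal.ofReal_le_ofReal ?_)
  have := sqrt_mul_norm_le_one hd hr hf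
  calc _ = C₁ * C₂ * (√(μ.real (Metric.ball x r)) * ‖f‖) := by ring
    _ ≤ C₁ * C₂ * 1 := by gcongr
    _ = _ := mul_one _

/-- The partial sums of an atomic decomposition. -/
def partialSum (l : ℕ → ℝ) (a : ℕ → Lp ℂ 2 μ) (n : ℕ) : Lp ℂ 2 μ :=
  ∑ i ∈ Finset.range n, (l i : ℂ) • a i

theorem coeFn_partialSum (l : ℕ → ℝ) (a : ℕ → Lp ℂ 2 μ) :
    ∀ᵐ x ∂μ, ∀ n, partialSum l a n x = ∑ i ∈ Finset.range n, (l i : ℂ) * a i x := by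
  refine ae_all_iff.2 fun n => ?_
  induction n with
  | zero =>
    filter_upwards [Lp.coeFn_zero ℂ 2 μ] with x hx
    simpa [partialSum] using hx
  | succ n ih =>
    have e : partialSum l a (n + 1) = partialSum l a n + (l n : ℂ) • a n :=
      Finset.sum_range_succ _ _
    filter_upwards [ih, Lp.coeFn_add (partialSum l a n) ((l n : ℂ) • a n),
      Lp.coeFn_smul (l n : ℂ) (a n)] with x h1 h2 h3
    rw [e, h2, Pi.add_apply, h1, h3, Finset.sum_range_succ, Pi.smul_apply, smul_eq_mul]

/-- By almost everywhere convergence the remainder is dominated pointwise by the absolute tail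
series. Since atoms are uniformly bounded in `L¹`, this turns pointwise convergence into `L¹`
convergence. -/
theorem lintegral_sub_partialSum_le {C : ℝ}
    (hC : ∀ a : Lp ℂ 2 μ, IsAtom H M a → ∫⁻ y, ‖a y‖ₑ ∂μ ≤ ENNReal.ofReal C) {f : Lp ℂ 2 μ}
    {l : ℕ → ℝ} {a : ℕ → Lp ℂ 2 μ} (h : IsAtomicDecomposition H M (f : X →ₘ[μ] ℂ) l a) (n : ℕ) :
    ∫⁻ y, ‖(f - partialSum l a n : Lp ℂ 2 μ) y‖ₑ ∂μ ≤
      (∑' i, ENNReal.ofReal |l (i + n)|) * ENNReal.ofReal C := by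
  have hpt : ∀ᵐ y ∂μ, ‖(f - partialSum l a n : Lp ℂ 2 μ) y‖ₑ ≤
      ∑' i, ENNReal.ofReal |l (i + n)| * ‖a (i + n) y‖ₑ := by
    filter_upwards [h.ae_tendsto, coeFn_partialSum l a, Lp.coeFn_sub f (partialSum l a n)]
      with y h1 h2 h3
    rw [h3, Pi.sub_apply, h2]
    have h4 := ((h1.comp (tendsto_add_atTop_nat n)).sub_const
      (∑ i ∈ Finset.range n, (l i : ℂ) * a i y)).enorm
    refine le_of_tendsto h4 (Eventually.of_forall fun N => ?_)
    simp only [Function.comp_apply]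
    rw [add_comm N n, Finset.sum_range_add, add_sub_cancel_left]
    refine (enorm_sum_le _ _).trans ((Finset.sum_le_sum fun i _ => ?_).trans
      (ENNReal.sum_le_tsum (Finset.range N)))
    rw [enorm_mul, add_comm n i, ← ofReal_norm (l (i + n) : ℂ), Complex.norm_real,
      Real.norm_eq_abs]
  refine (lintegral_mono_ae hpt).trans ?_
  rw [lintegral_tsum fun i => ((Lp.aestronglyMeasurable (a (i + n))).enorm).const_mul _,
    ← ENNReal.tsum_mul_right]
  refine ENNReal.tsum_le_tsum fun i => ?_
  rw [lintegral_const_mul'' _ (Lp.aestronglyMeasurable (a (i + n))).enorm]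
  gcongr
  exact hC _ (h.atom _)

/-- If `f ∈ L²` has an atomic decomposition, then the partial sums converge to `f` after
application of a heat operator. -/
theorem IsAtomicDecomposition.tendsto_heat [Nontrivial X] [SFinite μ] (hd : Doubling μ d)
    (hvol : LowerVolumeBound μ) (hDG : DaviesGaffney H) (hDUE : DUE H) (hH : IsNonnegSelfAdjoint H)
    {f : Lp ℂ 2 μ} {l : ℕ → ℝ} {a : ℕ → Lp ℂ 2 μ}
    (h : IsAtomicDecomposition H M (f : X →ₘ[μ] ℂ) l a) {s : ℝ} (hs : 0 < s) :
    Tendsto (fun n => heat H s (partialSum l a n)) atTop (𝓝 (heat H s f)) := by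
  obtain ⟨C, hC, hat⟩ := exists_lintegral_atom_le hd hDG hH M
  obtain ⟨c, hc, hheat⟩ := hDUE.exists_norm_heat_le_integral hd hvol hs
  have hsum : ∀ n, ∑' i, ENNReal.ofReal |l (i + n)| = ENNReal.ofReal (∑' i, |l (i + n)|) :=
    fun n => (ENNReal.ofReal_tsum_of_nonneg (fun i => abs_nonneg _)
      ((summable_nat_add_iff n).2 h.summable)).symm
  have h1 : ∀ n, ‖heat H s (partialSum l a n) - heat H s f‖ ≤
      c * ((∑' i, |l (i + n)|) * C) := by
    intro n
    have h2 := lintegral_sub_partialSum_le hat h n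
    have ht : 0 ≤ ∑' i, |l (i + n)| := tsum_nonneg fun i => abs_nonneg _
    rw [hsum, ← ENNReal.ofReal_mul ht] at h2
    have hint : Integrable (f - partialSum l a n : Lp ℂ 2 μ) μ :=
      ⟨Lp.aestronglyMeasurable _, h2.trans_lt ENNReal.ofReal_lt_top⟩
    rw [← norm_neg, neg_sub, ← map_sub]
    refine (hheat _ hint).trans (mul_le_mul_of_nonneg_left ?_ hc)
    rw [integral_norm_eq_lintegral_enorm hint.1]
    exact ENNReal.toReal_le_of_le_ofReal (by positivity) h2
  rw [tendsto_iff_norm_sub_tendsto_zero]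
  refine squeeze_zero (fun n => norm_nonneg _) h1 ?_
  have h3 := ((tendsto_sum_nat_add fun i => |l i|).mul_const C).const_mul c
  simpa using h3

theorem tendsto_heat_zero (hH : IsNonnegSelfAdjoint H) (f : Lp ℂ 2 μ) :
    Tendsto (fun s => heat H s f) (𝓝[>] 0) (𝓝 f) := by
  have := tendsto_functionOf_nhdsGT_zero hH (vanishesAtTop_exp (t := 1) one_pos) f
  simpa [heat] using this

/-! ### Estimates on `H¹ ∩ L²` -/

/-- The bilinear estimate `|⟪B_Q' g, T B_Q f⟫| ≤ K μ(Q)^{1/2} μ(Q')^{1/2} ‖f‖ ‖g‖`. -/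
def AtomBound (H : Lp ℂ 2 μ →ₗ.[ℂ] Lp ℂ 2 μ) (M : ℕ) (K : ℝ) (T : Lp ℂ 2 μ →L[ℂ] Lp ℂ 2 μ) :
    Prop :=
  ∀ (x y : X) (r r' : ℝ) (f g : Lp ℂ 2 μ), 0 < r → 0 < r' →
    SupportedIn f (Metric.ball x r) → SupportedIn g (Metric.ball y r') →
    ‖⟪ballOp H M r' g, T (ballOp H M r f)⟫_ℂ‖ ≤
      K * √(μ.real (Metric.ball x r)) * √(μ.real (Metric.ball y r')) * (‖f‖ * ‖g‖)

theorem AtomBound.norm_inner_atom_le {K : ℝ} {T : Lp ℂ 2 μ →L[ℂ] Lp ℂ 2 μ} (hK : 0 ≤ K)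
    (hd : Doubling μ d) (h : AtomBound H M K T) {a : Lp ℂ 2 μ} (ha : IsAtom H M a) {y : X} {r' : ℝ}
    (hr' : 0 < r') {g : Lp ℂ 2 μ} (hg : SupportedIn g (Metric.ball y r')) :
    ‖⟪ballOp H M r' g, T a⟫_ℂ‖ ≤ K * (√(μ.real (Metric.ball y r')) * ‖g‖) := by
  obtain ⟨x, r, f, hr, hs, hf, rfl⟩ := ha
  refine (h x y r r' f g hr hr' hs hg).trans ?_
  have := sqrt_mul_norm_le_one hd hr hf
  calc _ = K * (√(μ.real (Metric.ball y r')) * ‖g‖) * (√(μ.real (Metric.ball x r)) * ‖f‖) := by ring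
    _ ≤ K * (√(μ.real (Metric.ball y r')) * ‖g‖) * 1 := by gcongr
    _ = _ := mul_one _

theorem norm_map_partialSum_le {E : Type*} [SeminormedAddCommGroup E] [NormedSpace ℂ E]
    (φ : Lp ℂ 2 μ →ₗ[ℂ] E) {l : ℕ → ℝ}
    {a : ℕ → Lp ℂ 2 μ} (hl : Summable fun i => |l i|) {K : ℝ} (hK : 0 ≤ K)
    (h : ∀ i, ‖φ (a i)‖ ≤ K) (n : ℕ) : ‖φ (partialSum l a n)‖ ≤ K * ∑' i, |l i| := by
  rw [partialSum, map_sum, mul_comm]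
  refine (norm_sum_le _ _).trans ?_
  refine (Finset.sum_le_sum fun i _ => ?_ : _ ≤ ∑ i ∈ Finset.range n, |l i| * K).trans ?_
  · rw [map_smul, norm_smul, Complex.norm_real, Real.norm_eq_abs]
    exact mul_le_mul_of_nonneg_left (h i) (abs_nonneg _)
  · rw [← Finset.sum_mul]
    exact mul_le_mul_of_nonneg_right (hl.sum_le_tsum _ fun i _ => abs_nonneg _) hK

section Bounds

variable [Nontrivial X] [SFinite μ] (hd : Doubling μ d)
    (hvol : LowerVolumeBound μ) (hDG : DaviesGaffney H) (hDUE : DUE H) (hH : IsNonnegSelfAdjoint H)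
    {K : ℝ} (hK : 0 ≤ K) {T : Lp ℂ 2 μ →L[ℂ] Lp ℂ 2 μ}
    (hT : ∀ s, 0 < s → AtomBound H M K (T * heat H s)) {f : Lp ℂ 2 μ} {l : ℕ → ℝ} {a : ℕ → Lp ℂ 2 μ}
    (h : IsAtomicDecomposition H M (f : X →ₘ[μ] ℂ) l a)

include hd hvol hDG hDUE hH hK hT h

/-- For `s > 0` the estimate on atoms may be summed, since `e^{-sH}` of the partial sums converges
in `L²`. The resulting bound does not depend on `s`, and `e^{-sH} f → f`. -/
theorem norm_inner_ballOp_le_of_decomposition {y : X} {r' : ℝ} (hr' : 0 < r') {g : Lp ℂ 2 μ}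
    (hg : SupportedIn g (Metric.ball y r')) :
    ‖⟪ballOp H M r' g, T f⟫_ℂ‖ ≤ K * (√(μ.real (Metric.ball y r')) * ‖g‖) * ∑' i, |l i| := by
  have h1 : ∀ s, 0 < s → ‖⟪ballOp H M r' g, T (heat H s f)⟫_ℂ‖ ≤
      K * (√(μ.real (Metric.ball y r')) * ‖g‖) * ∑' i, |l i| := by
    intro s hs
    have h2 := ((innerSL ℂ (ballOp H M r' g) ∘L T).continuous.tendsto _).comp
      (h.tendsto_heat hd hvol hDG hDUE hH hs)
    exact le_of_tendsto h2.norm (Eventually.of_forall fun n => norm_map_partialSum_le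
      ((innerSL ℂ (ballOp H M r' g) ∘L T ∘L heat H s : Lp ℂ 2 μ →L[ℂ] ℂ) : Lp ℂ 2 μ →ₗ[ℂ] ℂ)
      h.summable (by positivity)
      (fun i => (hT s hs).norm_inner_atom_le hK hd (h.atom i) hr' hg) n)
  have h3 := ((innerSL ℂ (ballOp H M r' g) ∘L T).continuous.tendsto _).comp
    (tendsto_heat_zero hH f)
  exact le_of_tendsto h3.norm (eventually_nhdsWithin_of_forall fun s hs => h1 s hs)

/-- Here the second argument is regularised: commutation moves `e^{-sH}` onto `T`, and the preceding
bound is applied to `T e^{-sH}`. Its own regularisations `T e^{-(s+t)H}` are covered by the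
hypothesis. -/
theorem norm_inner_le_of_decomposition (hcomm : ∀ s, Commute (heat H s) T) {g : Lp ℂ 2 μ}
    {l' : ℕ → ℝ} {b : ℕ → Lp ℂ 2 μ} (h' : IsAtomicDecomposition H M (g : X →ₘ[μ] ℂ) l' b) :
    ‖⟪T f, g⟫_ℂ‖ ≤ K * (∑' i, |l i|) * ∑' i, |l' i| := by
  have hl : 0 ≤ ∑' i, |l i| := tsum_nonneg fun i => abs_nonneg _
  have h1 : ∀ s, 0 < s → ‖⟪T f, heat H s g⟫_ℂ‖ ≤ K * (∑' i, |l i|) * ∑' i, |l' i| := by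
    intro s hs
    have hTs : ∀ t, 0 < t → AtomBound H M K (T * heat H s * heat H t) := fun t ht => by
      rw [mul_assoc, ← heat_add hH hs ht]
      exact hT _ (by positivity)
    have h2 := ((innerSL ℂ (T f)).continuous.tendsto _).comp (h'.tendsto_heat hd hvol hDG hDUE hH hs)
    refine le_of_tendsto h2.norm (Eventually.of_forall fun n => norm_map_partialSum_le
      ((innerSL ℂ (T f) ∘L heat H s : Lp ℂ 2 μ →L[ℂ] ℂ) : Lp ℂ 2 μ →ₗ[ℂ] ℂ)
      h'.summable (by positivity) (fun i => ?_) n)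
    obtain ⟨y, r', w, hr', hw, hwn, hb⟩ := h'.atom i
    have h3 := norm_inner_ballOp_le_of_decomposition hd hvol hDG hDUE hH hK hTs h hr' hw
    have e : ⟪T f, heat H s (b i)⟫_ℂ = ⟪(T * heat H s) f, ballOp H M r' w⟫_ℂ := by
      rw [← inner_heat, ← (hcomm s).eq, hb]
      rfl
    change ‖⟪T f, heat H s (b i)⟫_ℂ‖ ≤ _
    rw [e, norm_inner_symm]
    refine h3.trans (mul_le_mul_of_nonneg_right ?_ hl)
    exact mul_le_of_le_one_right hK (sqrt_mul_norm_le_one hd hr' hwn)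
  have h3 := ((innerSL ℂ (T f)).continuous.tendsto _).comp (tendsto_heat_zero hH g)
  exact le_of_tendsto h3.norm (eventually_nhdsWithin_of_forall fun s hs => h1 s hs)

end Bounds

/-! ### The `BMO` norm -/

theorem isBallOpOf_ballOp (r : ℝ) (f : Lp ℂ 2 μ) :
    IsBallOpOf H M r (f : X →ₘ[μ] ℂ) (ballOp H M r f : Lp ℂ 2 μ) := by
  intro φ _
  refine ⟨L2.integrable_inner φ (ballOp H M r f), L2.integrable_inner (ballOp H M r φ) f, ?_⟩
  have h := inner_ballOp H M r φ f
  rw [L2.inner_def, L2.inner_def] at h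
  exact h.symm

/-- Testing with `g = 1_Q B_Q u` and using that `B_Q` is self-adjoint, the pairing is `‖1_Q B_Q
u‖²`. -/
theorem bmoNorm_le_of_inner_le (hd : Doubling μ d) {K : ℝ} (hK : 0 ≤ K) {u : Lp ℂ 2 μ}
    (h : ∀ (x : X) (r : ℝ) (g : Lp ℂ 2 μ), 0 < r → SupportedIn g (Metric.ball x r) →
      ‖⟪ballOp H M r g, u⟫_ℂ‖ ≤ K * (√(μ.real (Metric.ball x r)) * ‖g‖)) :
    bmoNorm H M (u : X →ₘ[μ] ℂ) ≤ ENNReal.ofReal K := by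
  refine iSup_le fun x => iSup_le fun r => iSup_le fun hr =>
    iInf₂_le_of_le _ (isBallOpOf_ballOp r u) ?_
  set F := ballOp H M r u with hF
  have hV := hd.pos x hr
  set c := cut (measurableSet_ball (x := x) (ε := r)) F with hc
  have h1 : ‖c‖ ≤ K * √(μ.real (Metric.ball x r)) := by
    have h2 := h x r c hr (supportedIn_cut _ F)
    rw [inner_ballOp, ← hF, hc, ← inner_cut_cut, inner_self_eq_norm_sq_to_K, ← hc] at h2
    rw [norm_pow, RCLike.norm_ofReal, abs_of_nonneg (norm_nonneg _)] at h2
    rcases (norm_nonneg c).eq_or_lt with h0 | h0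
    · rw [← h0]; positivity
    · refine le_of_mul_le_mul_right (a := ‖c‖) ?_ h0
      linarith
  rw [quadMean]
  have h3 : eLpNorm F 2 (μ.restrict (Metric.ball x r)) = ENNReal.ofReal ‖c‖ := by
    rw [hc, norm_cut, ENNReal.ofReal_toReal
      ((eLpNorm_restrict_le _ _ _ _).trans_lt (Lp.eLpNorm_lt_top F)).ne]
  have h4 : μ (Metric.ball x r) ^ (1 / 2 : ℝ) = ENNReal.ofReal √(μ.real (Metric.ball x r)) := by
    rw [Real.sqrt_eq_rpow, ← ENNReal.ofReal_rpow_of_nonneg measureReal_nonneg (by norm_num),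
      ofReal_measureReal (hd.ne_top x r)]
  rw [h3, h4, ← ENNReal.ofReal_div_of_pos (Real.sqrt_pos.2 hV)]
  exact ENNReal.ofReal_le_ofReal (div_le_of_le_mul₀ (Real.sqrt_nonneg _) hK h1)

end Atoms

/-! ### Extension of semilinear maps by density -/

section DenseExtension

variable {E F W : Type*} [SeminormedAddCommGroup E] [NormedSpace ℂ E] [AddCommGroup W] [Module ℂ W]

/-- The extension of a bounded semilinear map from a dense subspace. -/
theorem exists_extension_of_dense [SeminormedAddCommGroup F] [NormedSpace ℂ F] [CompleteSpace F]
    [T0Space F] {σ : ℂ →+* ℂ} {e : W →ₗ[ℂ] E} (he : DenseRange e)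
    (f : W →ₛₗ[σ] F) {K : ℝ} (hK : 0 ≤ K) (hf : ∀ k, ‖f k‖ ≤ K * ‖e k‖) :
    ∃ S : E →SL[σ] F, (∀ k, S (e k) = f k) ∧ ‖S‖ ≤ K := by
  -- `F` is a separated seminormed space, so its seminorm is a norm; limits are then unique.
  let i1 : NormedAddCommGroup F := NormedAddCommGroup.ofSeparation fun x hx =>
    (Metric.inseparable_iff.2 (by rwa [dist_zero_right])).eq
  let i2 : NormedSpace ℂ F := { norm_smul_le := norm_smul_le }
  exact ⟨f.extendOfNorm e, LinearMap.extendOfNorm_eq he ⟨K, hf⟩,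
    LinearMap.opNorm_extendOfNorm_le he hK hf⟩

theorem strongDual_ext_of_denseRange {e : W →ₗ[ℂ] E} (he : DenseRange e) {φ ψ : StrongDual ℂ E}
    (h : ∀ k, φ (e k) = ψ (e k)) : φ = ψ :=
  ContinuousLinearMap.coeFn_injective (he.equalizer φ.continuous ψ.continuous (funext h))

/-- A bounded sesquilinear form on a dense subspace extends to an operator into the dual. -/
theorem exists_sesquilinear_extension (e : W →ₗ[ℂ] E) (he : DenseRange e)
    (u : W →ₗ⋆[ℂ] W →ₗ[ℂ] ℂ) {K : ℝ} (hK : 0 ≤ K) (hu : ∀ k k', ‖u k k'‖ ≤ K * ‖e k‖ * ‖e k'‖) :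
    ∃ D : E →L⋆[ℂ] StrongDual ℂ E, (∀ k k', D (e k) (e k') = u k k') ∧ ‖D‖ ≤ K := by
  have h1 := fun k => exists_extension_of_dense he (u k) (mul_nonneg hK (norm_nonneg _)) (hu k)
  choose v hv hvn using h1
  let G : W →ₗ⋆[ℂ] StrongDual ℂ E :=
    { toFun := v
      map_add' := fun k₁ k₂ => strongDual_ext_of_denseRange he fun k => by
        rw [add_apply, hv, hv, hv, map_add, LinearMap.add_apply]
      map_smul' := fun c k₁ => strongDual_ext_of_denseRange he fun k => by
        rw [smul_apply, hv, hv, LinearMap.map_smulₛₗ, LinearMap.smul_apply] }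
  obtain ⟨D, hD, hDn⟩ := exists_extension_of_dense he G hK hvn
  exact ⟨D, fun k k' => by rw [hD]; exact hv k k', hDn⟩

end DenseExtension

section Extensions

variable {X : Type*} [MetricSpace X] [MeasurableSpace X] [BorelSpace X] {μ : Measure X} {d : ℝ}
  {H : Lp ℂ 2 μ →ₗ.[ℂ] Lp ℂ 2 μ} {M : ℕ} [Nonempty X]

/-! ### Extension from `H¹ ∩ L²` -/

variable (H M) in
/-- The subspace `H¹ ∩ L²` of `H¹`. -/
def hardyL2 : Submodule ℂ (Hardy H M) where
  carrier := {h | h.toFun ∈ Lp ℂ 2 μ}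
  zero_mem' := zero_mem (Lp ℂ 2 μ)
  add_mem' {h₁ h₂} hh₁ hh₂ :=
    show h₁.toFun + h₂.toFun ∈ Lp ℂ 2 μ from add_mem hh₁ hh₂
  smul_mem' c h hh := Lp.const_smul_mem_Lp c ⟨h.toFun, hh⟩

variable (H M) in
/-- The elements of `H¹ ∩ L²` as elements of `L²`. -/
def toL2 : hardyL2 H M →ₗ[ℂ] Lp ℂ 2 μ where
  toFun h := ⟨h.1.toFun, h.2⟩
  map_add' _ _ := rfl
  map_smul' _ _ := rfl

theorem exists_toL2_eq {h : Hardy H M} {f : Lp ℂ 2 μ} (hf : h.toFun = (f : X →ₘ[μ] ℂ)) :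
    ∃ k : hardyL2 H M, (hardyL2 H M).subtype k = h ∧ toL2 H M k = f :=
  ⟨⟨h, by change h.toFun ∈ Lp ℂ 2 μ; rw [hf]; exact f.2⟩, rfl, Subtype.ext hf⟩

theorem IsAtomicDecomposition.sub_partialSum {h : X →ₘ[μ] ℂ} {l : ℕ → ℝ} {a : ℕ → Lp ℂ 2 μ}
    (hd : IsAtomicDecomposition H M h l a) (n : ℕ) :
    IsAtomicDecomposition H M (h - (partialSum l a n : Lp ℂ 2 μ)) (fun i => l (i + n))
      (fun i => a (i + n)) := by
  refine ⟨fun i => hd.atom _, (summable_nat_add_iff n).2 hd.summable, ?_⟩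
  filter_upwards [hd.ae_tendsto, coeFn_partialSum l a,
    AEEqFun.coeFn_sub h (partialSum l a n : X →ₘ[μ] ℂ)] with x h1 h2 h3
  rw [h3, Pi.sub_apply]
  have h4 := (h1.comp (tendsto_add_atTop_nat n)).sub_const (partialSum l a n x)
  refine h4.congr fun N => ?_
  simp only [Function.comp_apply]
  rw [h2, add_comm N n, Finset.sum_range_add, add_sub_cancel_left]
  simp only [add_comm n]

/-- Partial sums of an atomic decomposition lie in `L²`. The remainder is decomposed by the tail, so
its Hardy norm is at most the tail of a convergent series. -/
theorem denseRange_hardyL2 : DenseRange (hardyL2 H M).subtype := by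
  intro h
  obtain ⟨l, a, hd⟩ := Subtype.property (p := (· ∈ hardySubmodule H M)) h
  have hrest : ∀ n, h.toFun - (partialSum l a n : X →ₘ[μ] ℂ) ∈ hardySubmodule H M := fun n =>
    ⟨_, _, hd.sub_partialSum n⟩
  let R : ℕ → Hardy H M := fun n => (⟨_, hrest n⟩ : hardySubmodule H M)
  have hR : ∀ n, ‖R n‖ ≤ ∑' i, |l (i + n)| := fun n =>
    csInf_le (atomicCosts_bddBelow _) ⟨_, _, hd.sub_partialSum n, rfl⟩
  have hR0 : Tendsto R atTop (𝓝 0) := squeeze_zero_norm hR (tendsto_sum_nat_add fun i => |l i|)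
  have hlim : Tendsto (fun n => h - R n) atTop (𝓝 h) := by
    simpa using hR0.const_sub h
  refine mem_closure_of_tendsto hlim (Eventually.of_forall fun n => ?_)
  have e : (h - R n).toFun = (partialSum l a n : X →ₘ[μ] ℂ) := sub_sub_cancel _ _
  obtain ⟨k, hk, -⟩ := exists_toL2_eq e
  exact ⟨k, hk⟩

theorem norm_le_of_forall_decomposition {h : Hardy H M} {c K : ℝ} (hK : 0 ≤ K)
    (hc : ∀ l a, IsAtomicDecomposition H M h.toFun l a → c ≤ K * ∑' i, |l i|) : c ≤ K * ‖h‖ := by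
  rcases hK.eq_or_lt with rfl | hK
  · obtain ⟨l, a, hd⟩ := Subtype.property (p := (· ∈ hardySubmodule H M)) h
    have := hc l a hd
    rwa [zero_mul] at this ⊢
  rw [← div_le_iff₀' hK]
  refine le_csInf h.costs_nonempty ?_
  rintro _ ⟨l, a, hd, rfl⟩
  rw [div_le_iff₀' hK]
  exact hc l a hd

theorem exists_extendsToBMO {T : Lp ℂ 2 μ →L[ℂ] Lp ℂ 2 μ} {K : ℝ} (hK : 0 ≤ K)
    (h : ∀ k : hardyL2 H M,
      bmoNorm H M (T (toL2 H M k) : X →ₘ[μ] ℂ) ≤ ENNReal.ofReal (K * ‖(k : Hardy H M)‖)) :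
    ∃ S : Hardy H M →L[ℂ] BMO H M, ExtendsToBMO T S ∧ ‖S‖ ≤ K := by
  let P : hardyL2 H M →ₗ[ℂ] PreBMO H M :=
    { toFun := fun k => (⟨T (toL2 H M k), ⟨0, zero_mem _, _, (T (toL2 H M k)).2,
          (zero_add _).symm⟩, (h k).trans_lt ENNReal.ofReal_lt_top⟩ : bmoSubmodule H M)
      map_add' := fun k₁ k₂ => Subtype.ext
        (congrArg (Subtype.val (p := (· ∈ Lp ℂ 2 μ))) (map_add (T.toLinearMap ∘ₗ toL2 H M) k₁ k₂))
      map_smul' := fun c k => Subtype.ext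
        (congrArg (Subtype.val (p := (· ∈ Lp ℂ 2 μ))) (map_smul (T.toLinearMap ∘ₗ toL2 H M) c k)) }
  let Q : hardyL2 H M →ₗ[ℂ] BMO H M :=
    (UniformSpace.Completion.toComplL (𝕜 := ℂ) (E := PreBMO H M)).toLinearMap ∘ₗ P
  have hQ : ∀ k, ‖Q k‖ ≤ K * ‖(hardyL2 H M).subtype k‖ := by
    intro k
    have e : ‖Q k‖ = ‖P k‖ := UniformSpace.Completion.norm_coe _
    rw [e]
    exact ENNReal.toReal_le_of_le_ofReal (by positivity) (h k)
  obtain ⟨S, hS, hSn⟩ := exists_extension_of_dense denseRange_hardyL2 Q hK hQ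
  refine ⟨S, fun k f hf => ?_, hSn⟩
  obtain ⟨k, rfl, rfl⟩ := exists_toL2_eq hf
  exact ⟨P k, rfl, hS k⟩

theorem exists_extendsToDual {T : Lp ℂ 2 μ →L[ℂ] Lp ℂ 2 μ} {K : ℝ} (hK : 0 ≤ K)
    (h : ∀ k k' : hardyL2 H M, ‖⟪T (toL2 H M k), toL2 H M k'⟫_ℂ‖ ≤
      K * ‖(k : Hardy H M)‖ * ‖(k' : Hardy H M)‖) :
    ∃ D : Hardy H M →L⋆[ℂ] StrongDual ℂ (Hardy H M), ExtendsToDual T D ∧ ‖D‖ ≤ K := by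
  obtain ⟨D, hD, hDn⟩ := exists_sesquilinear_extension (hardyL2 H M).subtype denseRange_hardyL2
    (((innerₛₗ ℂ).comp (T.toLinearMap ∘ₗ toL2 H M)).compl₂ (toL2 H M)) hK h
  refine ⟨D, fun k k' f f' hf hf' => ?_, hDn⟩
  obtain ⟨k, rfl, rfl⟩ := exists_toL2_eq hf
  obtain ⟨k', rfl, rfl⟩ := exists_toL2_eq hf'
  exact hD k k'

end Extensions

/-! ### The extensions and the theorem -/

theorem exists_extensions {X : Type*} [MetricSpace X] [Nontrivial X] [MeasurableSpace X]
    [BorelSpace X] {μ : Measure X} [SFinite μ] {d : ℝ} (hd : Doubling μ d)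
    (hvol : LowerVolumeBound μ) {H : Lp ℂ 2 μ →ₗ.[ℂ] Lp ℂ 2 μ} {M : ℕ} (hDG : DaviesGaffney H)
    (hDUE : DUE H) (hH : IsNonnegSelfAdjoint H) {K : ℝ} (hK : 0 ≤ K)
    {T : Lp ℂ 2 μ →L[ℂ] Lp ℂ 2 μ} (hT : ∀ s, 0 < s → AtomBound H M K (T * heat H s))
    (hcomm : ∀ s, Commute (heat H s) T) :
    (∃ S : Hardy H M →L[ℂ] BMO H M, ExtendsToBMO T S ∧ ‖S‖ ≤ K) ∧
    ∃ D : Hardy H M →L⋆[ℂ] StrongDual ℂ (Hardy H M), ExtendsToDual T D ∧ ‖D‖ ≤ K := by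
  refine ⟨exists_extendsToBMO hK fun k => ?_, exists_extendsToDual hK fun k k' => ?_⟩
  · refine bmoNorm_le_of_inner_le hd (by positivity) fun x r g hr hg => ?_
    rw [mul_right_comm]
    refine norm_le_of_forall_decomposition (by positivity) fun l a hla => ?_
    exact norm_inner_ballOp_le_of_decomposition hd hvol hDG hDUE hH hK hT
      (f := toL2 H M k) hla hr hg
  · refine norm_le_of_forall_decomposition (by positivity) fun l' b hlb => ?_
    rw [mul_right_comm]
    refine norm_le_of_forall_decomposition
      (mul_nonneg hK (tsum_nonneg fun i => abs_nonneg _)) fun l a hla => ?_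
    rw [mul_right_comm]
    exact norm_inner_le_of_decomposition hd hvol hDG hDUE hH hK hT
      (f := toL2 H M k) hla hcomm (g := toL2 H M k') hlb

end HardyBMO

end

theorem mainTheorem5 {X : Type*} [MetricSpace X] [Nontrivial X] [MeasurableSpace X] [BorelSpace X]
    (μ : Measure X) [SigmaFinite μ]
    (d : ℝ) (hd : 0 < d) (hdoubling : HardyBMO.Doubling μ d)
    (hvolume : HardyBMO.LowerVolumeBound μ)
    (H : Lp ℂ 2 μ →ₗ.[ℂ] Lp ℂ 2 μ) (hH : HardyBMO.IsNonnegSelfAdjoint H)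
    (hDG : HardyBMO.DaviesGaffney H) (hDUE : HardyBMO.DUE H)
    (M : ℕ) (hM : min (3 / 4 + 3 * d / 8) 3 ≤ (M : ℝ))
    (m : ℕ) (hm : d / 2 ≤ (m : ℝ)) (hm' : (m : ℝ) ≤ 4 * (M : ℝ) / 3)
    (κ : ℝ) (hκ : 0 < κ) :
    ∃ C : ℝ, 0 < C ∧ ∀ (A : ℝ), 0 < A → ∀ T : Lp ℂ 2 μ →L[ℂ] Lp ℂ 2 μ,
      HardyBMO.CommutesWith H T → HardyBMO.PropertyH H κ m A T →
      (∃ (S : HardyBMO.Hardy H M →L[ℂ] HardyBMO.BMO H M)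
          (S' : ℝ → HardyBMO.Hardy H M →L[ℂ] HardyBMO.BMO H M),
        HardyBMO.ExtendsToBMO T S ∧
        (∀ s : ℝ, 0 < s → HardyBMO.ExtendsToBMO (T ∘L HardyBMO.heat H s) (S' s)) ∧
        ∀ s : ℝ, 0 < s → ‖S‖ + ‖S' s‖ ≤ C * A) ∧
      (∃ (D : HardyBMO.Hardy H M →L⋆[ℂ] StrongDual ℂ (HardyBMO.Hardy H M))
          (D' : ℝ → HardyBMO.Hardy H M →L⋆[ℂ] StrongDual ℂ (HardyBMO.Hardy H M)),
        HardyBMO.ExtendsToDual T D ∧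
        (∀ s : ℝ, 0 < s → HardyBMO.ExtendsToDual (T ∘L HardyBMO.heat H s) (D' s)) ∧
        ∀ s : ℝ, 0 < s → ‖D‖ + ‖D' s‖ ≤ C * A) := by
  have hM1 : 1 ≤ M := by
    by_contra hlt
    have : M = 0 := by omega
    subst this
    have : 0 < min (3 / 4 + 3 * d / 8) 3 := lt_min (by positivity) (by norm_num)
    rw [Nat.cast_zero] at hM
    linarith
  have hm1 : 1 ≤ m := by
    by_contra hlt
    have : m = 0 := by omega
    subst this
    rw [Nat.cast_zero] at hm
    linarith
  obtain ⟨C₁, hC₁, h1⟩ := HardyBMO.exists_bilinear_bound hdoubling hvolume hDG hDUE hH hd hM1 hm1 hκ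
  obtain ⟨C₂, hC₂, h2⟩ := HardyBMO.exists_hasBallBounds_mul_heat hdoubling hvolume hH hm hκ
  -- Each of the two norms in the sum is at most `C₁ * C₂ * A`.
  refine ⟨2 * (C₁ * C₂), by positivity, fun A hA T hT hTA => ?_⟩
  have hb := hTA.hasBallBounds hH hA.le hT
  have hK : 0 ≤ C₁ * C₂ * A := by positivity
  have hat : ∀ s, 0 < s → HardyBMO.AtomBound H M (C₁ * C₂ * A) (T * HardyBMO.heat H s) := by
    intro s hs
    have := h1 (C₂ * A) _ (by positivity) (h2 A T hA.le hb s hs)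
    rwa [← mul_assoc] at this
  -- By the semigroup law the regularisations of `T e^{-sH}` are again of the form `T e^{-(s+t)H}`,
  -- so `T e^{-sH}` inherits the same constant.
  have hat' : ∀ s, 0 < s → ∀ t, 0 < t →
      HardyBMO.AtomBound H M (C₁ * C₂ * A) (T * HardyBMO.heat H s * HardyBMO.heat H t) := by
    intro s hs t ht
    rw [mul_assoc T, ← HardyBMO.heat_add hH hs ht]
    exact hat _ (by positivity)
  have hcomm : ∀ s, Commute (HardyBMO.heat H s) T := fun s => hb.commute _
  obtain ⟨⟨S, hS, hSn⟩, D, hD, hDn⟩ :=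
    HardyBMO.exists_extensions hdoubling hvolume hDG hDUE hH hK hat hcomm
  have hex := fun s hs => HardyBMO.exists_extensions hdoubling hvolume hDG hDUE hH hK (hat' s hs)
    fun t => (hcomm t).mul_right (HardyBMO.commute_functionOf H _ _)
  have hS' : ∀ s, ∃ S', 0 < s → HardyBMO.ExtendsToBMO (M := M) (T ∘L HardyBMO.heat H s) S' ∧
      ‖S'‖ ≤ C₁ * C₂ * A := fun s => by
    by_cases hs : 0 < s
    · obtain ⟨S', h⟩ := (hex s hs).1
      exact ⟨S', fun _ => h⟩
    · exact ⟨0, fun h => absurd h hs⟩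
  have hD' : ∀ s, ∃ D', 0 < s → HardyBMO.ExtendsToDual (M := M) (T ∘L HardyBMO.heat H s) D' ∧
      ‖D'‖ ≤ C₁ * C₂ * A := fun s => by
    by_cases hs : 0 < s
    · obtain ⟨D', h⟩ := (hex s hs).2
      exact ⟨D', fun _ => h⟩
    · exact ⟨0, fun h => absurd h hs⟩
  choose S' hS' using hS'
  choose D' hD' using hD'
  refine ⟨⟨S, S', hS, fun s hs => (hS' s hs).1, fun s hs => ?_⟩,
    ⟨D, D', hD, fun s hs => (hD' s hs).1, fun s hs => ?_⟩⟩
  · linarith [(hS' s hs).2]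
  · linarith [(hD' s hs).2]
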